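/- **Conventions.** A Turing machine has a finite state set, a two-way infinite tape with alphabet $\{0,1,B\}$, one starting state, and at least one halting state; each halting state is either a yes or a no state. Inputs and outputs are strings in $\{0,1\}^*$, written from the head to the right and followed by $B$. $M$ accepts (rejects) $w$ if on input $w$ it halts in a yes (no) state; it computes the partial function sending $w$ to the output with which it halts on $w$. A set $L\subseteq\{0,1\}^*$ is recursive if some machine accepts all $w\in L$ and rejects all $w\notin L$. $\langle\cdot\rangle$ is a fixed injective, effective and effectively invertible encoding of finite objects in $\{0,1\}^*$. Let $\Delta$ be a countably infinite set of constants. Signatures are sets of symbols, with $\Delta$ as their set of constants, taken from an effectively encoded countable vocabulary; every predicate symbol is either an OWA- or a CWA-predicate symbol. Let $\sigma_D$ be a signature without function symbols of positive arity, and $\sigma_Q$ a signature without CWA-predicate symbols. A *database* is a partial function $D$ from the atoms $R(c_1,\dots,c_n)$ ($R\in\sigma_D$, $c_i\in\Delta$) to $\{1,0,-1\}$ such that only finitely many atoms have a value in $\{0,1\}$, $D$ is defined on all CWA-atoms, and only CWA-atoms have the value $-1$. $D_0$ *extends* $D$ if it does so as a partial function. Let $\mathscr D$ be the class of all databases, or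 that of all databases without the value $0$. Let $\mathscr Q$ be a set of first-order sentences of $\sigma_Q$ that is recursive, closed under conjunction and under injective renamings $\tau:\Delta\to\Delta$ of constants, and contains a non-tautology. For injective $\tau$, $\tau(D)$ is the database whose atoms with a value in $\{0,1\}$ are the $\tau(\alpha)$ with $D(\alpha)\in\{0,1\}$, with the same values, and in which all other CWA-atoms of $\sigma_D$ have the value $-1$. For a Turing machine $M$ let $\mathbb K(M)=\{(D,\phi)\in\mathscr D\times\mathscr Q: M\text{ accepts }\langle D,\phi\rangle\}$, and let $S(M)$ be the least subset of $\mathscr D\times\mathscr Q$ such that $(D,\phi)\in\mathscr D\times\mathscr Q$ belongs to $S(M)$ whenever 1. $M$ accepts $\langle D,\phi\rangle$; or 2. $\phi$ is a tautology; or 3. $(D,\psi)\in S(M)$ for some $\psi\in\mathscr Q$ with $\psi\models\phi$; or 4. $\phi=\psi\wedge\chi$ with $\psi,\chi\in\mathscr Q$ and $(D,\psi),(D,\chi)\in S(M)$; or 5. $(D',\phi)\in S(M)$ for some $D'\in\mathscr D$ such that $D$ extends $D'$; or 6. $(\tau(D),\tau(\phi))\in S(M)$ for some injective $\tau:\Delta\to\Delta$.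 A *star transformation* is a map $M\mapsto M^*$ from Turing machines to Turing machines such that $\langle M\rangle\mapsto\langle M^*\rangle$ is computed by a Turing machine, the set $\{\langle M^*\rangle : M \text{ a Turing machine}\}$ is recursive, and $M^*$ performs the search given by 1–6, i.e., for all $(D,\phi)\in\mathscr D\times\mathscr Q$, $M^*$ accepts $\langle D,\phi\rangle$ iff $(D,\phi)\in S(M)$. Given a star transformation, the formalism $\Theta$ is the map with domain $\{\langle M^*\rangle : M\text{ a Turing machine}\}$ (its *theories*) and $\Theta(\langle M^*\rangle)=\mathbb K(M^*)$. **Theorem.** Star transformations exist. For every star transformation and the corresponding $\Theta$, there is a Turing machine $N$ such that, for every Turing machine $M$ that computes a recursive function $p:\mathrm{dom}(\Theta)\to\mathrm{dom}(\Theta)$, the machine $N$ on input $\langle M\rangle$ halts and outputs a theory $\pi\in\mathrm{dom}(\Theta)$ with $\Theta(p(\pi))=\Theta(\pi)$. -/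

import Mathlib

open FirstOrder

namespace KRF

noncomputable section

/-! ### Turing machines over the tape alphabet `{0, 1, B}` -/

/-- A Turing machine with a two-way infinite tape. The tape alphabet is `Option Bool`, where
`none` is the blank `B`. `status q` is `none` if `q` is not a halting state, `some true` if `q` is a
**yes** state, and `some false` if `q` is a **no** state. `instr q a = some (q', a', d)` is the
instruction: in state `q` reading `a`, write `a'`, move the head in direction `d`, enter `q'`. -/
structure TM where
  numStates : ℕ
  start : Fin numStates
  status : Fin numStates → Option Bool
  exists_halting : ∃ q, status q ≠ none
  instr : Fin numStates → Option Bool → Option (Fin numStates × Option Bool × Turing.Dir)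

namespace TM

/-- A configuration: the current state, and the tape seen from the reading head. -/
structure Cfg (M : TM) where
  state : Fin M.numStates
  tape : Turing.Tape (Option Bool)

/-- One step. There is no step from a halting state, and none if no instruction applies
(a machine stuck in a state that is not a halting state does not count as halting). -/
def step (M : TM) (c : M.Cfg) : Option M.Cfg :=
  if M.status c.state = none then
    (M.instr c.state c.tape.head).map fun i => ⟨i.1, (c.tape.write i.2.1).move i.2.2⟩
  else none

/-- The initial configuration: the input is written from the head to the right, all other cells
are blank. -/
def init (M : TM) (w : List Bool) : M.Cfg :=
  ⟨M.start, Turing.Tape.mk₁ (w.map some)⟩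

/-- On input `w` the machine halts in a state of status `b` with the tape `T`. -/
def HaltsWith (M : TM) (w : List Bool) (b : Bool) (T : Turing.Tape (Option Bool)) : Prop :=
  ∃ c : M.Cfg, StateTransition.Reaches M.step (M.init w) c ∧ M.status c.state = some b ∧ c.tape = T

/-- `M` halts on input `w` in a **yes** state. -/
def Accepts (M : TM) (w : List Bool) : Prop := ∃ T, M.HaltsWith w true T

/-- `M` halts on input `w` in a **no** state. -/
def Rejects (M : TM) (w : List Bool) : Prop := ∃ T, M.HaltsWith w false T

/-- `M` halts on input `w` with output `v`: the cells from the head to the right hold `v`, followed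
by a blank (recall that `v[i]? = none` for `i = v.length`). -/
def Outputs (M : TM) (w v : List Bool) : Prop :=
  ∃ b T, M.HaltsWith w b T ∧ ∀ i : ℕ, i ≤ v.length → T.nth (i : ℤ) = v[i]?

/-- `M` computes the partial function `p` on `{0,1}*`. -/
def Computes (M : TM) (p : List Bool →. List Bool) : Prop :=
  ∀ w v, M.Outputs w v ↔ v ∈ p w

/-- `M` decides the language `L`. -/
def Decides (M : TM) (L : Set (List Bool)) : Prop :=
  ∀ w, (w ∈ L → M.Accepts w) ∧ (w ∉ L → M.Rejects w)

/-- A Turing machine as a natural number: the number of states, the starting state, and the table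
listing, for every state, its status and the instructions for `B`, `0` and `1`. -/
def code (M : TM) : ℕ :=
  let cell (q : Fin M.numStates) (a : Option Bool) : Option (ℕ × Option Bool × Bool) :=
    (M.instr q a).map fun i => (i.1.val, i.2.1, decide (i.2.2 = Turing.Dir.right))
  Encodable.encode (M.numStates, M.start.val,
    List.ofFn fun q => (M.status q, cell q none, cell q (some false), cell q (some true)))

/-- The encoding `⟪M⟫ ∈ {0,1}*` of a Turing machine. -/
def enc (M : TM) : List Bool := Nat.bits M.code

theorem code_injective : Function.Injective code := by
  rintro ⟨n, s, st, hh, ins⟩ ⟨n', s', st', hh', ins'⟩ h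
  have h := Encodable.encode_injective h
  simp only [Prod.mk.injEq] at h
  obtain ⟨rfl, hs, hl⟩ := h
  have hs : s = s' := Fin.ext hs
  have hl := List.ofFn_injective hl
  have key : ∀ x y : Option (Fin n × Option Bool × Turing.Dir),
      x.map (fun i => (i.1.val, i.2.1, decide (i.2.2 = Turing.Dir.right))) =
        y.map (fun i => (i.1.val, i.2.1, decide (i.2.2 = Turing.Dir.right))) → x = y := by
    intro x y
    refine fun e => Option.map_injective ?_ e
    rintro ⟨a, b, d⟩ ⟨a', b', d'⟩ e
    simp only [Prod.mk.injEq] at e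
    obtain ⟨e1, e2, e3⟩ := e
    have e1 : a = a' := Fin.ext e1
    subst e1 e2
    cases d <;> cases d' <;> simp_all
  have h1 : st = st' := funext fun q => (Prod.mk.inj (congrFun hl q)).1
  have h2 : ins = ins' := by
    funext q a
    have hq := congrFun hl q
    simp only [Prod.mk.injEq] at hq
    obtain ⟨-, ha, hb, hc⟩ := hq
    rcases a with _ | _ | _
    · exact key _ _ ha
    · exact key _ _ hb
    · exact key _ _ hc
  subst hs h1 h2
  rfl

theorem bits_injective : Function.Injective Nat.bits := by
  intro a b h
  induction a using Nat.binaryRec' generalizing b with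
  | zero =>
    induction b using Nat.binaryRec' with
    | zero => rfl
    | bit c n hc _ => rw [Nat.bits_append_bit n c hc] at h; simp at h
  | bit c n hc ih =>
    induction b using Nat.binaryRec' with
    | zero => rw [Nat.bits_append_bit n c hc] at h; simp at h
    | bit c' n' hc' _ =>
      rw [Nat.bits_append_bit n c hc, Nat.bits_append_bit n' c' hc'] at h
      obtain ⟨rfl, hn⟩ := List.cons.inj h
      rw [ih hn]

theorem enc_injective : Function.Injective enc := bits_injective.comp code_injective

end TM

/-- A language is recursive if some Turing machine decides it. -/
def IsRecursive (L : Set (List Bool)) : Prop := ∃ M : TM, M.Decides L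

/-! ### Symbols, signatures, first-order sentences -/

/-- The countably infinite set `Δ` of constants. -/
abbrev Const : Type := ℕ

/-- Every predicate symbol is either an OWA- or a CWA-predicate symbol. -/
inductive Kind
  | owa
  | cwa
  deriving DecidableEq

/-- The vocabulary from which all signatures are taken: `Δ` is the set of nullary function symbols,
and there are countably many function symbols of every positive arity and countably many
OWA-predicate symbols and CWA-predicate symbols of every arity. -/
abbrev vocab : FirstOrder.Language.{0, 0} where
  Functions := fun _ => ℕ
  Relations := fun _ => Kind × ℕ

/-- A signature that includes `Δ`: an arbitrary set of symbols of the vocabulary with `Δ` in it. -/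
structure Signature where
  funcs : ∀ n, Set (vocab.Functions n)
  preds : ∀ n, Set (vocab.Relations n)
  const_mem : ∀ c : Const, c ∈ funcs 0

/-- A database signature has no function symbols of positive arity. -/
def Signature.IsDatabaseSignature (σ : Signature) : Prop :=
  ∀ n, 0 < n → σ.funcs n = ∅

/-- A query signature has no CWA-predicate symbol. -/
def Signature.IsQuerySignature (σ : Signature) : Prop :=
  ∀ n, ∀ R ∈ σ.preds n, R.1 = Kind.owa

/-- First-order sentences. -/
abbrev Sentence : Type := vocab.Sentence

/-- All symbols of the term `t` belong to `σ`. -/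
def TermOver (σ : Signature) {α : Type} : vocab.Term α → Prop
  | .var _ => True
  | .func (l := l) f ts => f ∈ σ.funcs l ∧ ∀ i, TermOver σ (ts i)

/-- All symbols of the formula `φ` belong to `σ`. -/
def FormulaOver (σ : Signature) {α : Type} : {n : ℕ} → vocab.BoundedFormula α n → Prop
  | _, .falsum => True
  | _, .equal t u => TermOver σ t ∧ TermOver σ u
  | _, .rel (l := l) R ts => R ∈ σ.preds l ∧ ∀ i, TermOver σ (ts i)
  | _, .imp φ ψ => FormulaOver σ φ ∧ FormulaOver σ ψ
  | _, .all φ => FormulaOver σ φ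

/-- `φ ⊨ ψ`. -/
def Entails (φ ψ : Sentence) : Prop :=
  ({φ} : vocab.Theory).ModelsBoundedFormula ψ

/-- `φ` is true in all structures. -/
def Tautology (φ : Sentence) : Prop :=
  (∅ : vocab.Theory).ModelsBoundedFormula φ

/-- The map of symbols that replaces every constant `c` by `τ c`. -/
def renameHom (τ : Const → Const) : vocab →ᴸ vocab where
  onFunction := fun n f =>
    match n with
    | 0 => τ f
    | _ + 1 => f
  onRelation := fun _ R => R

/-- The sentence `τ(φ)`. -/
def renameSentence (τ : Const → Const) (φ : Sentence) : Sentence :=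
  (renameHom τ).onSentence φ

/-- A predicate symbol as a natural number. -/
def codePred (R : Kind × ℕ) : ℕ := Encodable.encode (decide (R.1 = Kind.cwa), R.2)

/-- A term (with bound variables only) as a natural number. -/
def codeTerm {n : ℕ} : vocab.Term (Empty ⊕ Fin n) → ℕ
  | .var (.inl x) => x.elim
  | .var (.inr i) => Nat.pair 0 i.val
  | .func (l := l) f ts =>
      Nat.pair 1 (Nat.pair l (Nat.pair f (Encodable.encode (List.ofFn fun i => codeTerm (ts i)))))

/-- A formula (with bound variables only) as a natural number. -/
def codeFormula : {n : ℕ} → vocab.BoundedFormula Empty n → ℕ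
  | _, .falsum => Nat.pair 0 0
  | _, .equal t u => Nat.pair 1 (Nat.pair (codeTerm t) (codeTerm u))
  | _, .rel (l := l) R ts =>
      Nat.pair 2 (Nat.pair l (Nat.pair (codePred R)
        (Encodable.encode (List.ofFn fun i => codeTerm (ts i)))))
  | _, .imp φ ψ => Nat.pair 3 (Nat.pair (codeFormula φ) (codeFormula ψ))
  | _, .all φ => Nat.pair 4 (codeFormula φ)

theorem codePred_injective : Function.Injective codePred := by
  rintro ⟨k, a⟩ ⟨k', a'⟩ h
  have h := Encodable.encode_injective h
  cases k <;> cases k' <;> simp_all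

theorem codeTerm_injective {n : ℕ} : Function.Injective (codeTerm (n := n)) := by
  intro t
  induction t with
  | var x =>
    rcases x with x | i
    · exact x.elim
    intro u h
    rcases u with (x | j) | ⟨f, ts⟩
    · exact x.elim
    · simp only [codeTerm, Nat.pair_eq_pair] at h
      rw [Fin.ext h.2]
    · simp [codeTerm, Nat.pair_eq_pair] at h
  | func f ts ih =>
    intro u h
    rcases u with (x | j) | ⟨f', ts'⟩
    · exact x.elim
    · simp [codeTerm, Nat.pair_eq_pair] at h
    · simp only [codeTerm, Nat.pair_eq_pair] at h
      obtain ⟨-, rfl, rfl, h⟩ := h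
      have h := List.ofFn_injective (Encodable.encode_injective h)
      have : ts = ts' := funext fun i => ih i (congrFun h i)
      rw [this]

theorem codeFormula_injective {n : ℕ} : Function.Injective (codeFormula (n := n)) := by
  intro φ
  induction φ with
  | falsum => intro ψ h; cases ψ <;> simp_all [codeFormula, Nat.pair_eq_pair]
  | equal t u =>
    intro ψ h
    cases ψ <;> simp only [codeFormula, Nat.pair_eq_pair] at h <;> try omega
    rw [codeTerm_injective h.2.1, codeTerm_injective h.2.2]
  | rel R ts =>
    intro ψ h
    cases ψ <;> simp only [codeFormula, Nat.pair_eq_pair] at h <;> try omega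
    obtain ⟨-, rfl, hR, h⟩ := h
    have h := List.ofFn_injective (Encodable.encode_injective h)
    rw [codePred_injective hR]
    congr 1
    exact funext fun i => codeTerm_injective (congrFun h i)
  | imp φ ψ ih₁ ih₂ =>
    intro χ h
    cases χ <;> simp only [codeFormula, Nat.pair_eq_pair] at h <;> try omega
    rw [ih₁ h.2.1, ih₂ h.2.2]
  | all φ ih =>
    intro ψ h
    cases ψ <;> simp only [codeFormula, Nat.pair_eq_pair] at h <;> try omega
    rw [ih h.2]

/-- The encoding of a sentence in `{0,1}*`. -/
def encSentence (φ : Sentence) : List Bool := Nat.bits (codeFormula φ)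

/-- A query language of the signature `σ`. -/
structure IsQueryLanguage (σ : Signature) (𝒬 : Set Sentence) : Prop where
  sentencesOver : ∀ φ ∈ 𝒬, FormulaOver σ φ
  recursive : IsRecursive (encSentence '' 𝒬)
  conj : ∀ φ ∈ 𝒬, ∀ ψ ∈ 𝒬, φ ⊓ ψ ∈ 𝒬
  rename : ∀ τ : Const → Const, Function.Injective τ → ∀ φ ∈ 𝒬, renameSentence τ φ ∈ 𝒬
  nontrivial : ∃ φ ∈ 𝒬, ¬ Tautology φ

/-! ### Databases -/

/-- An atom without variables and equality, `R(c₁, …, cₙ)` with `cᵢ ∈ Δ`. -/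
structure GroundAtom where
  arity : ℕ
  pred : vocab.Relations arity
  args : Fin arity → Const

/-- The atom belongs to `Fact(σ)`. -/
def GroundAtom.IsFact (σ : Signature) (α : GroundAtom) : Prop := α.pred ∈ σ.preds α.arity

/-- The predicate symbol of the atom is a CWA-predicate symbol. -/
def GroundAtom.IsCWA (α : GroundAtom) : Prop := α.pred.1 = Kind.cwa

/-- The atom `τ(α)`. -/
def GroundAtom.rename (τ : Const → Const) (α : GroundAtom) : GroundAtom :=
  ⟨α.arity, α.pred, fun i => τ (α.args i)⟩

/-- A `σ`-database: a partial function from `Fact(σ)` to `{1, 0, -1}`. Only finitely many atoms are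
observed (have value `1` or `0`), and it is defined on all CWA-atoms of `σ`. The value `-1`
(not observed, but determined by the closed-world rules) is for CWA-atoms only, so that a database
is a finite object, given by its observed facts. -/
structure Database (σ : Signature) where
  val : GroundAtom → Option SignType
  isFact : ∀ α, val α ≠ none → α.IsFact σ
  finite : {α | val α = some 1 ∨ val α = some 0}.Finite
  complete : ∀ α : GroundAtom, α.IsFact σ → α.IsCWA → val α ≠ none
  neg_cwa : ∀ α, val α = some (-1) → α.IsCWA

namespace Database

variable {σ : Signature}

/-- `D₀` extends `D` (as a partial function). -/
def Extends (D₀ D : Database σ) : Prop := ∀ α v, D.val α = some v → D₀.val α = some v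

/-- There are no negative facts in `D`. -/
def IsPositive (D : Database σ) : Prop := ∀ α, D.val α ≠ some 0

open Classical in
/-- The database `τ(D)`: its observed facts are `τ(α)`, for the observed facts `α` of `D`, with the
same values (`τ` is injective wherever this is used); all the other CWA-atoms of `σ` have the
value `-1`. -/
def rename (τ : Const → Const) (D : Database σ) : Database σ where
  val := fun β =>
    if ∃ α, α.rename τ = β ∧ D.val α = some 1 then some 1
    else if ∃ α, α.rename τ = β ∧ D.val α = some 0 then some 0
    else if β.IsFact σ ∧ β.IsCWA then some (-1)
    else none
  isFact := by
    intro β h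
    split_ifs at h with h1 h2 h3
    · obtain ⟨α, rfl, hα⟩ := h1
      exact (D.isFact α (by simp [hα]) : _)
    · obtain ⟨α, rfl, hα⟩ := h2
      exact (D.isFact α (by simp [hα]) : _)
    · exact h3.1
    · exact absurd rfl h
  finite := by
    refine (D.finite.image (GroundAtom.rename τ)).subset ?_
    intro β h
    simp only [Set.mem_ofPred_eq] at h
    split_ifs at h with h1 h2 h3
    · obtain ⟨α, e, hα⟩ := h1
      exact ⟨α, Or.inl hα, e⟩
    · obtain ⟨α, e, hα⟩ := h2
      exact ⟨α, Or.inr hα, e⟩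
    · exact absurd h (by decide)
    · simp at h
  complete := by
    intro β h1 h2
    split_ifs with h3 h4 h5 <;> simp_all
  neg_cwa := by
    intro β h
    split_ifs at h with h1 h2 h3
    · exact absurd h (by decide)
    · exact absurd h (by decide)
    · exact h3.2

theorem val_rename (τ : Const → Const) (hτ : Function.Injective τ) (D : Database σ)
    (α : GroundAtom) : (D.rename τ).val (α.rename τ) = D.val α := by
  have inj : ∀ α β : GroundAtom, α.rename τ = β.rename τ → α = β := by
    rintro ⟨n,R,a⟩ ⟨m,S,b⟩ h
    simp only [GroundAtom.rename, GroundAtom.mk.injEq] at h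
    obtain ⟨rfl, h1, h2⟩ := h
    simp only [heq_eq_eq] at h1 h2
    subst h1
    have : a = b := funext fun i => hτ (congrFun h2 i)
    rw [this]
  have e : ∀ v, (∃ β : GroundAtom, β.rename τ = α.rename τ ∧ D.val β = some v) ↔ D.val α = some v :=
    fun v => ⟨fun ⟨β, h, h'⟩ => by rwa [← inj β α h], fun h => ⟨α, rfl, h⟩⟩
  simp only [Database.rename, e]
  by_cases h0 : D.val α = none
  · simp only [h0]
    have : ¬ (α.IsFact σ ∧ α.IsCWA) := fun h => D.complete α h.1 h.2 h0
    simp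
    exact fun h1 h2 => this ⟨h1, h2⟩
  · obtain ⟨v, hv⟩ := Option.ne_none_iff_exists'.1 h0
    have hf := D.isFact α h0
    have hn := D.neg_cwa α
    rw [hv] at hn
    rcases v with _ | _ | _
    · rw [hv, if_neg (by decide), if_pos (by decide)]; rfl
    · rw [hv, if_neg (by decide), if_neg (by decide), if_pos ⟨hf, hn rfl⟩]; rfl
    · rw [hv, if_pos (by decide)]; rfl

/-- An observed fact with its value, as a natural number. -/
def codeFact (α : GroundAtom) (b : Bool) : ℕ :=
  Encodable.encode (codePred α.pred, List.ofFn α.args, b)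

/-- The finite set of the codes of all observed facts. -/
def factCodes (D : Database σ) : Set ℕ :=
  {k | ∃ α, (D.val α = some 1 ∧ k = codeFact α true) ∨ (D.val α = some 0 ∧ k = codeFact α false)}

theorem factCodes_finite (D : Database σ) : D.factCodes.Finite := by
  refine ((D.finite.image fun α => codeFact α true).union
    (D.finite.image fun α => codeFact α false)).subset ?_
  rintro k ⟨α, ⟨h, rfl⟩ | ⟨h, rfl⟩⟩
  · exact Or.inl ⟨α, Or.inl h, rfl⟩
  · exact Or.inr ⟨α, Or.inr h, rfl⟩

/-- A database as a natural number: the increasing list of the codes of its observed facts. -/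
def code (D : Database σ) : ℕ :=
  Encodable.encode (D.factCodes_finite.toFinset.sort (· ≤ ·))

theorem codeFact_injective {α β : GroundAtom} {b c : Bool} (h : codeFact α b = codeFact β c) :
    α = β ∧ b = c := by
  obtain ⟨n, R, a⟩ := α
  obtain ⟨m, S, a'⟩ := β
  have h := Encodable.encode_injective h
  simp only [Prod.mk.injEq] at h
  obtain ⟨h1, h2, h3⟩ := h
  have hnm : n = m := by simpa using congrArg List.length h2
  subst hnm
  have h1 : R = S := codePred_injective h1
  have h2 : a = a' := List.ofFn_injective h2
  subst h1 h2
  exact ⟨rfl, h3⟩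

theorem code_injective : Function.Injective (code (σ := σ)) := by
  intro D E h
  have h := Encodable.encode_injective h
  have h : D.factCodes = E.factCodes := by
    have := congrArg List.toFinset h
    simpa using this
  have mem1 : ∀ (D : Database σ) α, codeFact α true ∈ D.factCodes ↔ D.val α = some 1 := by
    refine fun D α => ⟨?_, fun h => ⟨α, Or.inl ⟨h, rfl⟩⟩⟩
    rintro ⟨β, ⟨hβ, e⟩ | ⟨hβ, e⟩⟩
    · rwa [(codeFact_injective e).1]
    · exact absurd (codeFact_injective e).2 (by decide)
  have mem0 : ∀ (D : Database σ) α, codeFact α false ∈ D.factCodes ↔ D.val α = some 0 := by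
    refine fun D α => ⟨?_, fun h => ⟨α, Or.inr ⟨h, rfl⟩⟩⟩
    rintro ⟨β, ⟨hβ, e⟩ | ⟨hβ, e⟩⟩
    · exact absurd (codeFact_injective e).2 (by decide)
    · rwa [(codeFact_injective e).1]
  have neg : ∀ (D E : Database σ) α, D.factCodes = E.factCodes →
      D.val α = some (-1) → E.val α = some (-1) := by
    intro D E α h hα
    have hE : E.val α ≠ none := E.complete α (D.isFact α (by simp [hα])) (D.neg_cwa α hα)
    obtain ⟨v, hv⟩ := Option.ne_none_iff_exists'.1 hE
    rcases v with _ | _ | _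
    · have := (mem0 D α).1 (h ▸ (mem0 E α).2 hv)
      rw [hα] at this
      exact absurd this (by decide)
    · exact hv
    · have := (mem1 D α).1 (h ▸ (mem1 E α).2 hv)
      rw [hα] at this
      exact absurd this (by decide)
  have hv : D.val = E.val := by
    funext α
    ext v
    rcases v with _ | _ | _
    · exact (mem0 D α).symm.trans ((by rw [h]) : _ ↔ _) |>.trans (mem0 E α)
    · exact ⟨neg D E α h, neg E D α h.symm⟩
    · exact (mem1 D α).symm.trans ((by rw [h]) : _ ↔ _) |>.trans (mem1 E α)
  cases D; cases E; congr

end Database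

/-- The encoding `⟪D, φ⟫ ∈ {0,1}*` of a database together with a sentence. -/
def encPair {σ : Signature} (D : Database σ) (φ : Sentence) : List Bool :=
  Nat.bits (Nat.pair D.code (codeFormula φ))

theorem encPair_injective {σ : Signature} {D E : Database σ} {φ ψ : Sentence}
    (h : encPair D φ = encPair E ψ) : D = E ∧ φ = ψ := by
  have h := TM.bits_injective h
  rw [Nat.pair_eq_pair] at h
  exact ⟨Database.code_injective h.1, codeFormula_injective h.2⟩

/-- The class of all `σ`-databases. -/
def allDatabases (σ : Signature) : Set (Database σ) := Set.univ

/-- The class of all positive `σ`-databases. -/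
def posDatabases (σ : Signature) : Set (Database σ) := {D | D.IsPositive}

/-! ### The transformation `M ↦ M*` and the canonical formalism `Θ` -/

/-- `𝕂(M)`: the pairs in `𝒟 × 𝒬` whose encodings `M` accepts. -/
def acceptedPairs {σ : Signature} (𝒟 : Set (Database σ)) (𝒬 : Set Sentence) (M : TM) :
    Set (Database σ × Sentence) :=
  {x | x.1 ∈ 𝒟 ∧ x.2 ∈ 𝒬 ∧ M.Accepts (encPair x.1 x.2)}

/-- `SearchSucceeds 𝒟 𝒬 M D φ`: the search that `M*` performs on `(D, φ) ∈ 𝒟 × 𝒬` succeeds. The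
six clauses are the six parts of the search; the recursive calls are searches of the same kind, and
a search succeeds only if this is witnessed by a finite tree of such calls. -/
inductive SearchSucceeds {σ : Signature} (𝒟 : Set (Database σ)) (𝒬 : Set Sentence) (M : TM) :
    Database σ → Sentence → Prop
  | simulate {D : Database σ} {φ : Sentence} (hD : D ∈ 𝒟) (hφ : φ ∈ 𝒬)
      (h : M.Accepts (encPair D φ)) : SearchSucceeds 𝒟 𝒬 M D φ
  | tautology {D : Database σ} {φ : Sentence} (hD : D ∈ 𝒟) (hφ : φ ∈ 𝒬)
      (h : Tautology φ) : SearchSucceeds 𝒟 𝒬 M D φ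
  | implication {D : Database σ} {φ ψ : Sentence} (hD : D ∈ 𝒟) (hφ : φ ∈ 𝒬) (hψ : ψ ∈ 𝒬)
      (h : Entails ψ φ) (ih : SearchSucceeds 𝒟 𝒬 M D ψ) : SearchSucceeds 𝒟 𝒬 M D φ
  | conjunction {D : Database σ} {ψ χ : Sentence} (hD : D ∈ 𝒟) (hψχ : ψ ⊓ χ ∈ 𝒬) (hψ : ψ ∈ 𝒬)
      (hχ : χ ∈ 𝒬) (ih₁ : SearchSucceeds 𝒟 𝒬 M D ψ) (ih₂ : SearchSucceeds 𝒟 𝒬 M D χ) :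
      SearchSucceeds 𝒟 𝒬 M D (ψ ⊓ χ)
  | extension {D D' : Database σ} {φ : Sentence} (hD : D ∈ 𝒟) (hD' : D' ∈ 𝒟) (hφ : φ ∈ 𝒬)
      (h : D.Extends D') (ih : SearchSucceeds 𝒟 𝒬 M D' φ) : SearchSucceeds 𝒟 𝒬 M D φ
  | renaming {D : Database σ} {φ : Sentence} (hD : D ∈ 𝒟) (hφ : φ ∈ 𝒬) (τ : Const → Const)
      (hτ : Function.Injective τ)
      (ih : SearchSucceeds 𝒟 𝒬 M (D.rename τ) (renameSentence τ φ)) : SearchSucceeds 𝒟 𝒬 M D φ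

/-- `star` is an implementation of the transformation `M ↦ M*`: it is effective, the set of all
encodings `⟪M*⟫` is recursive, and on the (encoded) pairs in `𝒟 × 𝒬` the machine `M*` performs the
search based on `M`, accepting iff the search succeeds. -/
structure IsStarTransformation {σ : Signature} (𝒟 : Set (Database σ)) (𝒬 : Set Sentence)
    (star : TM → TM) : Prop where
  effective : ∃ T : TM, ∀ M : TM, T.Outputs M.enc (star M).enc
  recursive_range : IsRecursive (Set.range fun M => (star M).enc)
  accepts_iff : ∀ M : TM, ∀ D ∈ 𝒟, ∀ φ ∈ 𝒬,
    (star M).Accepts (encPair D φ) ↔ SearchSucceeds 𝒟 𝒬 M D φ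

/-- The formalism `Θ`, a partial map on `{0,1}*`: its theories are the strings `⟪M*⟫`, and it maps
`⟪M*⟫` to `𝕂(M*)`. (The encoding of machines is injective, see `TM.enc_injective`, so the union has
just one member.) -/
def Theta {σ : Signature} (𝒟 : Set (Database σ)) (𝒬 : Set Sentence) (star : TM → TM) :
    List Bool →. Set (Database σ × Sentence) :=
  fun π => ⟨∃ M : TM, (star M).enc = π,
    fun _ => ⋃ (M : TM) (_ : (star M).enc = π), acceptedPairs 𝒟 𝒬 (star M)⟩

end

end KRF

/-! The fixed point comes from Kleene's recursion theorem together with the idempotence of the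
search. Let `M` compute `p`. Self-reference gives a machine `M₀` that on input `w` finds `⟪M₀*⟫`,
runs `M` on it to get `p(⟪M₀*⟫) = ⟪M₁*⟫`, and simulates `M₁*` on `w`. So `M₀` and `M₁*` accept the
same strings, whence `S(M₀) = S(M₁*)`. The pairs accepted by `M₁*` are those of `S(M₁)`, which is
already closed under the search clauses, so `S(M₁*) = S(M₁)`. Hence `M₀*` and `M₁*` accept the same
pairs, and `π = ⟪M₀*⟫` is as required. The machine `N` only has to compute `⟪M₀*⟫` from `⟪M⟫`. This
is `IsStarTransformation.exists_fixedPoint` with `IsStarTransformation.acceptedPairs_eq`, which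
rests on `SearchSucceeds.of_accepts`.

Self-reference needs little: `U.hardwire a` runs `U` on `1ᵃ0w`, and its code is a primitive
recursive function of `a` and the code of `U`. If `a` is the pair of the codes of `M` and of `U`,
then `U` can rebuild from `a` the code of the very machine `U.hardwire a`.

Star transformations exist because `S(M)` is recursively enumerable uniformly in `M`: one machine
`U` performs the search for all `M`, and `M*` is `U` with the code of `M` hard-wired. The range is
recursive since the hard-wired argument is bounded by the code of the machine. The search clauses
must first be turned into rules on numbers (`searchCode_iff`). An injective renaming matters only on
the finitely many constants in play, where it is a product of transpositions (`exists_actSwaps`).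
Extension of databases becomes a condition on the sets of observed facts (`Database.extends_iff`).
Entailment and tautology need the completeness theorem (`entails_iff`, `tautology_iff`).

Completeness is reduced to propositional logic. A statement is a formula with names for the values
of its variables; a name stands for the value of a term or for a Henkin counterexample to a
universal formula. The truth conditions and the laws of equality forbid certain finite lists of
signed statements. A list of signed statements is either refuted by a finite tree of case
distinctions or satisfied by a valuation that respects all the prohibitions, and then the names
modulo equality form a structure.

Recursive enumerability is taken in the form `RE`, with a primitive recursive matrix, which makes
closure properties easy. The link to machines goes both ways: `HaltsCode` simulates a machine given
by its code, and `RE.exists_TM` builds a machine for any single-valued `RE` relation by an unbounded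
search, written as a counter program and compiled into machine fragments. -/

namespace KRF

/-! ### Primitive recursive functions and `Σ₁` predicates -/

section PR

variable {α β γ δ σ : Type} [Primcodable α] [Primcodable β] [Primcodable γ] [Primcodable δ]
  [Primcodable σ]

/-- Primitive recursive functions, in a form suited to the tactic `fun_prop`. -/
@[fun_prop]
def PR (f : α → β) : Prop := Primrec f

namespace PR

@[fun_prop] theorem id : PR (fun a : α => a) := Primrec.id
@[fun_prop] theorem const (b : β) : PR (fun _ : α => b) := Primrec.const b
@[fun_prop] theorem comp {f : β → γ} {g : α → β} (hf : PR f) (hg : PR g) :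
    PR (fun a => f (g a)) := Primrec.comp hf hg
@[fun_prop] theorem fst {f : α → β × γ} (hf : PR f) : PR (fun a => (f a).1) := Primrec.fst.comp hf
@[fun_prop] theorem snd {f : α → β × γ} (hf : PR f) : PR (fun a => (f a).2) := Primrec.snd.comp hf
@[fun_prop] theorem mk {f : α → β} {g : α → γ} (hf : PR f) (hg : PR g) :
    PR (fun a => (f a, g a)) := Primrec.pair hf hg
@[fun_prop] theorem natPair {f g : α → ℕ} (hf : PR f) (hg : PR g) :
    PR (fun a => Nat.pair (f a) (g a)) := Primrec₂.natPair.comp hf hg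
@[fun_prop] theorem natUnpair {f : α → ℕ} (hf : PR f) :
    PR (fun a => Nat.unpair (f a)) := Primrec.unpair.comp hf
@[fun_prop] theorem add {f g : α → ℕ} (hf : PR f) (hg : PR g) :
    PR (fun a => f a + g a) := Primrec.nat_add.comp hf hg
@[fun_prop] theorem sub {f g : α → ℕ} (hf : PR f) (hg : PR g) :
    PR (fun a => f a - g a) := Primrec.nat_sub.comp hf hg
@[fun_prop] theorem mul {f g : α → ℕ} (hf : PR f) (hg : PR g) :
    PR (fun a => f a * g a) := Primrec.nat_mul.comp hf hg
@[fun_prop] theorem bodd {f : α → ℕ} (hf : PR f) : PR (fun a => Nat.bodd (f a)) :=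
  Primrec.nat_bodd.comp hf
@[fun_prop] theorem div2 {f : α → ℕ} (hf : PR f) : PR (fun a => Nat.div2 (f a)) :=
  Primrec.nat_div2.comp hf
@[fun_prop] theorem encode {f : α → β} (hf : PR f) : PR (fun a => Encodable.encode (f a)) :=
  Primrec.encode.comp hf
@[fun_prop] theorem decode {f : α → ℕ} (hf : PR f) :
    PR (fun a => (Encodable.decode (f a) : Option β)) := Primrec.decode.comp hf
@[fun_prop] theorem some {f : α → β} (hf : PR f) : PR (fun a => Option.some (f a)) :=
  Primrec.option_some.comp hf
@[fun_prop] theorem isSome {f : α → Option β} (hf : PR f) : PR (fun a => (f a).isSome) :=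
  Primrec.option_isSome.comp hf
@[fun_prop] theorem getD {f : α → Option β} {g : α → β} (hf : PR f) (hg : PR g) :
    PR (fun a => (f a).getD (g a)) := Primrec.option_getD.comp hf hg
@[fun_prop] theorem elim {f : α → Option β} {g : α → γ} {h : α → β → γ} (hf : PR f) (hg : PR g)
    (hh : PR (fun p : α × β => h p.1 p.2)) : PR (fun a => (f a).elim (g a) (h a)) :=
  (Primrec.option_casesOn hf hg (Primrec₂.mk hh)).of_eq fun a => by cases f a <;> rfl
@[fun_prop] theorem optMap {f : α → Option β} {h : α → β → γ} (hf : PR f)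
    (hh : PR (fun p : α × β => h p.1 p.2)) : PR (fun a => (f a).map (h a)) :=
  Primrec.option_map hf (Primrec₂.mk hh)
@[fun_prop] theorem cond {c : α → Bool} {f g : α → β} (hc : PR c) (hf : PR f) (hg : PR g) :
    PR (fun a => bif c a then f a else g a) := Primrec.cond hc hf hg
@[fun_prop] theorem band {f g : α → Bool} (hf : PR f) (hg : PR g) : PR (fun a => f a && g a) :=
  (Primrec.dom_bool₂ _).comp hf hg
@[fun_prop] theorem bor {f g : α → Bool} (hf : PR f) (hg : PR g) : PR (fun a => f a || g a) :=
  (Primrec.dom_bool₂ _).comp hf hg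
@[fun_prop] theorem bnot {f : α → Bool} (hf : PR f) : PR (fun a => !(f a)) :=
  (Primrec.dom_bool _).comp hf
@[fun_prop] theorem decEq [DecidableEq β] {f g : α → β} (hf : PR f) (hg : PR g) :
    PR (fun a => decide (f a = g a)) := (Primrec.eq.comp hf hg).decide
@[fun_prop] theorem decLt {f g : α → ℕ} (hf : PR f) (hg : PR g) :
    PR (fun a => decide (f a < g a)) := (Primrec.nat_lt.comp hf hg).decide
@[fun_prop] theorem decLe {f g : α → ℕ} (hf : PR f) (hg : PR g) :
    PR (fun a => decide (f a ≤ g a)) := (Primrec.nat_le.comp hf hg).decide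
@[fun_prop] theorem cons {f : α → β} {g : α → List β} (hf : PR f) (hg : PR g) :
    PR (fun a => f a :: g a) := Primrec.list_cons.comp hf hg
@[fun_prop] theorem append {f g : α → List β} (hf : PR f) (hg : PR g) :
    PR (fun a => f a ++ g a) := Primrec.list_append.comp hf hg
@[fun_prop] theorem tail {f : α → List β} (hf : PR f) : PR (fun a => (f a).tail) :=
  Primrec.list_tail.comp hf
@[fun_prop] theorem length {f : α → List β} (hf : PR f) : PR (fun a => (f a).length) :=
  Primrec.list_length.comp hf
@[fun_prop] theorem range {f : α → ℕ} (hf : PR f) : PR (fun a => List.range (f a)) :=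
  Primrec.list_range.comp hf
@[fun_prop] theorem getElem? {f : α → List β} {g : α → ℕ} (hf : PR f) (hg : PR g) :
    PR (fun a => (f a)[g a]?) := Primrec.list_getElem?.comp hf hg
@[fun_prop] theorem headI [Inhabited β] {f : α → List β} (hf : PR f) : PR (fun a => (f a).headI) :=
  Primrec.list_headI.comp hf
@[fun_prop] theorem map {f : α → List β} {h : α → β → γ} (hf : PR f)
    (hh : PR (fun p : α × β => h p.1 p.2)) : PR (fun a => (f a).map (h a)) :=
  Primrec.list_map hf (Primrec₂.mk hh)
@[fun_prop] theorem foldr {f : α → List β} {g : α → γ} {h : α → β → γ → γ} (hf : PR f) (hg : PR g)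
    (hh : PR (fun p : α × β × γ => h p.1 p.2.1 p.2.2)) : PR (fun a => (f a).foldr (h a) (g a)) :=
  Primrec.list_foldr (h := fun a p => h a p.1 p.2) hf hg (Primrec₂.mk hh)
@[fun_prop] theorem all {f : α → List β} {h : α → β → Bool} (hf : PR f)
    (hh : PR (fun p : α × β => h p.1 p.2)) : PR (fun a => (f a).all (h a)) := by
  have : PR (fun a => (f a).foldr (fun b acc => h a b && acc) true) := by fun_prop
  refine Primrec.of_eq this fun a => ?_
  induction f a <;> simp_all
@[fun_prop] theorem any {f : α → List β} {h : α → β → Bool} (hf : PR f)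
    (hh : PR (fun p : α × β => h p.1 p.2)) : PR (fun a => (f a).any (h a)) := by
  have : PR (fun a => (f a).foldr (fun b acc => h a b || acc) false) := by fun_prop
  refine Primrec.of_eq this fun a => ?_
  induction f a <;> simp_all
@[fun_prop] theorem decMem [DecidableEq β] {f : α → β} {g : α → List β} (hf : PR f) (hg : PR g) :
    PR (fun a => decide (f a ∈ g a)) := by
  have : PR (fun a => (g a).any (fun b => decide (f a = b))) := by fun_prop
  refine Primrec.of_eq this fun a => ?_
  rw [Bool.eq_iff_iff]; simp
@[fun_prop] theorem decSubset [DecidableEq β] {f g : α → List β} (hf : PR f) (hg : PR g) :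
    PR (fun a => decide (f a ⊆ g a)) := by
  have : PR (fun a => (f a).all (fun b => decide (b ∈ g a))) := by fun_prop
  refine Primrec.of_eq this fun a => ?_
  rw [Bool.eq_iff_iff]; simp [List.subset_def]
@[fun_prop] theorem iterate {f : α → ℕ} {g : α → β} {h : α → β → β} (hf : PR f) (hg : PR g)
    (hh : PR (fun p : α × β => h p.1 p.2)) : PR (fun a => (h a)^[f a] (g a)) :=
  Primrec.nat_iterate hf hg (Primrec₂.mk hh)

@[fun_prop] theorem bits {f : α → ℕ} (hf : PR f) : PR (fun a => Nat.bits (f a)) := by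
  have h : Primrec₂ (fun (_ : Unit) n => Nat.bits n) := by
    -- The list `l` holds the values at `0, …, n - 1`, so its length is the argument `n`; the value
    -- at `n.div2` supplies all digits but the lowest.
    refine Primrec.nat_strong_rec _ (g := fun _ l => bif decide (l.length = 0) then Option.some []
      else (l[l.length.div2]?).map fun t => Nat.bodd l.length :: t) ?_ ?_
    · refine Primrec₂.mk (?_ : PR _)
      fun_prop
    · intro _ n
      rcases Nat.eq_zero_or_pos n with rfl | hn
      · simp
      · have h2 : n.div2 < n := by rw [Nat.div2_val]; omega
        have e := Nat.bits_append_bit n.div2 n.bodd (by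
          intro h; rw [← Nat.bit_bodd_div2 n, h] at hn; revert hn; cases n.bodd <;> simp)
        rw [Nat.bit_bodd_div2] at e
        have : n ≠ 0 := by omega
        simp [h2, e, this]
  exact Primrec.comp (Primrec₂.comp (f := fun (_ : Unit) n => Nat.bits n) h (Primrec.const ())
    Primrec.id) hf

end PR

/-! ### Recursively enumerable predicates and their closure properties -/

/-- `P` is recursively enumerable, in `Σ₁` form with a primitive recursive matrix. -/
def RE (P : α → Prop) : Prop := ∃ f : α × ℕ → Bool, PR f ∧ ∀ a, P a ↔ ∃ n, f (a, n) = true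

namespace RE

theorem of_eq {P Q : α → Prop} (h : RE P) (e : ∀ a, Q a ↔ P a) : RE Q := by
  obtain ⟨f, hf, h⟩ := h
  exact ⟨f, hf, fun a => (e a).trans (h a)⟩

theorem of_bool {f : α → Bool} (hf : PR f) : RE (fun a => f a = true) :=
  ⟨fun p => f p.1, by fun_prop, by simp⟩

theorem of_dec {P : α → Prop} [DecidablePred P] (hf : PR (fun a => decide (P a))) : RE P :=
  (of_bool hf).of_eq (by simp)

theorem comp {P : β → Prop} (h : RE P) {g : α → β} (hg : PR g) : RE (fun a => P (g a)) := by
  obtain ⟨f, hf, h⟩ := h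
  exact ⟨fun p => f (g p.1, p.2), by fun_prop, fun a => h _⟩

theorem and {P Q : α → Prop} (hP : RE P) (hQ : RE Q) : RE (fun a => P a ∧ Q a) := by
  obtain ⟨f, hf, h⟩ := hP
  obtain ⟨g, hg, h'⟩ := hQ
  refine ⟨fun p => f (p.1, p.2.unpair.1) && g (p.1, p.2.unpair.2), by fun_prop, fun a => ?_⟩
  beta_reduce
  rw [h, h']
  constructor
  · rintro ⟨⟨n, hn⟩, m, hm⟩
    exact ⟨Nat.pair n m, by simp [hn, hm]⟩
  · rintro ⟨n, hn⟩
    rw [Bool.and_eq_true] at hn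
    exact ⟨⟨_, hn.1⟩, _, hn.2⟩

theorem or {P Q : α → Prop} (hP : RE P) (hQ : RE Q) : RE (fun a => P a ∨ Q a) := by
  obtain ⟨f, hf, h⟩ := hP
  obtain ⟨g, hg, h'⟩ := hQ
  refine ⟨fun p => f p || g p, by fun_prop, fun a => ?_⟩
  beta_reduce
  rw [h, h', ← exists_or]
  simp

/-- The search index pairs a code of the witness with an index for `P`; numbers that decode to no
witness count as failures. -/
theorem ex {P : α → β → Prop} (h : RE (fun p : α × β => P p.1 p.2)) : RE (fun a => ∃ b, P a b) := by
  obtain ⟨f, hf, h⟩ := h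
  refine ⟨fun p => (Encodable.decode p.2.unpair.1 : Option β).elim false
    (fun b => f ((p.1, b), p.2.unpair.2)), by fun_prop, fun a => ?_⟩
  constructor
  · rintro ⟨b, hb⟩
    obtain ⟨n, hn⟩ := (h (a, b)).1 hb
    exact ⟨Nat.pair (Encodable.encode b) n, by simp [hn]⟩
  · rintro ⟨n, hn⟩
    cases e : (Encodable.decode n.unpair.1 : Option β) with
    | none => simp [e] at hn
    | some b => exact ⟨b, (h (a, b)).2 ⟨_, by simpa [e] using hn⟩⟩

/-- The image of a recursively enumerable set under a primitive recursive function. -/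
theorem image [DecidableEq β] {F : α → β} (hF : PR F) {Q : α → Prop} (hQ : RE Q) :
    RE (fun b => ∃ a, Q a ∧ F a = b) :=
  ex (P := fun b a => Q a ∧ F a = b)
    ((hQ.comp (by fun_prop)).and (of_dec (P := fun p : β × α => F p.2 = p.1) (by fun_prop)))

theorem range [DecidableEq β] {F : α → β} (hF : PR F) : RE (fun b => ∃ a, F a = b) :=
  (image hF (Q := fun _ => True) (of_dec (by simp; fun_prop))).of_eq (by simp)

end RE

/-! ### Inductive definitions with recursively enumerable rules -/

/-- The least set closed under the rules `R`: from all members of `l` infer `a`, where `R (l, a)`. -/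
inductive Der (R : List α × α → Prop) : α → Prop
  | mk (l : List α) (a : α) (h : R (l, a)) (ih : ∀ b ∈ l, Der R b) : Der R a

/-- A derivation, read from the end; ill-formed lines are skipped. -/
def derived [DecidableEq α] (f : (List α × α) × ℕ → Bool) (acc : List α)
    (s : List ((List α × α) × ℕ)) : List α :=
  s.foldr (fun x acc => bif f x && decide (x.1.1 ⊆ acc) then x.1.2 :: acc else acc) acc

/-- Needed to concatenate derivations: a derivation stays good when it starts from lines that are
already available. -/
theorem derived_mono {α : Type} [DecidableEq α] (f : (List α × α) × ℕ → Bool) {l l' : List α} (h : l ⊆ l')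
    (s : List ((List α × α) × ℕ)) : derived f l s ⊆ derived f l' s := by
  induction s with
  | nil => exact h
  | cons x s ih =>
    have e : ∀ l, derived f l (x :: s) = if f x = true ∧ x.1.1 ⊆ derived f l s then
        x.1.2 :: derived f l s else derived f l s := by
      intro l; simp [derived, Bool.cond_eq_ite]
    intro a ha
    rw [e] at ha ⊢
    by_cases h1 : f x = true ∧ x.1.1 ⊆ derived f l s
    · rw [if_pos h1] at ha
      rw [if_pos ⟨h1.1, fun b hb => ih (h1.2 hb)⟩]
      exact List.cons_subset_cons _ ih ha
    · rw [if_neg h1] at ha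
      split_ifs
      · exact List.mem_cons_of_mem _ (ih ha)
      · exact ih ha

theorem subset_derived {α : Type} [DecidableEq α] (f : (List α × α) × ℕ → Bool) (l : List α)
    (s : List ((List α × α) × ℕ)) : l ⊆ derived f l s := by
  induction s with
  | nil => exact fun _ h => h
  | cons x s ih =>
    simp only [derived, List.foldr_cons, Bool.cond_eq_ite] at *
    split_ifs
    · exact fun a ha => List.mem_cons_of_mem _ (ih ha)
    · exact ih

/-- A set inductively defined by recursively enumerable rules is recursively enumerable. -/
theorem RE.der [DecidableEq α] {R : List α × α → Prop} (hR : RE R) : RE (Der R) := by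
  obtain ⟨f, hf, h⟩ := hR
  have key : ∀ a, Der R a ↔ ∃ s, a ∈ derived f [] s := by
    intro a
    constructor
    · intro ha
      induction ha with
      | mk l a hr _ ih =>
        obtain ⟨n, hn⟩ := (h _).1 hr
        -- The premises are finitely many, so concatenating their derivations gives a single
        -- derivation that contains them all.
        have : ∃ s, l ⊆ derived f [] s := by
          -- What speaks of the whole list `l` is discarded, so that the induction on `l` concerns
          -- `ih` alone.
          clear hr hn h
          rename_i hder
          clear hder
          induction l with
          | nil => exact ⟨[], by simp⟩
          | cons b l ihl =>
            obtain ⟨s, hs⟩ := ihl fun b hb => ih b (List.mem_cons_of_mem _ hb)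
            obtain ⟨s', hs'⟩ := ih b List.mem_cons_self
            refine ⟨s' ++ s, ?_⟩
            have e : derived f [] (s' ++ s) = derived f (derived f [] s) s' := by
              simp [derived]
            rw [e]
            refine List.cons_subset.2 ⟨derived_mono f (List.nil_subset _) s' hs', ?_⟩
            exact fun a ha => subset_derived _ _ _ (hs ha)
        obtain ⟨s, hs⟩ := this
        refine ⟨((l, a), n) :: s, ?_⟩
        have hs' : l ⊆ List.foldr (fun x acc => bif f x && decide (x.1.1 ⊆ acc) then x.1.2 :: acc
          else acc) [] s := hs
        simp [derived, hn, hs']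
    · rintro ⟨s, hs⟩
      induction s generalizing a with
      | nil => simp [derived] at hs
      | cons x s ih =>
        simp only [derived, List.foldr_cons, Bool.cond_eq_ite, Bool.and_eq_true,
          decide_eq_true_eq] at hs ih
        split_ifs at hs with h1
        · rcases List.mem_cons.1 hs with rfl | hs
          · exact .mk x.1.1 _ ((h _).2 ⟨_, h1.1⟩) fun b hb => ih b (h1.2 hb)
          · exact ih a hs
        · exact ih a hs
  refine RE.of_eq (RE.ex (P := fun a s => a ∈ derived f [] s) ?_) key
  refine RE.of_dec ?_
  unfold derived
  fun_prop

end PR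

/-! ### Counter programs with one binary stack -/

/-- Programs over counters `0, 1, 2, …` and one stack of bits (its top is the end of the list). -/
inductive Prog
  | inc (i : ℕ)
  | dec (i : ℕ)
  | push (b : Bool)
  | pop (i : ℕ)
  | seq (p q : Prog)
  | loop (i : ℕ) (p : Prog)

/-- The contents of the counters and of the stack. -/
abbrev Store := (ℕ → ℕ) × List Bool

/-- The terminating runs of a program. `pop i` increases counter `i` by `1 + b`, where `b` is the bit
taken from the stack, and does nothing if the stack is empty; `dec i` needs a nonzero counter;
`loop i p` repeats `p` while counter `i` is not zero. -/
inductive Exec : Prog → Store → Store → Prop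
  | inc (i s w) : Exec (.inc i) (s, w) (Function.update s i (s i + 1), w)
  | dec (i s w) (h : s i ≠ 0) : Exec (.dec i) (s, w) (Function.update s i (s i - 1), w)
  | push (b s w) : Exec (.push b) (s, w) (s, w ++ [b])
  | popNil (i s) : Exec (.pop i) (s, []) (s, [])
  | pop (i s w b) : Exec (.pop i) (s, w ++ [b]) (Function.update s i (s i + (1 + b.toNat)), w)
  | seq {p q a b c} (h₁ : Exec p a b) (h₂ : Exec q b c) : Exec (.seq p q) a c
  | done {i p} {a : Store} (h : a.1 i = 0) : Exec (.loop i p) a a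
  | again {i p} {a b c : Store} (h : a.1 i ≠ 0) (h₁ : Exec p a b) (h₂ : Exec (.loop i p) b c) :
      Exec (.loop i p) a c

namespace Exec

theorem countdown {i : ℕ} {p : Prog} (F : ℕ → Store) (h0 : (F 0).1 i = 0)
    (h1 : ∀ n, (F (n + 1)).1 i ≠ 0) (h : ∀ n, Exec p (F (n + 1)) (F n)) (n : ℕ) :
    Exec (.loop i p) (F n) (F 0) := by
  induction n with
  | zero => exact .done h0
  | succ n ih => exact .again (h1 n) (h n) ih

theorem cast {p : Prog} {a b c : Store} (h : Exec p a b) (e : b = c) : Exec p a c := e ▸ h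

end Exec

namespace Prog

/-- Set counter `i` to zero. -/
def clear (i : ℕ) : Prog := .loop i (.dec i)

/-- Add counter `i` to counter `j` and set counter `i` to zero. -/
def move (i j : ℕ) : Prog := .loop i (.seq (.dec i) (.inc j))

/-- Add counter `i` to counter `j`, with the help of counter `t`. -/
def copy (i j t : ℕ) : Prog :=
  .seq (.loop i (.seq (.dec i) (.seq (.inc j) (.inc t)))) (move t i)

open Function in
theorem exec_clear (i : ℕ) (s : ℕ → ℕ) (w : List Bool) :
    Exec (clear i) (s, w) (update s i 0, w) := by
  have := Exec.countdown (i := i) (p := .dec i) (fun n => (update s i n, w)) (by simp) (by simp)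
    (fun n => (Exec.dec i _ w (by simp)).cast (by simp)) (s i)
  simpa [clear] using this

open Function in
theorem exec_move {i j : ℕ} (h : i ≠ j) (s : ℕ → ℕ) (w : List Bool) :
    Exec (move i j) (s, w) (update (update s j (s j + s i)) i 0, w) := by
  suffices ∀ n (s : ℕ → ℕ), s i = n →
      Exec (move i j) (s, w) (update (update s j (s j + s i)) i 0, w) from this _ s rfl
  intro n
  induction n with
  | zero =>
    intro s hs
    refine (Exec.done hs).cast ?_
    rw [hs, add_zero, update_eq_self, ← hs, update_eq_self]
  | succ n ih =>
    intro s hs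
    refine Exec.again (by simp [hs]) (.seq (.dec i s w (by simp [hs])) (.inc j _ w))
      ((ih _ ?_).cast ?_)
    · simp [h, hs]
    · ext x <;> simp only [update_apply]
      split_ifs <;> simp_all <;> omega

open Function in
theorem exec_copy {i j t : ℕ} (hij : i ≠ j) (hit : i ≠ t) (hjt : j ≠ t) (s : ℕ → ℕ) (w : List Bool)
    (ht : s t = 0) : Exec (copy i j t) (s, w) (update s j (s j + s i), w) := by
  have key : ∀ n (s : ℕ → ℕ), s i = n →
      Exec (.loop i (.seq (.dec i) (.seq (.inc j) (.inc t)))) (s, w)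
        (update (update (update s j (s j + s i)) t (s t + s i)) i 0, w) := by
    intro n
    induction n with
    | zero =>
      intro s hs
      refine (Exec.done hs).cast ?_
      ext x <;> simp only [update_apply]
      split_ifs <;> simp_all
    | succ n ih =>
      intro s hs
      refine Exec.again (by simp [hs]) (.seq (.dec i s w (by simp [hs])) (.seq (.inc j _ w)
        (.inc t _ w))) ((ih _ ?_).cast ?_)
      · simp [hij, hit, hs]
      · ext x <;> simp only [update_apply]
        split_ifs <;> simp_all <;> omega
  refine .seq (key _ s rfl) ((exec_move hit.symm _ w).cast ?_)
  ext x <;> simp only [update_apply]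
  split_ifs <;> simp_all

end Prog

open Function in
/-- Every primitive recursive function of counters `a i < k` is computed by a program that writes its
value to counter `k`, provided that all counters from `k` on are zero. -/
theorem exists_prog {n : ℕ} {f : List.Vector ℕ n → ℕ} (hf : Nat.Primrec' f) :
    ∀ (k : ℕ) (a : Fin n → ℕ), (∀ i, a i < k) → ∃ p : Prog, ∀ s w, (∀ j, k ≤ j → s j = 0) →
      Exec p (s, w) (update s k (f (List.Vector.ofFn fun i => s (a i))), w) := by
  induction hf with
  | zero =>
    intro k a ha
    refine ⟨.clear k, fun s w hs => Prog.exec_clear k s w⟩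
  | succ =>
    intro k a ha
    refine ⟨.seq (.copy (a 0) k (k + 1)) (.inc k), fun s w hs => ?_⟩
    have h0 := ha 0
    refine .seq (Prog.exec_copy (by omega) (by omega) (by omega) s w (hs _ (by omega)))
      ((Exec.inc k _ w).cast ?_)
    simp [hs k le_rfl, List.Vector.head_ofFn]
  | get i =>
    intro k a ha
    refine ⟨.copy (a i) k (k + 1), fun s w hs => ?_⟩
    have h0 := ha i
    refine (Prog.exec_copy (by omega) (by omega) (by omega) s w (hs _ (by omega))).cast ?_
    simp [hs k le_rfl]
  -- The values of the `g i` are put into the counters `k, …, k + n - 1`, and the value of `f` at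
  -- them into counter `k + n`; then the block is cleared and the result moved down to counter `k`.
  | @comp m n f g hf hg ihf ihg =>
    intro k a ha
    have args : ∀ m' (hm : m' ≤ n), ∃ p : Prog, ∀ s w, (∀ j, k ≤ j → s j = 0) →
        Exec p (s, w) (fun x => if h : k ≤ x ∧ x < k + m' then
          g ⟨x - k, by omega⟩ (List.Vector.ofFn fun i => s (a i)) else s x, w) := by
      intro m'
      induction m' with
      | zero =>
        intro _
        refine ⟨.clear k, fun s w hs => (Prog.exec_clear k s w).cast ?_⟩
        ext x
        · have := hs x
          simp only [update_apply]
          split_ifs with h1 h2 h2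
          · omega
          · rw [h1, hs k le_rfl]
          · omega
          · rfl
        · rfl
      | succ m' ih =>
        intro hm
        obtain ⟨p, hp⟩ := ih (by omega)
        obtain ⟨q, hq⟩ := ihg ⟨m', by omega⟩ (k + m') a (fun i => by have := ha i; omega)
        refine ⟨.seq p q, fun s w hs => .seq (hp s w hs) ((hq _ w ?_).cast ?_)⟩
        · intro j hj
          rw [dif_neg (by omega), hs j (by omega)]
        · have e : (fun i => if h : k ≤ a i ∧ a i < k + m' then
              g ⟨a i - k, by omega⟩ (List.Vector.ofFn fun i => s (a i)) else s (a i)) =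
              fun i => s (a i) := by
            funext i
            have := ha i
            rw [dif_neg (by omega)]
          refine Prod.ext (funext fun x => ?_) rfl
          simp only [update_apply]
          rw [e]
          by_cases h1 : x = k + m'
          · subst h1
            rw [if_pos rfl, dif_pos (by omega)]
            congr 2
            simp
          · rw [if_neg h1]
            by_cases h2 : k ≤ x ∧ x < k + m'
            · rw [dif_pos h2, dif_pos (by omega)]
            · rw [dif_neg h2, dif_neg (by omega)]
    have clears : ∀ m', ∃ p : Prog, ∀ s w,
        Exec p (s, w) (fun x => if k ≤ x ∧ x < k + m' then 0 else s x, w) ∨ m' = 0 := by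
      intro m'
      induction m' with
      | zero => exact ⟨.clear k, fun _ _ => .inr rfl⟩
      | succ m' ih =>
        obtain ⟨p, hp⟩ := ih
        rcases Nat.eq_zero_or_pos m' with rfl | hm
        · refine ⟨.clear k, fun s w => .inl ((Prog.exec_clear k s w).cast ?_)⟩
          refine Prod.ext (funext fun x => ?_) rfl
          simp only [update_apply]
          split_ifs <;> first | rfl | omega
        · refine ⟨.seq p (.clear (k + m')), fun s w => .inl ?_⟩
          refine .seq ((hp s w).resolve_right (by omega)) ((Prog.exec_clear _ _ w).cast ?_)
          refine Prod.ext (funext fun x => ?_) rfl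
          simp only [update_apply]
          split_ifs <;> first | rfl | omega
    obtain ⟨p, hp⟩ := args n le_rfl
    obtain ⟨q, hq⟩ := ihf (k + n) (fun i => k + i) (fun i => by omega)
    obtain ⟨c, hc⟩ := clears n
    -- Without inner functions the value of `f` lands in counter `k` directly, and `move` would have
    -- equal source and target.
    rcases Nat.eq_zero_or_pos n with rfl | hn
    · refine ⟨.seq p q, fun s w hs => .seq (hp s w hs) ((hq _ w ?_).cast ?_)⟩
      · intro j hj
        rw [dif_neg (by omega), hs j (by omega)]
      · refine Prod.ext (funext fun x => ?_) rfl
        simp only [update_apply]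
        rw [dif_neg (by omega)]
        congr 2
    · refine ⟨.seq p (.seq q (.seq c (.move (k + n) k))), fun s w hs => ?_⟩
      refine .seq (hp s w hs) (.seq (hq _ w ?_) (.seq ((hc _ w).resolve_right (by omega))
        ((Prog.exec_move (by omega) _ w).cast ?_)))
      · intro j hj
        rw [dif_neg (by omega), hs j (by omega)]
      · refine Prod.ext (funext fun x => ?_) rfl
        have e : (List.Vector.ofFn fun i : Fin n => if h : k ≤ k + (i : ℕ) ∧ k + (i : ℕ) < k + n then
            g ⟨k + (i : ℕ) - k, by omega⟩ (List.Vector.ofFn fun i => s (a i)) else s (k + i)) =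
            List.Vector.ofFn fun i => g i (List.Vector.ofFn fun i => s (a i)) := by
          congr 1
          funext i
          rw [dif_pos (by omega)]
          congr 2
          simp
        simp only [update_apply]
        rw [e]
        by_cases h1 : x = k
        · subst h1
          rw [if_neg (by omega), if_pos rfl, if_pos rfl, if_pos (by omega), if_neg (by omega),
            if_pos trivial, zero_add]
        · rw [if_neg h1, if_neg h1]
          by_cases h2 : x = k + n
          · rw [if_pos h2, hs x (by omega)]
          · rw [if_neg h2, if_neg h2]
            by_cases h3 : k ≤ x ∧ x < k + n
            · rw [if_pos h3, hs x (by omega)]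
            · rw [if_neg h3, dif_neg h3]
  -- Counter `k` holds the current value of the recursion, `k + 1` the recursion index, `k + 2` the
  -- number of rounds that remain, and `k + 3` receives the next value.
  | @prec n f g hf hg ihf ihg =>
    intro k a ha
    obtain ⟨p, hp⟩ := ihf k (fun i => a i.succ) (fun i => ha _)
    obtain ⟨q, hq⟩ := ihg (k + 3) (Fin.cons (k + 1) (Fin.cons k fun i => a i.succ)) (by
      intro i
      refine Fin.cases (by simp) (fun i => Fin.cases (by simp) (fun i => ?_) i) i
      simp only [Fin.cons_succ]
      have := ha i.succ
      omega)
    have h0 := ha 0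
    refine ⟨.seq p (.seq (.copy (a 0) (k + 2) (k + 3)) (.seq (.loop (k + 2)
      (.seq (.dec (k + 2)) (.seq q (.seq (.clear k) (.seq (.move (k + 3) k) (.inc (k + 1)))))))
      (.clear (k + 1)))), fun s w hs => ?_⟩
    set V := List.Vector.ofFn fun i => s (a (Fin.succ i)) with hV
    set R : ℕ → ℕ := fun m => Nat.rec (f V) (fun y IH => g (y ::ᵥ IH ::ᵥ V)) m with hR
    set N := s (a 0) with hN
    -- The store when `m` of the `N` rounds are still to come.
    let St : ℕ → Store := fun m =>
      (fun x => if x = k then R (N - m) else if x = k + 1 then N - m else if x = k + 2 then m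
        else s x, w)
    refine .seq (hp s w hs) (.seq (Exec.cast (Prog.exec_copy (by omega) (by omega) (by omega) _ w ?_)
      (c := St N) ?_) (.seq (b := St 0) ?_ ((Prog.exec_clear _ _ w).cast ?_)))
    · rw [update_of_ne (by omega), hs _ (by omega)]
    · refine Prod.ext (funext fun x => ?_) rfl
      simp only [update_apply, St, Nat.sub_self]
      have h1 := hs (k + 1) (by omega)
      have h2 := hs (k + 2) (by omega)
      rw [if_neg (by omega : k + 2 ≠ k), if_neg (by omega : a 0 ≠ k), h2]
      split_ifs <;> first | omega | rfl | simp_all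
    · have : ∀ m ≤ N, Exec (.loop (k + 2) (.seq (.dec (k + 2)) (.seq q (.seq (.clear k)
          (.seq (.move (k + 3) k) (.inc (k + 1))))))) (St m) (St 0) := by
        intro m
        induction m with
        | zero => exact fun _ => .done (by simp [St])
        | succ m ih =>
          intro hm
          refine .again (by simp [St]) (.seq (.dec _ _ w (by simp)) (.seq (hq _ w ?_)
            (.seq (Prog.exec_clear _ _ w) (.seq (Prog.exec_move (by omega) _ w)
              ((Exec.inc _ _ w).cast (c := St m) ?_))))) (ih (by omega))
          · intro j hj
            rw [update_of_ne (by omega), if_neg (by omega), if_neg (by omega), if_neg (by omega),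
              hs j (by omega)]
          · have e : g (List.Vector.ofFn fun i => update (fun x => if x = k then R (N - (m + 1)) else
                if x = k + 1 then N - (m + 1) else if x = k + 2 then m + 1 else s x) (k + 2)
                ((fun x => if x = k then R (N - (m + 1)) else
                if x = k + 1 then N - (m + 1) else if x = k + 2 then m + 1 else s x) (k + 2) - 1)
                ((Fin.cons (k + 1) (Fin.cons k fun i => a i.succ) : Fin (n + 2) → ℕ) i)) =
                R (N - m) := by
              have e1 : N - m = (N - (m + 1)) + 1 := by omega
              rw [e1]
              change _ = g (_ ::ᵥ R (N - (m + 1)) ::ᵥ V)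
              congr 1
              refine List.Vector.ext fun i => ?_
              rw [List.Vector.get_ofFn]
              refine Fin.cases ?_ (fun i => Fin.cases ?_ (fun i => ?_) i) i
              · simp
              · simp only [Fin.cons_succ, Fin.cons_zero, List.Vector.get_cons_succ]
                rw [List.Vector.get_zero, List.Vector.head_cons]
                simp
              · have := ha i.succ
                simp only [Fin.cons_succ, List.Vector.get_cons_succ, hV, List.Vector.get_ofFn]
                rw [update_of_ne (by omega), if_neg (by omega), if_neg (by omega),
                  if_neg (by omega)]
            refine Prod.ext (funext fun x => ?_) rfl
            rw [e]
            have h3 := hs (k + 3) (by omega)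
            simp only [update_apply, St]
            split_ifs <;> first | omega | rfl | skip
            all_goals simp_all
      exact this N le_rfl
    · refine Prod.ext (funext fun x => ?_) rfl
      have e : (List.Vector.ofFn fun i => s (a i)) = N ::ᵥ V := by
        simp [hV, hN, List.Vector.ofFn]
      have h1 := hs (k + 1) (by omega)
      have h2 := hs (k + 2) (by omega)
      simp only [update_apply, e, List.Vector.head_cons, List.Vector.tail_cons]
      split_ifs <;> first | omega | rfl | skip
      all_goals simp_all

/-! ### Strings and unbounded search in counter programs -/

/-- A bijective numbering of strings. -/
def num (w : List Bool) : ℕ := w.foldr (fun b n => 2 * n + 1 + b.toNat) 0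

@[simp] theorem num_nil : num [] = 0 := rfl
@[simp] theorem num_cons (b : Bool) (w : List Bool) : num (b :: w) = 2 * num w + 1 + b.toNat := rfl

/-- The counters given by a list. -/
def regs (l : List ℕ) : ℕ → ℕ := fun i => l.getD i 0

theorem update_regs (l : List ℕ) {i : ℕ} (h : i < l.length) (v : ℕ) :
    Function.update (regs l) i v = regs (l.set i v) := by
  funext j
  by_cases e : j = i
  · subst e; simp [regs, h]
  · have : i ≠ j := fun h => e h.symm
    simp [regs, e, this]

theorem regs_eq_zero {l : List ℕ} {k : ℕ} (h : ∀ x ∈ l.drop k, x = 0) (j : ℕ) (hj : k ≤ j) :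
    regs l j = 0 := by
  by_cases e : j < l.length
  · simp only [regs, List.getD_eq_getElem?_getD, List.getElem?_eq_getElem e, Option.getD_some]
    exact h _ (List.mem_drop_iff_getElem.2 ⟨j - k, by omega, by congr 1; omega⟩)
  · simp [regs, e]

open Function in
/-- A program that replaces a string on the stack by its number in counter `0`. -/
theorem exists_readProg : ∃ p : Prog, ∀ w,
    Exec p (regs [0, 0, 0, 0, 0, 0, 0], w) (regs [num w, 0, 0, 0, 0, 0, 0], []) := by
  -- After `pop 1`, counter `1` is `0` if the stack was empty and `1 + b` otherwise, so it is both
  -- the loop guard and the carrier of the bit. The body doubles counter `0` by way of counter `2`,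
  -- adds `1` and then `b`: this is Horner's rule for `num`.
  let body : Prog := .seq (.dec 1) (.seq (.move 0 2) (.seq
    (.loop 2 (.seq (.dec 2) (.seq (.inc 0) (.inc 0)))) (.seq (.inc 0) (.seq (.move 1 0) (.pop 1)))))
  refine ⟨.seq (.pop 1) (.loop 1 body), fun w => ?_⟩
  have double : ∀ w m a b, Exec (.loop 2 (.seq (.dec 2) (.seq (.inc 0) (.inc 0))))
      (regs [a, b, m, 0, 0, 0, 0], w) (regs [a + 2 * m, b, 0, 0, 0, 0, 0], w) := by
    intro w m
    induction m with
    | zero => exact fun a b => .done rfl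
    | succ m ih =>
      intro a b
      refine .again (by simp [regs]) (.seq (.dec _ _ _ (by simp [regs])) (.seq (.inc _ _ _)
        ((Exec.inc _ _ _).cast (c := (regs [a + 2, b, m, 0, 0, 0, 0], w)) ?_)))
        ((ih (a + 2) b).cast ?_)
      · rw [update_regs _ (by simp), update_regs _ (by simp), update_regs _ (by simp)]
        simp [regs]
      · rw [show a + 2 * (m + 1) = a + 2 + 2 * m by ring]
  have pops : ∀ u b a, Exec (.pop 1) (regs [a, 0, 0, 0, 0, 0, 0], u ++ [b])
      (regs [a, 1 + b.toNat, 0, 0, 0, 0, 0], u) := by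
    intro u b a
    refine (Exec.pop _ _ _ _).cast ?_
    rw [update_regs _ (by simp)]
    simp [regs]
  have step : ∀ u (b : Bool) a st, Exec (.pop 1) (regs [2 * a + 1 + b.toNat, 0, 0, 0, 0, 0, 0], u) st →
      Exec body (regs [a, 1 + b.toNat, 0, 0, 0, 0, 0], u) st := by
    intro u b a st h
    refine .seq (.dec _ _ _ (by simp [regs])) ?_
    rw [update_regs _ (by simp)]
    refine .seq (Prog.exec_move (by simp) _ _) ?_
    rw [update_regs _ (by simp), update_regs _ (by simp)]
    have e : (1 + b.toNat - 1) = b.toNat := by omega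
    simp only [regs, List.set_cons_succ, List.set_cons_zero, List.getD_cons_zero,
      List.getD_cons_succ, e, zero_add]
    refine .seq ((double u a 0 b.toNat).cast rfl) (.seq (.inc _ _ _) ?_)
    rw [update_regs _ (by simp)]
    refine .seq (Prog.exec_move (by simp) _ _) ?_
    rw [update_regs _ (by simp), update_regs _ (by simp)]
    simpa [regs] using h
  -- The top of the stack is the end of the string. Hence `v` is the part already read and `u` the
  -- part still on the stack.
  have main : ∀ u v, Exec (.seq (.pop 1) (.loop 1 body)) (regs [num v, 0, 0, 0, 0, 0, 0], u)
      (regs [num (u ++ v), 0, 0, 0, 0, 0, 0], []) := by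
    intro u
    induction u using List.reverseRecOn with
    | nil => exact fun v => .seq (.popNil _ _) (.done rfl)
    | append_singleton u b ih =>
      intro v
      refine .seq (pops u b _) ?_
      have := ih (b :: v)
      cases this with
      | seq h1 h2 =>
        rw [List.append_assoc, List.singleton_append]
        exact .again (by simp [regs]) (step u b (num v) _ h1) h2
  simpa using main w []

/-- Programs for the parts of an unbounded search: the least `k` with `G x k = 0` is sought, and from
it the output and the answer are found. -/
theorem exists_searchProg {G H B : ℕ → ℕ → ℕ} (hG : Primrec₂ G) (hH : Primrec₂ H)
    (hB : Primrec₂ B) : ∃ pA pB pC : Prog,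
      (∀ w, Exec pA (regs [0, 0, 0, 0, 0, 0, 0], w)
        (regs [num w, 0, G (num w) 0, 0, 0, 0, 0], [])) ∧
      (∀ x k t, Exec pB (regs [x, k, t, 0, 0, 0, 0], [])
        (regs [x, k + 1, G x (k + 1), 0, 0, 0, 0], [])) ∧
      (∀ x k v, H x k = num v → ∃ s, Exec pC (regs [x, k, 0, 0, 0, 0, 0], []) (s, v) ∧
        s 3 = B x k) := by
  have two : ∀ {F : ℕ → ℕ → ℕ}, Primrec₂ F → ∀ j, 2 ≤ j → ∃ p, ∀ s w, (∀ i, j ≤ i → s i = 0) →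
      Exec p (s, w) (Function.update s j (F (s 0) (s 1)), w) := by
    intro F hF j hj
    obtain ⟨p, hp⟩ := exists_prog (Nat.Primrec'.prim_iff₂.2 hF) j ![0, 1] (by
      intro i; fin_cases i <;> simp <;> omega)
    exact ⟨p, fun s w hs => (hp s w hs).cast (by simp [List.Vector.ofFn])⟩
  have one : ∀ {F : ℕ → ℕ}, Primrec F → ∀ j, 2 < j → ∃ p, ∀ s w, (∀ i, j ≤ i → s i = 0) →
      Exec p (s, w) (Function.update s j (F (s 2)), w) := by
    intro F hF j hj
    obtain ⟨p, hp⟩ := exists_prog (Nat.Primrec'.prim_iff₁.2 hF) j ![2] (by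
      intro i; fin_cases i; simpa)
    exact ⟨p, fun s w hs => (hp s w hs).cast (by simp [List.Vector.ofFn])⟩
  obtain ⟨pr, hr⟩ := exists_readProg
  obtain ⟨pz, hz⟩ := two hG 2 le_rfl
  obtain ⟨ph, hh⟩ := two hH 2 le_rfl
  obtain ⟨pb, hb⟩ := two hB 3 (by omega)
  obtain ⟨p4, h4⟩ := one (F := fun y => (y - 1) / 2)
    (Primrec.nat_div.comp (Primrec.nat_sub.comp .id (.const 1)) (.const 2)) 4 (by omega)
  obtain ⟨p5, h5⟩ := one (F := fun y => (y - 1) % 2)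
    (Primrec.nat_mod.comp (Primrec.nat_sub.comp .id (.const 1)) (.const 2)) 5 (by omega)
  -- For `y ≠ 0` in counter `2`, the next bit is `(y - 1) % 2` and the rest of the string has the
  -- number `(y - 1) / 2`. Counter `6` is the flag for the other branch: it is set to `1`, and the
  -- branch that pushes `true` takes it back.
  let body : Prog := .seq p4 (.seq p5 (.seq (.clear 2) (.seq (.move 4 2) (.seq (.inc 6) (.seq
    (.loop 5 (.seq (.dec 5) (.seq (.dec 6) (.push true))))
    (.loop 6 (.seq (.dec 6) (.push false))))))))
  refine ⟨.seq pr pz, .seq (.clear 2) (.seq (.inc 1) pz), .seq ph (.seq pb (.loop 2 body)),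
    fun w => ?_, fun x k t => ?_, fun x k v hv => ?_⟩
  · refine .seq (hr w) ((hz _ _ (regs_eq_zero (by simp))).cast ?_)
    rw [update_regs _ (by simp)]
    simp [regs]
  · refine .seq (Prog.exec_clear _ _ _) (.seq (.inc _ _ _) ((hz _ _ ?_).cast ?_))
    · rw [update_regs _ (by simp), update_regs _ (by simp)]
      exact regs_eq_zero (by simp)
    · rw [update_regs _ (by simp), update_regs _ (by simp), update_regs _ (by simp)]
      simp [regs]
  · refine ⟨regs [x, k, 0, B x k, 0, 0, 0], .seq (hh _ _ (regs_eq_zero (by simp)))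
      (.seq (hb _ _ ?_) ?_), rfl⟩
    · rw [update_regs _ (by simp)]
      exact regs_eq_zero (by simp)
    · rw [update_regs _ (by simp), update_regs _ (by simp)]
      have key : ∀ v u, Exec (.loop 2 body) (regs [x, k, num v, B x k, 0, 0, 0], u)
          (regs [x, k, 0, B x k, 0, 0, 0], u ++ v) := by
        intro v
        induction v with
        | nil => exact fun u => (Exec.done rfl).cast (by simp)
        | cons b v ih =>
          intro u
          have := ih (u ++ [b])
          rw [List.append_assoc, List.singleton_append] at this
          refine .again (by simp [regs]) ?_ this
          refine .seq (h4 _ _ (regs_eq_zero (by simp))) ?_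
          rw [update_regs _ (by simp)]
          refine .seq (h5 _ _ (regs_eq_zero (by simp))) ?_
          rw [update_regs _ (by simp)]
          refine .seq (Prog.exec_clear _ _ _) ?_
          rw [update_regs _ (by simp)]
          refine .seq (Prog.exec_move (by simp) _ _) ?_
          rw [update_regs _ (by simp), update_regs _ (by simp)]
          refine .seq (.inc _ _ _) ?_
          rw [update_regs _ (by simp)]
          have e1 : (2 * num v + 1 + b.toNat - 1) / 2 = num v := by cases b <;> simp <;> omega
          have e2 : (2 * num v + 1 + b.toNat - 1) % 2 = b.toNat := by cases b <;> simp <;> omega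
          simp only [regs, List.set_cons_succ, List.set_cons_zero, List.getD_cons_zero,
            List.getD_cons_succ, e1, e2, num_cons, zero_add]
          cases b
          · refine .seq (.done rfl) (.again (by simp [regs]) (.seq (.dec _ _ _ (by simp [regs]))
              (.push _ _ _)) ?_)
            rw [update_regs _ (by simp)]
            exact .done rfl
          · refine .seq (.again (by simp [regs]) (.seq (.dec _ _ _ (by simp [regs]))
              (.seq (.dec _ _ _ (by simp [regs])) (.push _ _ _))) (.done (by simp [regs]))) ?_
            rw [update_regs _ (by simp), update_regs _ (by simp)]
            exact .done rfl
      have := key v []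
      simpa [regs, ← hv] using this

/-! ### Fragments of Turing machines -/

/-- A machine fragment with exits in `E`. -/
structure Frag (E : Type) where
  S : Type
  finite : Finite S
  start : S
  δ : S → Option Bool → Option Bool × Turing.Dir × (S ⊕ E)

/-- A two-way infinite tape with the position of the head. -/
abbrev HeadTape := (ℤ → Option Bool) × ℤ

/-- The displacement of the head. -/
def sgn : Turing.Dir → ℤ
  | .left => -1
  | .right => 1

/-- The opposite direction. -/
def opp : Turing.Dir → Turing.Dir
  | .left => .right
  | .right => .left

@[simp] theorem sgn_opp (d : Turing.Dir) : sgn (opp d) = - sgn d := by cases d <;> rfl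

/-- Write a symbol and move the head. -/
def HeadTape.act (t : HeadTape) (a : Option Bool) (d : Turing.Dir) : HeadTape :=
  (Function.update t.1 t.2 a, t.2 + sgn d)

/-- The run from a state and a tape ends in an exit with a tape. -/
inductive Run {S E : Type} (δ : S → Option Bool → Option Bool × Turing.Dir × (S ⊕ E)) :
    S → HeadTape → E × HeadTape → Prop
  | exit {q t a d e} (h : δ q (t.1 t.2) = (a, d, .inr e)) : Run δ q t (e, t.act a d)
  | step {q t a d q' r} (h : δ q (t.1 t.2) = (a, d, .inl q')) (h' : Run δ q' (t.act a d) r) :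
      Run δ q t r

/-- Determinism turns the known exits of terminating parts into the only possible ones, which is
needed to show that a machine does not halt. -/
theorem Run.det {S E : Type} {δ : S → Option Bool → Option Bool × Turing.Dir × (S ⊕ E)} {q t r r'}
    (h : Run δ q t r) (h' : Run δ q t r') : r = r' := by
  induction h with
  | exit h =>
    cases h' with
    | exit k =>
      rw [h] at k
      simp only [Prod.mk.injEq, Sum.inr.injEq] at k
      obtain ⟨rfl, rfl, rfl⟩ := k
      rfl
    | step k => rw [h] at k; simp at k
  | step h _ ih =>
    cases h' with
    | exit k => rw [h] at k; simp at k
    | step k k' =>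
      rw [h] at k
      simp only [Prod.mk.injEq, Sum.inl.injEq] at k
      obtain ⟨rfl, rfl, rfl⟩ := k
      exact ih k'

namespace Frag

variable {E E' : Type}

/-- The run from the start on a tape ends in an exit with a tape. -/
def Exits (F : Frag E) (t : HeadTape) (r : E × HeadTape) : Prop := Run F.δ F.start t r

theorem Exits.det {F : Frag E} {t r r'} (h : F.Exits t r) (h' : F.Exits t r') : r = r' :=
  Run.det h h'

theorem Exits.cast {F : Frag E} {t t' r r'} (h : F.Exits t r) (e : t = t') (e' : r = r') :
    F.Exits t' r' := e ▸ e' ▸ h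

/-- A single instruction. -/
def rd (g : Option Bool → Option Bool × Turing.Dir × E) : Frag E where
  S := Unit
  finite := inferInstance
  start := ()
  δ := fun _ a => ((g a).1, (g a).2.1, .inr (g a).2.2)

theorem exits_rd (g : Option Bool → Option Bool × Turing.Dir × E) (t : HeadTape) :
    (rd g).Exits t ((g (t.1 t.2)).2.2, t.act (g (t.1 t.2)).1 (g (t.1 t.2)).2.1) :=
  Run.exit rfl

/-- Run `F`, then the fragment belonging to the exit that was taken. -/
def bind [hE : Finite E] (F : Frag E) (G : E → Frag E') : Frag E' where
  S := F.S ⊕ Σ e, (G e).S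
  finite := by
    have := F.finite
    have := fun e => (G e).finite
    infer_instance
  start := .inl F.start
  δ := fun q a => match q with
    | .inl q => ((F.δ q a).1, (F.δ q a).2.1, match (F.δ q a).2.2 with
      | .inl q' => .inl (.inl q')
      | .inr e => .inl (.inr ⟨e, (G e).start⟩))
    | .inr ⟨e, q⟩ => (((G e).δ q a).1, ((G e).δ q a).2.1, match ((G e).δ q a).2.2 with
      | .inl q' => .inl (.inr ⟨e, q'⟩)
      | .inr e' => .inr e')

theorem run_bind_right [Finite E] {F : Frag E} {G : E → Frag E'} {e q t r} :
    Run (bind F G).δ (.inr ⟨e, q⟩ : F.S ⊕ Σ e, (G e).S) t r ↔ Run (G e).δ q t r := by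
  constructor
  · generalize hx : (.inr ⟨e, q⟩ : F.S ⊕ Σ e, (G e).S) = x
    intro h
    induction h generalizing q with
    | exit h =>
      subst hx
      simp only [bind, Prod.mk.injEq] at h
      obtain ⟨rfl, rfl, h⟩ := h
      split at h
      · simp at h
      · rename_i e1 he
        refine .exit (Prod.ext rfl (Prod.ext rfl ?_))
        rw [he, ← Sum.inr.inj h]
    | step h _ ih =>
      subst hx
      simp only [bind, Prod.mk.injEq] at h
      obtain ⟨rfl, rfl, h⟩ := h
      split at h
      · rename_i q1 he
        exact .step (Prod.ext rfl (Prod.ext rfl he)) (ih (Sum.inl.inj h))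
      · simp at h
  · intro h
    induction h with
    | exit h => exact .exit (by simp [bind, h])
    | @step _ _ a d q' _ h _ ih =>
      exact .step (a := a) (d := d) (q' := (.inr ⟨e, q'⟩ : F.S ⊕ Σ e, (G e).S)) (by simp [bind, h]) ih

/-- The direction from left to right is what allows divergence of a part to be carried over to the
whole. -/
theorem exits_bind [Finite E] {F : Frag E} {G : E → Frag E'} {t r} :
    (bind F G).Exits t r ↔ ∃ e t', F.Exits t (e, t') ∧ (G e).Exits t' r := by
  constructor
  · have key : ∀ (x : F.S ⊕ Σ e, (G e).S) t, Run (bind F G).δ x t r → ∀ q, x = .inl q →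
        ∃ e t', Run F.δ q t (e, t') ∧ (G e).Exits t' r := by
      intro x t h
      induction h with
      | exit h =>
        rintro q rfl
        simp only [bind, Prod.mk.injEq] at h
        obtain ⟨rfl, rfl, h⟩ := h
        split at h <;> simp at h
      | @step q0 t a d q' r h h' ih =>
        rintro q rfl
        simp only [bind, Prod.mk.injEq] at h
        obtain ⟨rfl, rfl, h⟩ := h
        split at h
        · rename_i q1 he
          obtain ⟨e, t', h1, h2⟩ := ih q1 (Sum.inl.inj h).symm
          exact ⟨e, t', .step (Prod.ext rfl (Prod.ext rfl he)) h1, h2⟩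
        · rename_i e he
          obtain rfl := Sum.inl.inj h
          exact ⟨e, _, .exit (Prod.ext rfl (Prod.ext rfl he)), run_bind_right.1 h'⟩
    exact fun h => key _ _ h _ rfl
  · rintro ⟨e, t', h, h'⟩
    have key : ∀ q t x, Run F.δ q t x → ∀ t', x = (e, t') → (G e).Exits t' r →
        Run (bind F G).δ (.inl q : F.S ⊕ Σ e, (G e).S) t r := by
      clear h h'
      intro q t x h
      induction h with
      | exit h =>
        rintro t' hx h'
        obtain ⟨rfl, rfl⟩ := Prod.mk.inj hx
        exact .step (q' := (.inr ⟨_, (G _).start⟩ : F.S ⊕ Σ e, (G e).S))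
          (by simp only [bind, h]) (run_bind_right.2 h')
      | @step _ _ _ _ q' _ h _ ih =>
        intro t' hx h'
        exact .step (q' := (.inl q' : F.S ⊕ Σ e, (G e).S)) (by simp only [bind, h]) (ih t' hx h')
    exact key _ _ _ h _ rfl h'

theorem Exits.bind [Finite E] {F : Frag E} {G : E → Frag E'} {t e t' r} (h : F.Exits t (e, t'))
    (h' : (G e).Exits t' r) : (Frag.bind F G).Exits t r :=
  exits_bind.2 ⟨e, t', h, h'⟩

/-- Run `F` again and again, until it does not take the exit `none`. -/
def iter (F : Frag (Option E)) : Frag E where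
  S := F.S
  finite := F.finite
  start := F.start
  δ := fun q a => ((F.δ q a).1, (F.δ q a).2.1, match (F.δ q a).2.2 with
    | .inl q' => .inl q'
    | .inr none => .inl F.start
    | .inr (some e) => .inr e)

theorem Exits.iter_done {F : Frag (Option E)} {t e t'} (h : F.Exits t (some e, t')) :
    (iter F).Exits t (e, t') := by
  have key : ∀ q t x, Run F.δ q t x → ∀ t', x = (some e, t') → Run (iter F).δ q t (e, t') := by
    intro q t x h
    induction h with
    | exit h =>
      intro t' hx
      obtain ⟨rfl, rfl⟩ := Prod.mk.inj hx
      exact .exit (by simp only [iter, h])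
    | step h _ ih =>
      intro t' hx
      exact .step (by simp only [iter, h]) (ih t' hx)
  exact key _ _ _ h _ rfl

theorem Exits.iter_again {F : Frag (Option E)} {t t' r} (h : F.Exits t (none, t'))
    (h' : (iter F).Exits t' r) : (iter F).Exits t r := by
  have key : ∀ q t x, Run F.δ q t x → ∀ t', x = (none, t') → (iter F).Exits t' r →
      Run (iter F).δ q t r := by
    intro q t x h
    induction h with
    | exit h =>
      intro t' hx h'
      obtain ⟨rfl, rfl⟩ := Prod.mk.inj hx
      exact .step (q' := F.start) (by simp only [iter, h]) h'
    | step h _ ih =>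
      intro t' hx h'
      exact .step (by simp only [iter, h]) (ih t' hx h')
  exact key _ _ _ h _ rfl h'

/-- A loop that never gets a chance to leave does not exit. -/
theorem not_exits_iter {F : Frag (Option E)} (T : ℕ → HeadTape)
    (h : ∀ n, F.Exits (T n) (none, T (n + 1))) (r) : ¬ (iter F).Exits (T 0) r := by
  -- Invariant along a supposed run of the loop that exits: the current pass of `F` ends in `none`
  -- with the tape `T n` for some `n`. The last step of the run would contradict it.
  have key : ∀ q t, Run (iter F).δ q t r → ∀ n, ¬ Run F.δ q t (none, T n) := by
    intro q t h1
    induction h1 with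
    | @exit q t a d e h1 =>
      intro n h2
      simp only [iter, Prod.mk.injEq] at h1
      obtain ⟨rfl, rfl, h1⟩ := h1
      generalize hx : (none, T n) = x at h2
      cases h2 with
      | exit k => obtain ⟨rfl, -⟩ := Prod.mk.inj hx; rw [k] at h1; simp at h1
      | step k => rw [k] at h1; simp at h1
    | @step q t a d q' r h1 _ ih =>
      intro n h2
      simp only [iter, Prod.mk.injEq] at h1
      obtain ⟨rfl, rfl, h1⟩ := h1
      generalize hx : (none, T n) = x at h2
      cases h2 with
      | exit k =>
        obtain ⟨rfl, hT⟩ := Prod.mk.inj hx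
        simp only [k] at h1
        obtain rfl := Sum.inl.inj h1
        refine ih (n + 1) ?_
        rw [k, ← hT]
        exact h n
      | step k k' =>
        subst hx
        simp only [k] at h1
        obtain rfl := Sum.inl.inj h1
        refine ih n ?_
        rw [k]
        exact k'
  exact fun hr => key _ _ hr 1 (h 0)

/-- Move `n + 1` cells. -/
def walk {E : Type} (d : Turing.Dir) (e : E) : ℕ → Frag E
  | 0 => rd fun a => (a, d, e)
  | n + 1 => bind (rd fun a => (a, d, ())) fun _ => walk d e n

theorem exits_walk (d : Turing.Dir) (e : E) (n : ℕ) (f : ℤ → Option Bool) (p : ℤ) :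
    (walk d e n).Exits (f, p) (e, (f, p + sgn d * (n + 1))) := by
  induction n generalizing p with
  | zero =>
    refine (exits_rd _ _).cast rfl ?_
    simp [HeadTape.act]
  | succ n ih =>
    refine (exits_rd _ _).bind ((ih (p + sgn d)).cast ?_ ?_)
    · simp [HeadTape.act]
    · push_cast
      rw [show p + sgn d + sgn d * (n + 1) = p + sgn d * (n + 1 + 1) by ring]

/-- Move in steps of `r` cells until a blank is met, and write `x` there. -/
def scan (d : Turing.Dir) (r : ℕ) (x : Option Bool) : Frag Unit :=
  iter (bind (rd fun c => match c with
      | none => (x, opp d, false)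
      | some b => (some b, opp d, true))
    fun nb => bif nb then (walk d none r : Frag (Option Unit)) else walk d (some ()) 0)

/-- Since every instruction moves the head, reading a cell steps back by one. On a symbol, `walk d
none r` makes `r + 1` moves for a net stride of `r`; on a blank, `walk d (some ()) 0` makes the
single move that returns to it. The number of symbols passed is `n`. -/
theorem exits_scan (d : Turing.Dir) (r : ℕ) (x : Option Bool) (f : ℤ → Option Bool) (n : ℕ)
    (p q : ℤ) (hq : q = p + sgn d * (n * r)) (h : ∀ j : ℕ, j < n → f (p + sgn d * (j * r)) ≠ none)
    (h' : f q = none) : (scan d r x).Exits (f, p) ((), (Function.update f q x, q)) := by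
  induction n generalizing p with
  | zero =>
    simp only [Nat.cast_zero, zero_mul, mul_zero, add_zero] at hq
    subst hq
    refine Exits.iter_done (Exits.bind (e := false) (t' := (Function.update f q x, q - sgn d))
      ((exits_rd _ _).cast rfl ?_) ((exits_walk d _ 0 _ _).cast rfl ?_))
    · simp [h', HeadTape.act, sub_eq_add_neg]
    · simp
  | succ n ih =>
    obtain ⟨b, hb⟩ := Option.ne_none_iff_exists'.1 (h 0 (by omega))
    simp only [Nat.cast_zero, zero_mul, mul_zero, add_zero] at hb
    refine Exits.iter_again (t' := (f, p + sgn d * r)) (Exits.bind (e := true)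
      (t' := (f, p - sgn d)) ((exits_rd _ _).cast rfl ?_) ((exits_walk d _ r _ _).cast rfl ?_))
      (ih _ ?_ fun j hj => ?_)
    · simp only [hb, HeadTape.act, sgn_opp, ← sub_eq_add_neg]
      rw [← hb, Function.update_eq_self]
    · rw [show p - sgn d + sgn d * (r + 1) = p + sgn d * r by ring]
    · rw [hq]; push_cast; ring
    · have := h (j + 1) (by omega)
      push_cast at this
      rwa [show p + sgn d * r + sgn d * (j * r) = p + sgn d * ((j + 1) * r) by ring]

end Frag

/-! ### The layout of the counters and the stack on the tape -/

open Function

/-- The stack `w` is on the cells `0, 1, …`; counter `i < r` is written in unary on the cells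
`-(2 + (j + 1) * r + i)`. -/
def tapeOf (r : ℕ) (s : ℕ → ℕ) (w : List Bool) : ℤ → Option Bool
  | .ofNat n => w[n]?
  | .negSucc n => if n < 1 + r then none else
      if (n - 1 - r) / r < s ((n - 1 - r) % r) then some true else none

section layout

variable {r : ℕ} {s : ℕ → ℕ} {w : List Bool}

theorem tapeOf_nat (n : ℕ) : tapeOf r s w n = w[n]? := rfl

/-- These blanks stop the scans on the way home: cell `-1` ends a leftward scan of the stack, and
cell `-(2 + i)`, one stride before the first cell of counter `i`, ends a rightward scan of that
counter. -/
theorem tapeOf_gap {m : ℕ} (h0 : 1 ≤ m) (h : m ≤ r + 1) : tapeOf r s w (-m) = none := by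
  obtain ⟨m, rfl⟩ := Nat.exists_eq_add_of_le' h0
  change tapeOf r s w (.negSucc m) = none
  rw [tapeOf, if_pos (by omega)]

theorem tapeOf_counter {i : ℕ} (hi : i < r) (j : ℕ) :
    tapeOf r s w (-(2 + (j + 1) * r + i)) = if j < s i then some true else none := by
  have e : (-(2 + (j + 1) * r + i) : ℤ) = .negSucc (1 + r + (i + r * j)) := by
    rw [Int.negSucc_eq]; push_cast; ring
  rw [e, tapeOf, if_neg (by omega), show 1 + r + (i + r * j) - 1 - r = i + r * j by omega,
    Nat.add_mul_div_left _ _ (by omega), Nat.div_eq_of_lt hi, Nat.add_mul_mod_self_left,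
    Nat.mod_eq_of_lt hi, zero_add]

/-- Formulated so as to serve both changes of a counter: `j = s i`, `v = s i + 1` for an increase,
and `j = v = s i - 1` for a decrease. -/
theorem update_tapeOf_counter {i : ℕ} (hi : i < r) (j v : ℕ)
    (h : ∀ j', j' ≠ j → (j' < v ↔ j' < s i)) :
    update (tapeOf r s w) (-(2 + (j + 1) * r + i)) (if j < v then some true else none) =
      tapeOf r (update s i v) w := by
  have e : (-(2 + (j + 1) * r + i) : ℤ) = .negSucc (1 + r + (i + r * j)) := by
    rw [Int.negSucc_eq]; push_cast; ring
  funext z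
  rcases z with n | n
  · rw [e, update_of_ne (by simp)]
    rfl
  · by_cases hz : (.negSucc n : ℤ) = -(2 + (j + 1) * r + i)
    · rw [hz, update_self, tapeOf_counter hi, update_self]
    · rw [update_of_ne hz, tapeOf, tapeOf]
      by_cases hn : n < 1 + r
      · rw [if_pos hn, if_pos hn]
      · rw [if_neg hn, if_neg hn]
        by_cases hm : (n - 1 - r) % r = i
        · rw [hm, update_self]
          have hj : (n - 1 - r) / r ≠ j := by
            rintro rfl
            apply hz
            rw [e]
            congr 1
            rw [← hm, Nat.mod_add_div]
            omega
          simp only [h _ hj]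
        · rw [update_of_ne hm]

theorem update_tapeOf_push (b : Bool) :
    update (tapeOf r s w) w.length (some b) = tapeOf r s (w ++ [b]) := by
  funext z
  rcases z with n | n
  · by_cases hz : n = w.length
    · subst hz; simp [tapeOf]
    · have : (Int.ofNat n) ≠ (w.length : ℤ) := fun h => hz (by simpa using h)
      rw [update_of_ne this, tapeOf, tapeOf]
      by_cases h : n < w.length
      · rw [List.getElem?_append_left h]
      · rw [List.getElem?_eq_none (by omega), List.getElem?_eq_none (by simp; omega)]
  · rw [update_of_ne (by simp [Int.negSucc_eq]; omega)]; rfl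

theorem update_tapeOf_pop (b : Bool) :
    update (tapeOf r s (w ++ [b])) w.length none = tapeOf r s w := by
  rw [← update_tapeOf_push, update_idem]
  convert update_eq_self (w.length : ℤ) _
  simp [tapeOf_nat]

end layout

/-! ### Fragments for the instructions of programs -/

namespace Frag

/-- The fragment that increases counter `i`. -/
def incF (r i : ℕ) : Frag Unit :=
  bind (walk .left () (1 + r + i)) fun _ => bind (scan .left r (some true)) fun _ =>
    bind (scan .right r none) fun _ => walk .right () (1 + i)

/-- The fragment that decreases counter `i`. -/
def decF (r i : ℕ) : Frag Unit :=
  bind (walk .left () (1 + r + i)) fun _ => bind (scan .left r none) fun _ =>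
    bind (walk .right () (r - 1)) fun _ => bind (rd fun _ => (none, .right, ())) fun _ =>
    bind (walk .left () 0) fun _ => bind (walk .right () (r - 1)) fun _ =>
    bind (scan .right r none) fun _ => walk .right () (1 + i)

/-- The fragment that tests whether counter `i` is not zero. -/
def testF (r i : ℕ) : Frag Bool :=
  bind (walk .left () (1 + r + i)) fun _ => bind (rd fun c => (c, .right, c.isSome)) fun b =>
    walk .right b (r + i)

/-- The fragment that puts `b` on the stack. -/
def pushF (b : Bool) : Frag Unit :=
  bind (scan .right 1 (some b)) fun _ => bind (scan .left 1 none) fun _ => walk .right () 0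

/-- The fragment that takes a bit from the stack. -/
def popF (r i : ℕ) : Frag Unit :=
  bind (scan .right 1 none) fun _ => bind (walk .left () 0) fun _ =>
    bind (rd fun c => (none, .left, c)) fun c => match c with
    | none => walk .right () 1
    | some b => bind (scan .left 1 none) fun _ => bind (walk .right () 0) fun _ =>
        bif b then bind (incF r i) fun _ => incF r i else incF r i

/-- The fragment that does nothing. -/
def stay {E : Type} (e : E) : Frag E :=
  bind (rd fun c => (c, .right, ())) fun _ => walk .left e 0

/-- The fragment for a program whose counters are less than `r`. -/
def ofProg (r : ℕ) : Prog → Frag Unit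
  | .inc i => incF r i
  | .dec i => decF r i
  | .push b => pushF b
  | .pop i => popF r i
  | .seq p q => bind (ofProg r p) fun _ => ofProg r q
  | .loop i p => iter (bind (testF r i) fun b =>
      bif b then bind (ofProg r p) fun _ => stay none else stay (some ()))

theorem update_none_eq_self {f : ℤ → Option Bool} {z : ℤ} (h : f z = none) :
    update f z none = f := by rw [← h, update_eq_self]

theorem exits_goto {r i : ℕ} (t : ℤ → Option Bool) : (walk .left () (1 + r + i)).Exits
    (t, 0) ((), (t, -(2 + r + i))) := by
  refine (exits_walk .left () (1 + r + i) _ _).cast rfl ?_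
  simp [sgn]; ring

section

variable {r i : ℕ} (hi : i < r) (s : ℕ → ℕ) (w : List Bool)
include hi

/-- The head starts on mark number `n` of counter `i`, where `n = 0` means the gap cell `-(2 + i)`.
The scan stops in that gap cell in either case, and `2 + i` moves lead from there to cell `0`. -/
theorem exits_home (n : ℕ) (hn : n ≤ s i) :
    (bind (scan .right r none) fun _ => walk .right () (1 + i)).Exits
      (tapeOf r s w, -(2 + n * r + i)) ((), (tapeOf r s w, 0)) := by
  have h0 : tapeOf r s w (-(2 + i)) = none := by
    have := tapeOf_gap (r := r) (s := s) (w := w) (m := 2 + i) (by omega) (by omega)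
    exact_mod_cast this
  refine Exits.bind (e := ()) (t' := (tapeOf r s w, -(2 + i)))
    ((exits_scan .right r none _ n _ (-(2 + i)) ?_ ?_ h0).cast rfl ?_)
    ((exits_walk .right () (1 + i) _ _).cast rfl ?_)
  · simp only [sgn]; ring
  · intro j hj
    have : (-(2 + n * r + i) + sgn .right * (j * r) : ℤ) = -(2 + ((n - 1 - j : ℕ) + 1) * r + i) := by
      have : ((n - 1 - j : ℕ) : ℤ) = n - 1 - j := by omega
      rw [this]; simp only [sgn]; ring
    rw [this, tapeOf_counter hi, if_pos (by omega)]
    simp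
  · rw [update_none_eq_self h0]
  · simp [sgn]; ring

theorem exits_scan_counter (x : Option Bool) : (scan .left r x).Exits
    (tapeOf r s w, -(2 + r + i)) ((), (update (tapeOf r s w) (-(2 + (s i + 1) * r + i)) x,
      -(2 + (s i + 1) * r + i))) := by
  refine exits_scan .left r x _ (s i) _ _ ?_ ?_ ?_
  · simp only [sgn]; ring
  · intro j hj
    have : (-(2 + r + i) + sgn .left * (j * r) : ℤ) = -(2 + (j + 1) * r + i) := by
      simp only [sgn]; ring
    rw [this, tapeOf_counter hi, if_pos hj]
    simp
  · rw [tapeOf_counter hi, if_neg (by omega)]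

theorem exits_incF : (incF r i).Exits (tapeOf r s w, 0)
    ((), (tapeOf r (update s i (s i + 1)) w, 0)) := by
  refine (exits_goto _).bind (Exits.bind (e := ()) ((exits_scan_counter hi s w (some true)).cast
    rfl ?_) (exits_home hi (update s i (s i + 1)) w (s i + 1) (by simp)))
  have := update_tapeOf_counter (s := s) (w := w) hi (s i) (s i + 1) (by omega)
  rw [if_pos (by omega)] at this
  rw [this]
  push_cast
  rfl

/-- The scan stops on the blank beyond the last mark, and one stride back is the mark to be erased;
`s i ≠ 0` guarantees that there is one. A further stride avoids the new blank, on which the scan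
home would stop at once. -/
theorem exits_decF (h : s i ≠ 0) : (decF r i).Exits (tapeOf r s w, 0)
    ((), (tapeOf r (update s i (s i - 1)) w, 0)) := by
  have hn : tapeOf r s w (-(2 + (s i + 1) * r + i)) = none := by
    rw [tapeOf_counter hi, if_neg (by omega)]
  have e1 : ((r - 1 : ℕ) : ℤ) = r - 1 := by omega
  have e2 : ((s i - 1 : ℕ) : ℤ) = s i - 1 := by omega
  have hu := update_tapeOf_counter (s := s) (w := w) hi (s i - 1) (s i - 1) (by omega)
  rw [if_neg (by omega), e2] at hu
  refine (exits_goto _).bind ((exits_scan_counter hi s w none).bind ?_)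
  rw [update_none_eq_self hn]
  refine ((exits_walk .right () (r - 1) _ _)).bind (Exits.bind (e := ())
    (t' := (tapeOf r (update s i (s i - 1)) w, -(2 + (s i - 1 + 1) * r + i) + 1))
    ((exits_rd _ _).cast rfl ?_) ((exits_walk .left () 0 _ _).bind ((exits_walk .right () (r - 1) _ _).bind
    ((exits_home hi (update s i (s i - 1)) w (s i - 1) (by simp)).cast ?_ rfl))))
  · refine Prod.ext rfl (Prod.ext ?_ ?_)
    · simp only [HeadTape.act]
      rw [← hu]
      congr 1
      simp only [sgn, e1]; ring
    · simp only [HeadTape.act, sgn, e1]; ring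
  · refine Prod.ext rfl ?_
    simp only [sgn, e1, e2]
    push_cast
    ring

theorem exits_testF : (testF r i).Exits (tapeOf r s w, 0)
    (decide (s i ≠ 0), (tapeOf r s w, 0)) := by
  have h0 := tapeOf_counter (s := s) (w := w) hi 0
  simp only [Nat.cast_zero, zero_add, one_mul] at h0
  refine (exits_goto _).bind (Exits.bind (e := decide (s i ≠ 0))
    (t' := (tapeOf r s w, -(2 + r + i) + 1)) ((exits_rd _ _).cast rfl ?_)
    ((exits_walk .right (decide (s i ≠ 0)) (r + i) _ _).cast rfl ?_))
  · refine Prod.ext ?_ (Prod.ext ?_ rfl)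
    · simp only [h0]
      by_cases h : s i = 0 <;> simp [h, Nat.pos_iff_ne_zero]
    · simp only [HeadTape.act]
      rw [update_eq_self]
  · simp [sgn]; ring

end

theorem exits_home_stack (r : ℕ) (s : ℕ → ℕ) (w : List Bool) :
    (bind (scan .left 1 none) fun _ => walk .right () 0).Exits
      (tapeOf r s w, (w.length : ℤ) - 1) ((), (tapeOf r s w, 0)) := by
  have h0 : tapeOf r s w (-1) = none := tapeOf_gap (m := 1) le_rfl (by omega)
  refine Exits.bind (e := ()) (t' := (tapeOf r s w, -1))
    ((exits_scan .left 1 none _ w.length _ (-1) ?_ ?_ h0).cast rfl ?_) ((exits_walk .right () 0 _ _).cast rfl ?_)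
  · simp only [sgn]; push_cast; ring
  · intro j hj
    have : ((w.length : ℤ) - 1 + sgn .left * (j * (1 : ℕ))) = ((w.length - 1 - j : ℕ) : ℤ) := by
      simp only [sgn]; push_cast; omega
    rw [this, tapeOf_nat]
    simp; omega
  · rw [update_none_eq_self h0]
  · simp [sgn]

theorem exits_scan_stack (r : ℕ) (s : ℕ → ℕ) (w : List Bool) (x : Option Bool) :
    (scan .right 1 x).Exits (tapeOf r s w, 0)
      ((), (update (tapeOf r s w) w.length x, w.length)) := by
  refine exits_scan .right 1 x _ w.length _ _ ?_ ?_ ?_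
  · simp [sgn]
  · intro j hj
    have : (0 + sgn .right * (j * (1 : ℕ)) : ℤ) = j := by simp [sgn]
    rw [this, tapeOf_nat]
    simp; omega
  · simp [tapeOf_nat]

theorem exits_pushF (r : ℕ) (s : ℕ → ℕ) (w : List Bool) (b : Bool) :
    (pushF b).Exits (tapeOf r s w, 0) ((), (tapeOf r s (w ++ [b]), 0)) := by
  refine Exits.bind (e := ()) ((exits_scan_stack r s w _).cast rfl ?_)
    (exits_home_stack r s (w ++ [b]))
  rw [update_tapeOf_push]
  simp

/-- With an empty stack the cell that is read is the gap cell `-1`, so erasing it changes nothing.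
-/
theorem exits_popF_nil {r i : ℕ} (s : ℕ → ℕ) :
    (popF r i).Exits (tapeOf r s [], 0) ((), (tapeOf r s [], 0)) := by
  have h0 : tapeOf r s [] (-1) = none := tapeOf_gap (m := 1) le_rfl (by omega)
  refine (exits_scan_stack r s [] none).bind ?_
  rw [update_none_eq_self (tapeOf_nat _)]
  refine (exits_walk .left () 0 _ _).bind (Exits.bind (e := none) (t' := (tapeOf r s [], -2))
    ((exits_rd _ _).cast rfl ?_) ((exits_walk .right () 1 _ _).cast rfl ?_))
  · simp [HeadTape.act, sgn, h0]
  · simp [sgn]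

theorem exits_popF {r i : ℕ} (hi : i < r) (s : ℕ → ℕ) (w : List Bool) (b : Bool) :
    (popF r i).Exits (tapeOf r s (w ++ [b]), 0)
      ((), (tapeOf r (update s i (s i + (1 + b.toNat))) w, 0)) := by
  refine (exits_scan_stack r s (w ++ [b]) none).bind ?_
  rw [update_none_eq_self (by rw [tapeOf_nat]; simp)]
  refine (exits_walk .left () 0 _ _).bind (Exits.bind (e := some b)
    (t' := (tapeOf r s w, (w.length : ℤ) - 1))
    ((exits_rd _ _).cast rfl ?_) ?_)
  · have e : (((w ++ [b]).length : ℤ) + sgn .left * ((0 : ℕ) + 1)) = w.length := by simp [sgn]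
    simp only [HeadTape.act, e, tapeOf_nat, update_tapeOf_pop]
    simp [sgn, sub_eq_add_neg]
  · have h := exits_home_stack r s w
    rw [exits_bind] at h
    obtain ⟨e, t', h1, h2⟩ := h
    refine h1.bind (h2.bind ?_)
    cases b
    · exact exits_incF hi s w
    · refine (exits_incF hi s w).bind ((exits_incF hi _ w).cast rfl ?_)
      simp [add_assoc]

theorem exits_stay {E : Type} (e : E) (t : HeadTape) : (stay e).Exits t (e, t) := by
  refine (exits_rd _ _).bind ((exits_walk .left e 0 _ _).cast rfl ?_)
  simp [sgn]

end Frag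

/-! ### Correctness of the compiled programs -/

/-- All counters of the program are less than `r`. -/
def Prog.Bounded (r : ℕ) : Prog → Prop
  | .inc i => i < r
  | .dec i => i < r
  | .push _ => True
  | .pop i => i < r
  | .seq p q => p.Bounded r ∧ q.Bounded r
  | .loop i p => i < r ∧ p.Bounded r

theorem Prog.Bounded.mono {r r' : ℕ} (h : r ≤ r') : ∀ {p : Prog}, p.Bounded r → p.Bounded r'
  | .inc _, hp => lt_of_lt_of_le (b := r) hp h
  | .dec _, hp => lt_of_lt_of_le (b := r) hp h
  | .push _, _ => trivial
  | .pop _, hp => lt_of_lt_of_le (b := r) hp h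
  | .seq _ _, hp => ⟨hp.1.mono h, hp.2.mono h⟩
  | .loop _ _, hp => ⟨lt_of_lt_of_le hp.1 h, hp.2.mono h⟩

theorem Prog.exists_bounded (p : Prog) : ∃ r, p.Bounded r := by
  induction p with
  | inc i => exact ⟨i + 1, Nat.lt_succ_self i⟩
  | dec i => exact ⟨i + 1, Nat.lt_succ_self i⟩
  | push b => exact ⟨0, trivial⟩
  | pop i => exact ⟨i + 1, Nat.lt_succ_self i⟩
  | seq p q ihp ihq =>
    obtain ⟨a, ha⟩ := ihp
    obtain ⟨b, hb⟩ := ihq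
    exact ⟨max a b, ha.mono (le_max_left _ _), hb.mono (le_max_right _ _)⟩
  | loop i p ih =>
    obtain ⟨a, ha⟩ := ih
    exact ⟨max a (i + 1), by simp, ha.mono (le_max_left _ _)⟩

/-- Induction on the execution covers terminating programs only; the divergence of a search loop is
obtained separately in `Exec.not_exits`. -/
theorem Exec.exits {r : ℕ} {p : Prog} {a b : Store} (h : Exec p a b) (hp : p.Bounded r) :
    (Frag.ofProg r p).Exits (tapeOf r a.1 a.2, 0) ((), (tapeOf r b.1 b.2, 0)) := by
  induction h with
  | inc i s w => exact Frag.exits_incF hp s w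
  | dec i s w h => exact Frag.exits_decF hp s w h
  | push b s w => exact Frag.exits_pushF r s w b
  | popNil i s => exact Frag.exits_popF_nil s
  | pop i s w b => exact Frag.exits_popF hp s w b
  | seq _ _ ih₁ ih₂ => exact (ih₁ hp.1).bind (ih₂ hp.2)
  | done h =>
    refine Frag.Exits.iter_done ((Frag.exits_testF hp.1 _ _).bind ?_)
    rw [h]
    exact Frag.exits_stay _ _
  | again h _ _ ih₁ ih₂ =>
    refine Frag.Exits.iter_again ((Frag.exits_testF hp.1 _ _).bind ?_) (ih₂ hp)
    rw [decide_eq_true h]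
    exact (ih₁ hp.2).bind (Frag.exits_stay _ _)

/-- A loop that runs for ever does not exit. -/
theorem Exec.not_exits {r i : ℕ} {p : Prog} (hi : i < r) (hp : p.Bounded r) (F : ℕ → Store)
    (h : ∀ n, Exec p (F n) (F (n + 1))) (h' : ∀ n, (F n).1 i ≠ 0) (x) :
    ¬ (Frag.ofProg r (.loop i p)).Exits (tapeOf r (F 0).1 (F 0).2, 0) x := by
  refine Frag.not_exits_iter (fun n => (tapeOf r (F n).1 (F n).2, 0)) (fun n => ?_) x
  refine (Frag.exits_testF hi _ _).bind ?_
  rw [decide_eq_true (h' n)]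
  exact ((h n).exits hp).bind (Frag.exits_stay _ _)

/-! ### Turing machines for recursively enumerable relations -/

/-- The tape seen from the head. -/
def Shows (T : Turing.Tape (Option Bool)) (t : HeadTape) : Prop := ∀ i, T.nth i = t.1 (t.2 + i)

theorem Shows.act {T : Turing.Tape (Option Bool)} {t : HeadTape} (h : Shows T t) (a : Option Bool)
    (d : Turing.Dir) : Shows ((T.write a).move d) (t.act a d) := by
  intro i
  have key : ∀ j, (T.write a).nth j = Function.update t.1 t.2 a (t.2 + j) := by
    intro j
    rw [Turing.Tape.write_nth]
    by_cases hj : j = 0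
    · subst hj; simp
    · rw [if_neg hj, Function.update_of_ne (by omega), h]
  cases d
  · rw [Turing.Tape.move_left_nth, key]
    simp only [HeadTape.act, sgn]
    congr 1; ring
  · rw [Turing.Tape.move_right_nth, key]
    simp only [HeadTape.act, sgn]
    congr 1; ring

theorem Shows.head {T : Turing.Tape (Option Bool)} {t : HeadTape} (h : Shows T t) :
    T.head = t.1 t.2 := by
  rw [← Turing.Tape.nth_zero, h, add_zero]

theorem TM.step_of_status {M : TM} {c : M.Cfg} {b : Bool} (h : M.status c.state = some b) :
    M.step c = none := by
  rw [TM.step, if_neg (by simp [h])]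

/-- There is no step from a halting state, so both final configurations are values of the partial
function `StateTransition.eval`. -/
theorem TM.HaltsWith.det {M : TM} {w : List Bool} {b b' : Bool} {T T' : Turing.Tape (Option Bool)}
    (h : M.HaltsWith w b T) (h' : M.HaltsWith w b' T') : b = b' ∧ T = T' := by
  obtain ⟨c, hc, hs, rfl⟩ := h
  obtain ⟨c', hc', hs', rfl⟩ := h'
  have e1 := StateTransition.mem_eval.2 ⟨hc, TM.step_of_status hs⟩
  have e2 := StateTransition.mem_eval.2 ⟨hc', TM.step_of_status hs'⟩
  obtain rfl := Part.mem_unique e1 e2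
  rw [hs] at hs'
  exact ⟨Option.some.inj hs', rfl⟩

/-- Fragments with a yes-exit and a no-exit are Turing machines. -/
theorem Frag.exists_TM (F : Frag Bool) : ∃ M : TM, ∀ w b, (∀ T, M.HaltsWith w b T →
      ∃ t, F.Exits (fun z => if 0 ≤ z then w[z.toNat]? else none, 0) (b, t)) ∧
    ∀ t, F.Exits (fun z => if 0 ≤ z then w[z.toNat]? else none, 0) (b, t) →
      ∃ T, M.HaltsWith w b T ∧ Shows T t := by
  have := F.finite
  -- The two exits become the halting states of the machine.
  obtain ⟨n, ⟨e⟩⟩ := Finite.exists_equiv_fin (F.S ⊕ Bool)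
  let M : TM :=
    { numStates := n
      start := e (.inl F.start)
      status := fun q => match e.symm q with
        | .inl _ => none
        | .inr b => some b
      exists_halting := ⟨e (.inr true), by simp⟩
      instr := fun q a => match e.symm q with
        | .inl q => some (match (F.δ q a).2.2 with
          | .inl q' => e (.inl q')
          | .inr b => e (.inr b), (F.δ q a).1, (F.δ q a).2.1)
        | .inr _ => none }
  have hstep : ∀ q T, M.step ⟨e (.inl q), T⟩ = some ⟨match (F.δ q T.head).2.2 with
      | .inl q' => e (.inl q')
      | .inr b => e (.inr b), (T.write (F.δ q T.head).1).move (F.δ q T.head).2.1⟩ := by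
    intro q T
    simp [TM.step, M]
  have hinit : ∀ w, Shows (M.init w).tape
      (fun z => if 0 ≤ z then w[z.toNat]? else none, 0) := by
    intro w i
    rw [TM.init, Turing.Tape.mk₁, Turing.Tape.mk₂]
    rcases i with i | i
    · change (Turing.Tape.mk' _ _).nth (i : ℤ) = _
      rw [Turing.Tape.mk'_nth_nat, Turing.ListBlank.nth_mk]
      simp only [zero_add, Int.ofNat_eq_natCast, Nat.cast_nonneg, if_true, Int.toNat_natCast]
      rw [List.getI_eq_getElem?_getD, List.getElem?_map]
      cases w[i]? <;> rfl
    · simp only [zero_add, Int.negSucc_not_nonneg, if_false]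
      change (Turing.ListBlank.mk []).nth i = none
      rw [Turing.ListBlank.nth_mk]
      simp; rfl
  have forth : ∀ q t r, Run F.δ q t r → ∀ T, Shows T t →
      ∃ T', Shows T' r.2 ∧ StateTransition.Reaches M.step ⟨e (.inl q), T⟩ ⟨e (.inr r.1), T'⟩ := by
    intro q t r h
    induction h with
    | @exit q t a d b h =>
      intro T hT
      refine ⟨_, hT.act a d, Relation.ReflTransGen.single ?_⟩
      rw [hstep, hT.head, h]
      rfl
    | @step q t a d q' r h _ ih =>
      intro T hT
      obtain ⟨T', h1, h2⟩ := ih _ (hT.act a d)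
      refine ⟨T', h1, Relation.ReflTransGen.head ?_ h2⟩
      rw [hstep, hT.head, h]
      rfl
  have back : ∀ c c' : M.Cfg, StateTransition.Reaches M.step c c' → ∀ b, c'.state = e (.inr b) →
      ∀ q t, c.state = e (.inl q) → Shows c.tape t → ∃ t', Run F.δ q t (b, t') := by
    intro c c' h b hb
    induction h using Relation.ReflTransGen.head_induction_on with
    | refl =>
      intro q t hq
      rw [hb] at hq
      simp at hq
    | @head a c hac hc ih =>
      intro q t hq ht
      obtain ⟨s, T⟩ := a
      subst hq
      change _ ∈ M.step ⟨_, T⟩ at hac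
      rw [hstep, Option.mem_some_iff] at hac
      subst hac
      have h0 := ht.head
      simp only at h0
      rcases hx : F.δ q T.head with ⟨a, d, q' | b'⟩
      · simp only [hx] at ih
        obtain ⟨t', ht'⟩ := ih q' _ rfl (ht.act a d)
        exact ⟨t', .step (by rw [← h0, hx]) ht'⟩
      · simp only [hx] at hc
        -- An exit state is halting, so what remains of the path after it is empty.
        have hn : M.step ⟨e (.inr b'), (T.write a).move d⟩ = none := TM.step_of_status (b := b') (by
          simp [M])
        rcases Relation.ReflTransGen.cases_head hc with h | ⟨c1, h, _⟩
        · rw [← h] at hb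
          have : b' = b := by simpa using hb
          subst this
          exact ⟨_, .exit (by rw [← h0, hx])⟩
        · rw [hn] at h
          simp at h
  refine ⟨M, fun w b => ⟨?_, ?_⟩⟩
  · rintro T ⟨c, hc, hs, rfl⟩
    have : c.state = e (.inr b) := by
      rw [← e.symm_apply_eq]
      simp only [M] at hs
      split at hs
      · simp at hs
      · rename_i h
        rw [h, Option.some.inj hs]
    exact back _ _ hc b this F.start _ rfl (hinit w)
  · intro t ht
    obtain ⟨T, h1, h2⟩ := forth _ _ _ ht _ (hinit w)
    exact ⟨T, ⟨_, h2, by simp [M], rfl⟩, h1⟩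

theorem tapeOf_init (r : ℕ) (w : List Bool) : (tapeOf r (regs [0, 0, 0, 0, 0, 0, 0]) w) =
    fun z => if 0 ≤ z then w[z.toNat]? else none := by
  have h0 : ∀ i, regs [0, 0, 0, 0, 0, 0, 0] i = 0 := fun i => regs_eq_zero (k := 0) (by simp) i (by simp)
  funext z
  rcases z with n | n
  · simp [tapeOf]
  · simp [tapeOf, h0]

/-- The search for the least `k` with `G x k = 0`, as a Turing machine. -/
theorem exists_search_TM {G H B : ℕ → ℕ → ℕ} (hG : Primrec₂ G) (hH : Primrec₂ H)
    (hB : Primrec₂ B) : ∃ M : TM, ∀ w,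
      (∀ k v, G (num w) k = 0 → (∀ j < k, G (num w) j ≠ 0) → H (num w) k = num v →
        ∃ T, M.HaltsWith w (decide (B (num w) k ≠ 0)) T ∧
          ∀ i : ℕ, i ≤ v.length → T.nth (i : ℤ) = v[i]?) ∧
      ((∀ k, G (num w) k ≠ 0) → ∀ b T, ¬ M.HaltsWith w b T) := by
  obtain ⟨pA, pB, pC, hA, hB', hC⟩ := exists_searchProg hG hH hB
  obtain ⟨r, hr, h3, hb⟩ : ∃ r, 2 < r ∧ 3 < r ∧ pA.Bounded r ∧ pB.Bounded r ∧ pC.Bounded r := by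
    obtain ⟨a, ha⟩ := pA.exists_bounded
    obtain ⟨b, hb⟩ := pB.exists_bounded
    obtain ⟨c, hc⟩ := pC.exists_bounded
    exact ⟨a + b + c + 4, by omega, by omega, ha.mono (by omega), hb.mono (by omega),
      hc.mono (by omega)⟩
  -- Counter `2` holds `G x k` and guards the search loop; the final test of counter `3`, which
  -- holds `B x k`, gives the answer.
  let F : Frag Bool := Frag.bind (Frag.ofProg r pA) fun _ =>
    Frag.bind (Frag.ofProg r (.loop 2 pB)) fun _ =>
    Frag.bind (Frag.ofProg r pC) fun _ => Frag.testF r 3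
  obtain ⟨M, hM⟩ := F.exists_TM
  refine ⟨M, fun w => ⟨fun k v hk hlt hv => ?_, fun hk b T hT => ?_⟩⟩
  · obtain ⟨s, hs, hs3⟩ := hC _ k v hv
    have loop : ∀ m j, j + m = k → Exec (.loop 2 pB)
        (regs [num w, j, G (num w) j, 0, 0, 0, 0], []) (regs [num w, k, 0, 0, 0, 0, 0], []) := by
      intro m
      induction m with
      | zero =>
        rintro j rfl
        rw [add_zero] at hk ⊢
        rw [hk]
        exact .done rfl
      | succ m ih =>
        intro j hj
        exact .again (hlt j (by omega)) (hB' _ _ _) (ih (j + 1) (by omega))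
    have h1 := (hA w).exits hb.1
    rw [tapeOf_init] at h1
    have hF : F.Exits _ _ := h1.bind (((loop k 0 (by omega)).exits ⟨hr, hb.2.1⟩).bind
      ((hs.exits hb.2.2).bind (Frag.exits_testF h3 s v)))
    rw [hs3] at hF
    obtain ⟨T, hT, hS⟩ := (hM w _).2 _ hF
    refine ⟨T, hT, fun i _ => ?_⟩
    rw [hS i, zero_add]
    exact tapeOf_nat (r := r) (s := s) i
  · obtain ⟨t, ht⟩ := (hM w b).1 T hT
    obtain ⟨_, t1, h1, h2⟩ := Frag.exits_bind.1 ht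
    have h1' := (hA w).exits hb.1
    rw [tapeOf_init] at h1'
    obtain ⟨-, rfl⟩ := Prod.mk.inj (h1.det h1')
    -- An exit of the whole would contain an exit of the search loop, whose guard never vanishes.
    obtain ⟨_, t2, h3, -⟩ := Frag.exits_bind.1 h2
    exact Exec.not_exits hr hb.2.1 (fun k => (regs [num w, k, G (num w) k, 0, 0, 0, 0], []))
      (fun k => hB' _ _ _) hk _ h3

/-- The inverse of `num`. -/
def unnum (n : ℕ) : List Bool := (Nat.bits (n + 1)).dropLast

/-- The binary digits of `num w + 1`, from the lowest on, are those of `w` followed by the leading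
`1`. -/
theorem unnum_num (w : List Bool) : unnum (num w) = w := by
  have : ∀ w, Nat.bits (num w + 1) = w ++ [true] := by
    intro w
    induction w with
    | nil => simp
    | cons b w ih =>
      have e : num (b :: w) + 1 = Nat.bit b (num w + 1) := by
        rw [num_cons, Nat.bit_val]; cases b <;> simp <;> ring
      rw [e, Nat.bits_append_bit _ _ (by simp), ih, List.cons_append]
  rw [unnum, this, List.dropLast_concat]

section

variable {α : Type} [Primcodable α]

@[fun_prop] theorem PR.unnum {f : α → ℕ} (hf : PR f) : PR (fun a => unnum (f a)) := by
  have : PR (fun a => (Nat.bits (f a + 1)).reverse.tail.reverse) :=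
    Primrec.list_reverse.comp (Primrec.list_tail.comp (Primrec.list_reverse.comp
      (by fun_prop : PR _)))
  exact Primrec.of_eq this fun a => by simp [KRF.unnum]

@[fun_prop] theorem PR.num {f : α → List Bool} (hf : PR f) : PR (fun a => num (f a)) := by
  have : PR (fun b : Bool => b.toNat) := Primrec.dom_bool _
  unfold KRF.num
  fun_prop

end

/-- `T` shows the string `v`, followed by a blank. -/
def Reads (T : Turing.Tape (Option Bool)) (v : List Bool) : Prop :=
  ∀ i : ℕ, i ≤ v.length → T.nth (i : ℤ) = v[i]?

/-- If one string were shorter, the blank that ends it would be a symbol of the other. -/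
theorem Reads.unique {T : Turing.Tape (Option Bool)} {v v' : List Bool} (h : Reads T v)
    (h' : Reads T v') : v = v' := by
  have key : ∀ {v v' : List Bool}, Reads T v → Reads T v' → ¬ v.length < v'.length := by
    intro v v' h h' hl
    have h1 := h _ le_rfl
    rw [h' _ hl.le, List.getElem?_eq_getElem hl] at h1
    simp at h1
  have hl : v.length = v'.length := by
    have := key h h'; have := key h' h; omega
  refine List.ext_getElem? fun i => ?_
  by_cases hi : i ≤ v.length
  · rw [← h i hi, h' i (by omega)]
  · rw [List.getElem?_eq_none (by omega), List.getElem?_eq_none (by omega)]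

/-- Every recursively enumerable single-valued relation is computed by a Turing machine. -/
theorem RE.exists_TM {R : List Bool × Bool × List Bool → Prop} (hR : RE R)
    (hf : ∀ w x y, R (w, x) → R (w, y) → x = y) :
    ∃ M : TM, ∀ w b v, (∃ T, M.HaltsWith w b T ∧ Reads T v) ↔ R (w, b, v) := by
  obtain ⟨f, hf', h⟩ := hR
  let D : ℕ → Option ((Bool × List Bool) × ℕ) := Encodable.decode
  have hb : PR (fun b : Bool => b.toNat) := Primrec.dom_bool _
  have hD : PR D := Primrec.decode
  -- The number `k` sought codes an answer, an output, and an index at which the matrix `f` confirms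
  -- them. The default `1` in `G` keeps numbers without this form from ending the search.
  obtain ⟨M, hM⟩ := exists_search_TM
    (G := fun x k => (D k).elim 1 fun y => bif f ((unnum x, y.1), y.2) then 0 else 1)
    (H := fun x k => (D k).elim 0 fun y => num y.1.2)
    (B := fun x k => (D k).elim 0 fun y => y.1.1.toNat)
    (Primrec₂.mk (by fun_prop : PR _)) (Primrec₂.mk (by fun_prop : PR _))
    (Primrec₂.mk (by fun_prop : PR _))
  simp only [unnum_num] at hM
  refine ⟨M, fun w => ?_⟩
  have hG : ∀ k, (D k).elim 1 (fun y => bif f ((w, y.1), y.2) then 0 else 1) = 0 ↔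
      ∃ y, D k = some y ∧ f ((w, y.1), y.2) = true := by
    intro k
    cases e : D k with
    | none => simp
    | some y =>
      simp only [Option.elim_some, Option.some.injEq, exists_eq_left']
      cases f ((w, y.1), y.2) <;> simp
  by_cases hex : ∃ k, (D k).elim 1 (fun y => bif f ((w, y.1), y.2) then 0 else 1) = 0
  · classical
    have h0 := Nat.find_spec hex
    obtain ⟨⟨⟨b, v⟩, n⟩, h1, h2⟩ := (hG _).1 h0
    obtain ⟨T, hT, hv⟩ := (hM w).1 _ v h0 (fun j hj => Nat.find_min hex hj) (by rw [h1]; rfl)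
    have e : decide ((D (Nat.find hex)).elim 0 (fun y => y.1.1.toNat) ≠ 0) = b := by
      rw [h1]; cases b <;> simp
    rw [e] at hT
    have hRw : R (w, b, v) := (h _).2 ⟨n, h2⟩
    intro b' v'
    constructor
    · rintro ⟨T', hT', hv'⟩
      obtain ⟨rfl, rfl⟩ := hT.det hT'
      rwa [Reads.unique hv' hv]
    · intro h'
      obtain ⟨rfl, rfl⟩ := Prod.mk.inj (hf _ _ _ hRw h')
      exact ⟨T, hT, hv⟩
  · rw [not_exists] at hex
    intro b v
    constructor
    · rintro ⟨T, hT, -⟩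
      exact absurd hT ((hM w).2 hex b T)
    · intro h'
      obtain ⟨n, hn⟩ := (h _).1 h'
      refine absurd ((hG (Encodable.encode ((b, v), n))).2 ⟨((b, v), n), ?_, hn⟩) (hex _)
      exact Encodable.encodek _

/-- The halting computations of a Turing machine have an output. -/
theorem exists_reads (T : Turing.Tape (Option Bool)) : ∃ v, Reads T v := by
  obtain ⟨L, hL⟩ : ∃ L : List (Option Bool), T.right₀ = Turing.ListBlank.mk L :=
    ⟨_, (Quotient.out_eq' T.right₀).symm⟩
  have key : ∀ L : List (Option Bool), ∃ v : List Bool, ∀ i : ℕ, i ≤ v.length →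
      (Turing.ListBlank.mk L).nth i = v[i]? := by
    intro L
    induction L with
    | nil =>
      refine ⟨[], fun i hi => ?_⟩
      obtain rfl : i = 0 := by simpa using hi
      simp; rfl
    | cons a L ih =>
      obtain ⟨v, hv⟩ := ih
      cases a with
      | none =>
        refine ⟨[], fun i hi => ?_⟩
        obtain rfl : i = 0 := by simpa using hi
        simp
      | some b =>
        refine ⟨b :: v, fun i hi => ?_⟩
        cases i with
        | zero => simp
        | succ i =>
          have := hv i (by simpa using hi)
          rw [Turing.ListBlank.nth_mk] at this ⊢
          simpa using this
  obtain ⟨v, hv⟩ := key L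
  refine ⟨v, fun i hi => ?_⟩
  rw [← Turing.Tape.right₀_nth, hL]
  exact hv i hi

/-- The relation has only the answer "yes" with the empty output, so outside of `P` the machine runs
for ever. -/
theorem RE.exists_TM_accepts {P : List Bool → Prop} (hP : RE P) :
    ∃ M : TM, ∀ w, M.Accepts w ↔ P w := by
  obtain ⟨M, hM⟩ := RE.exists_TM (R := fun x => P x.1 ∧ x.2 = (true, []))
    ((hP.comp (by fun_prop)).and (of_dec (by fun_prop)))
    (fun w x y hx hy => hx.2.trans hy.2.symm)
  refine ⟨M, fun w => ⟨?_, fun h => ?_⟩⟩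
  · rintro ⟨T, hT⟩
    obtain ⟨v, hv⟩ := exists_reads T
    exact ((hM w true v).1 ⟨T, hT, hv⟩).1
  · obtain ⟨T, hT, -⟩ := (hM w true []).2 ⟨h, rfl⟩
    exact ⟨T, hT⟩

theorem RE.exists_TM_outputs {R : List Bool × List Bool → Prop} (hR : RE R)
    (hf : ∀ w x y, R (w, x) → R (w, y) → x = y) : ∃ M : TM, ∀ w v, M.Outputs w v ↔ R (w, v) := by
  obtain ⟨M, hM⟩ := RE.exists_TM (R := fun x => R (x.1, x.2.2) ∧ x.2.1 = true)
    ((hR.comp (by fun_prop)).and (of_dec (by fun_prop)))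
    (fun w x y hx hy => Prod.ext (hx.2.trans hy.2.symm) (hf w _ _ hx.1 hy.1))
  refine ⟨M, fun w v => ⟨?_, fun h => ?_⟩⟩
  · rintro ⟨b, T, hT⟩
    exact ((hM w b v).1 ⟨T, hT⟩).1
  · obtain ⟨T, hT⟩ := (hM w true v).2 ⟨h, rfl⟩
    exact ⟨true, T, hT⟩

theorem isRecursive_of_PR {f : List Bool → Bool} (hf : PR f) : IsRecursive {w | f w = true} := by
  obtain ⟨M, hM⟩ := RE.exists_TM (R := fun x => x.2 = (f x.1, []))
    (RE.of_dec (by fun_prop)) (fun w x y hx hy => hx.trans hy.symm)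
  refine ⟨M, fun w => ⟨fun h => ?_, fun h => ?_⟩⟩
  · obtain ⟨T, hT, -⟩ := (hM w true []).2 (by simp_all)
    exact ⟨T, hT⟩
  · obtain ⟨T, hT, -⟩ := (hM w false []).2 (by simp_all)
    exact ⟨T, hT⟩

/-! ### Simulation of Turing machines given by their codes -/

/-- The coded instruction for a state and a symbol. -/
abbrev CellData := Option (ℕ × Option Bool × Bool)

/-- The status of a state and the instructions for `B`, `0`, `1`. -/
abbrev RowData := Option Bool × CellData × CellData × CellData

/-- The number of states, the starting state, and the table of a machine. -/
abbrev MachineData := ℕ × ℕ × List RowData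

/-- State, tape to the left (from the head), scanned symbol, tape to the right. -/
abbrev SimCfg := ℕ × List (Option Bool) × Option Bool × List (Option Bool)

namespace TM

/-- The coded instruction of a machine. -/
def cell (M : TM) (q : Fin M.numStates) (a : Option Bool) : CellData :=
  (M.instr q a).map fun i => (i.1.val, i.2.1, decide (i.2.2 = Turing.Dir.right))

/-- The row of the table for a state. -/
def row (M : TM) (q : Fin M.numStates) : RowData :=
  (M.status q, M.cell q none, M.cell q (some false), M.cell q (some true))

/-- The data encoded by `M.code`. -/
def data (M : TM) : MachineData := (M.numStates, M.start.val, List.ofFn M.row)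

theorem code_eq (M : TM) : M.code = Encodable.encode M.data := rfl

end TM

/-- The instruction in a row for a symbol. -/
def RowData.get (r : RowData) (a : Option Bool) : CellData :=
  a.elim r.2.1 fun b => bif b then r.2.2.2 else r.2.2.1

theorem TM.get_row (M : TM) (q : Fin M.numStates) (a : Option Bool) :
    RowData.get (M.row q) a = M.cell q a := by
  rcases a with _ | _ | _ <;> rfl

/-- One step of the simulation; a halted configuration is repeated. -/
def simStep (D : MachineData) (c : SimCfg) : SimCfg :=
  (D.2.2[c.1]?).elim c fun r => bif r.1.isSome then c else
    (RowData.get r c.2.2.1).elim c fun i =>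
      bif i.2.2 then (i.1, i.2.1 :: c.2.1, c.2.2.2.headI, c.2.2.2.tail)
      else (i.1, c.2.1.tail, c.2.1.headI, i.2.1 :: c.2.2.2)

/-- The initial configuration of the simulation. -/
def simInit (D : MachineData) (w : List Bool) : SimCfg :=
  (D.2.1, [], (w.map some).headI, (w.map some).tail)

/-- The configuration after `n` steps. -/
def simRun (D : MachineData) (w : List Bool) (n : ℕ) : SimCfg := (simStep D)^[n] (simInit D w)

/-- The string before the first blank. -/
def untilBlank (l : List (Option Bool)) : List Bool :=
  l.foldr (fun a v => a.elim [] fun b => b :: v) []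

section

variable {α : Type} [Primcodable α]

@[fun_prop] theorem PR.simRun {f : α → MachineData} {g : α → List Bool} {h : α → ℕ} (hf : PR f)
    (hg : PR g) (hh : PR h) : PR (fun a => simRun (f a) (g a) (h a)) := by
  unfold KRF.simRun simStep simInit RowData.get
  fun_prop

@[fun_prop] theorem PR.untilBlank {f : α → List (Option Bool)} (hf : PR f) :
    PR (fun a => untilBlank (f a)) := by
  unfold KRF.untilBlank
  fun_prop

end

/-- The simulated tape. -/
def SimCfg.tape (c : SimCfg) : Turing.Tape (Option Bool) :=
  ⟨c.2.2.1, Turing.ListBlank.mk c.2.1, Turing.ListBlank.mk c.2.2.2⟩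

theorem SimCfg.reads_tape (c : SimCfg) : Reads c.tape (untilBlank (c.2.2.1 :: c.2.2.2)) := by
  have key : ∀ (L : List (Option Bool)) (i : ℕ), i ≤ (untilBlank L).length →
      L.getI i = (untilBlank L)[i]? := by
    intro L
    induction L with
    | nil =>
      intro i hi
      obtain rfl : i = 0 := by simpa [untilBlank] using hi
      rfl
    | cons a L ih =>
      cases a with
      | none =>
        intro i hi
        obtain rfl : i = 0 := by simpa [untilBlank] using hi
        rfl
      | some b =>
        have e : untilBlank (some b :: L) = b :: untilBlank L := rfl
        rw [e]
        intro i hi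
        cases i with
        | zero => rfl
        | succ i => simpa using ih i (by simpa using hi)
  intro i hi
  rw [← key _ i hi]
  cases i with
  | zero => rfl
  | succ i =>
    change (Turing.ListBlank.mk c.2.2.2).nth i = _
    rw [Turing.ListBlank.nth_mk]
    rfl

/-- The status of the state of a configuration. -/
def simStatus (D : MachineData) (c : SimCfg) : Option Bool := (D.2.2[c.1]?).elim none fun r => r.1

/-- The output in a configuration. -/
def simOut (c : SimCfg) : List Bool := untilBlank (c.2.2.1 :: c.2.2.2)

section

variable {α : Type} [Primcodable α]

@[fun_prop] theorem PR.simStatus {f : α → MachineData} {g : α → SimCfg} (hf : PR f)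
    (hg : PR g) : PR (fun a => simStatus (f a) (g a)) := by
  unfold KRF.simStatus
  fun_prop

@[fun_prop] theorem PR.simOut {f : α → SimCfg} (hf : PR f) : PR (fun a => simOut (f a)) := by
  unfold KRF.simOut
  fun_prop

@[fun_prop] theorem PR.encodeMachineData {f : α → MachineData} (hf : PR f) :
    PR (fun a => Encodable.encode (f a)) := PR.encode hf

end

/-- The machine with the code `x.1` halts on input `x.2.1` with the answer `x.2.2.1` and the output
`x.2.2.2`. -/
def HaltsCode (x : ℕ × List Bool × Bool × List Bool) : Prop :=
  ∃ (D : MachineData) (n : ℕ), Encodable.encode D = x.1 ∧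
    simStatus D (simRun D x.2.1 n) = some x.2.2.1 ∧ simOut (simRun D x.2.1 n) = x.2.2.2

theorem re_haltsCode : RE HaltsCode := by
  refine RE.ex (P := fun (x : ℕ × List Bool × Bool × List Bool) (D : MachineData) => ∃ n : ℕ,
    Encodable.encode D = x.1 ∧ simStatus D (simRun D x.2.1 n) = some x.2.2.1 ∧
    simOut (simRun D x.2.1 n) = x.2.2.2) ?_
  refine RE.ex (P := fun (y : (ℕ × List Bool × Bool × List Bool) × MachineData) (n : ℕ) =>
    Encodable.encode y.2 = y.1.1 ∧ simStatus y.2 (simRun y.2 y.1.2.1 n) = some y.1.2.2.1 ∧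
    simOut (simRun y.2 y.1.2.1 n) = y.1.2.2.2) ?_
  refine (RE.of_dec ?_).and ((RE.of_dec ?_).and (RE.of_dec ?_))
  · have h : PR (fun p : ((ℕ × List Bool × Bool × List Bool) × MachineData) × ℕ =>
      Encodable.encode p.1.2) := by fun_prop
    exact PR.decEq h (by fun_prop)
  · exact PR.decEq (by fun_prop) (by fun_prop)
  · exact PR.decEq (by fun_prop) (by fun_prop)

namespace TM

variable {M : TM}

/-- The simulation is in the configuration `c`. -/
def Sim (c : M.Cfg) (s : SimCfg) : Prop := s.1 = c.state.val ∧ s.tape = c.tape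

theorem getElem?_table (M : TM) (q : Fin M.numStates) : M.data.2.2[q.val]? = some (M.row q) := by
  simp [data]

/-- The lists of the simulation represent the two sides of the tape only up to trailing blanks. This
suffices, as `headI` and `tail` on lists agree with head and tail of the represented sides, the
default symbol being the blank. -/
theorem Sim.step {c c' : M.Cfg} {s : SimCfg} (h : Sim c s) (hc : M.step c = some c') :
    Sim c' (simStep M.data s) := by
  obtain ⟨q, T⟩ := c
  obtain ⟨q0, L, a, R⟩ := s
  obtain ⟨h1, h2⟩ := h
  dsimp only at h1 h2
  subst h1 h2
  simp only [TM.step] at hc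
  split_ifs at hc with hq
  simp only [SimCfg.tape, Option.map_eq_some_iff] at hc
  obtain ⟨⟨q', b, d⟩, hi, rfl⟩ := hc
  have hg : RowData.get (M.row q) a = some (q'.val, b, decide (d = .right)) := by
    rw [get_row, cell, hi]; rfl
  have hr : (M.row q).1.isSome = false := by simp [row, hq]
  simp only [simStep, getElem?_table, Option.elim_some, hr, cond_false, hg]
  cases d
  · refine ⟨rfl, ?_⟩
    simp [SimCfg.tape, Turing.Tape.write, Turing.Tape.move]
  · refine ⟨rfl, ?_⟩
    simp [SimCfg.tape, Turing.Tape.write, Turing.Tape.move]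

/-- Repeating the last configuration makes the simulation total, so that it can be run for any
number of steps. -/
theorem Sim.stuck {c : M.Cfg} {s : SimCfg} (h : Sim c s) (hc : M.step c = none) :
    simStep M.data s = s := by
  obtain ⟨q, T⟩ := c
  obtain ⟨q0, L, a, R⟩ := s
  obtain ⟨h1, h2⟩ := h
  dsimp only at h1 h2
  subst h1 h2
  simp only [simStep, getElem?_table, Option.elim_some]
  cases hr : (M.row q).1 with
  | some b => rfl
  | none =>
    have hq : M.status q = none := hr
    simp only [TM.step, hq, if_true, Option.map_eq_none_iff] at hc
    have hg : RowData.get (M.row q) a = none := by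
      rw [get_row, cell]
      simpa [SimCfg.tape] using hc
    simp [hg]

theorem sim_init (M : TM) (w : List Bool) : Sim (M.init w) (simInit M.data w) := by
  refine ⟨rfl, ?_⟩
  simp [simInit, SimCfg.tape, TM.init, Turing.Tape.mk₁, Turing.Tape.mk₂, Turing.Tape.mk']

theorem exists_reaches_sim (w : List Bool) (n : ℕ) :
    ∃ c, StateTransition.Reaches M.step (M.init w) c ∧ Sim c (simRun M.data w n) := by
  induction n with
  | zero => exact ⟨_, .refl, sim_init M w⟩
  | succ n ih =>
    obtain ⟨c, h1, h2⟩ := ih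
    rw [simRun, Function.iterate_succ_apply', ← simRun]
    cases hc : M.step c with
    | none => exact ⟨c, h1, by rwa [h2.stuck hc]⟩
    | some c' => exact ⟨c', h1.tail hc, h2.step hc⟩

theorem exists_sim_of_reaches {w : List Bool} {c : M.Cfg}
    (h : StateTransition.Reaches M.step (M.init w) c) : ∃ n, Sim c (simRun M.data w n) := by
  induction h with
  | refl => exact ⟨0, sim_init M w⟩
  | tail _ h ih =>
    obtain ⟨n, hn⟩ := ih
    exact ⟨n + 1, by rw [simRun, Function.iterate_succ_apply', ← simRun]; exact hn.step h⟩

/-- The simulation follows the machine step by step in both directions, which makes `HaltsCode` a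
universal `Σ₁` predicate for halting computations. -/
theorem haltsCode_iff (w : List Bool) (b : Bool) (v : List Bool) :
    HaltsCode (M.code, w, b, v) ↔ ∃ T, M.HaltsWith w b T ∧ Reads T v := by
  constructor
  · rintro ⟨D, n, hD, hs, hv⟩
    obtain rfl : D = M.data := Encodable.encode_injective (hD.trans M.code_eq)
    obtain ⟨c, h1, h2, h3⟩ := exists_reaches_sim (M := M) w n
    refine ⟨c.tape, ⟨c, h1, ?_, rfl⟩, ?_⟩
    · simp only [simStatus, h2, getElem?_table] at hs
      exact hs
    · dsimp only at hv
      rw [← h3, ← hv]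
      exact SimCfg.reads_tape _
  · rintro ⟨T, ⟨c, h1, h2, rfl⟩, hv⟩
    obtain ⟨n, hn, hn'⟩ := exists_sim_of_reaches h1
    refine ⟨M.data, n, M.code_eq.symm, ?_, ?_⟩
    · simp only [simStatus, hn, getElem?_table]
      exact h2
    · refine Reads.unique ?_ hv
      rw [← hn']
      exact SimCfg.reads_tape _

theorem accepts_iff_haltsCode (w : List Bool) :
    M.Accepts w ↔ ∃ v, HaltsCode (M.code, w, true, v) := by
  simp only [haltsCode_iff]
  constructor
  · rintro ⟨T, hT⟩
    obtain ⟨v, hv⟩ := exists_reads T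
    exact ⟨v, T, hT, hv⟩
  · rintro ⟨v, T, hT, -⟩
    exact ⟨T, hT⟩

theorem outputs_iff_haltsCode (w v : List Bool) :
    M.Outputs w v ↔ ∃ b, HaltsCode (M.code, w, b, v) := by
  simp only [haltsCode_iff]
  rfl

theorem Outputs.unique {w v v' : List Bool} (h : M.Outputs w v) (h' : M.Outputs w v') :
    v = v' := by
  obtain ⟨b, T, hT, hv⟩ := h
  obtain ⟨b', T', hT', hv'⟩ := h'
  obtain ⟨-, rfl⟩ := hT.det hT'
  exact Reads.unique hv hv'

end TM

/-- The machine with the code `x.1` accepts `x.2`. -/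
def AcceptsCode (x : ℕ × List Bool) : Prop := ∃ v, HaltsCode (x.1, x.2, true, v)

theorem re_acceptsCode : RE AcceptsCode :=
  RE.ex (P := fun (x : ℕ × List Bool) v => HaltsCode (x.1, x.2, true, v))
    (re_haltsCode.comp (by fun_prop))

theorem TM.acceptsCode {M : TM} {w : List Bool} : AcceptsCode (M.code, w) ↔ M.Accepts w :=
  (accepts_iff_haltsCode w).symm

/-- The machine with the code `x.1` on input `x.2.1` has the output `x.2.2`. -/
def OutputsCode (x : ℕ × List Bool × List Bool) : Prop := ∃ b, HaltsCode (x.1, x.2.1, b, x.2.2)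

theorem re_outputsCode : RE OutputsCode :=
  RE.ex (P := fun (x : ℕ × List Bool × List Bool) b => HaltsCode (x.1, x.2.1, b, x.2.2))
    (re_haltsCode.comp (by fun_prop))

theorem TM.outputsCode {M : TM} {w v : List Bool} : OutputsCode (M.code, w, v) ↔ M.Outputs w v :=
  (outputs_iff_haltsCode w v).symm

/-- A set decided by a machine, pulled back along the encoding, is recursively enumerable. -/
theorem IsRecursive.re {L : Set (List Bool)} (hL : IsRecursive L) : RE (fun w => w ∈ L) := by
  obtain ⟨M, hM⟩ := hL
  refine (re_acceptsCode.comp (g := fun w => (M.code, w)) (by fun_prop)).of_eq fun w => ?_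
  rw [TM.acceptsCode]
  refine ⟨(hM w).1, fun h => by_contra fun hw => ?_⟩
  obtain ⟨T, hT⟩ := h
  obtain ⟨T', hT'⟩ := (hM w).2 hw
  exact absurd (hT.det hT').1 (by simp)

/-! ### The codes of Turing machines -/

/-- The state in the instruction is less than `n`. -/
def cellOk (n : ℕ) (c : CellData) : Bool := c.elim true fun i => decide (i.1 < n)

/-- The states in the instructions of the row are less than `n`. -/
def rowOk (n : ℕ) (r : RowData) : Bool := cellOk n r.2.1 && cellOk n r.2.2.1 && cellOk n r.2.2.2

/-- The data are those of a Turing machine. -/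
def validData (D : MachineData) : Bool :=
  decide (D.2.2.length = D.1) && decide (D.2.1 < D.1) && D.2.2.any (fun r => r.1.isSome) &&
    D.2.2.all fun r => rowOk D.1 r

/-- The number is the code of a Turing machine. -/
def isCode (m : ℕ) : Bool := (Encodable.decode m : Option MachineData).elim false fun D =>
  validData D && decide (Encodable.encode D = m)

section

variable {α : Type} [Primcodable α]

@[fun_prop] theorem PR.cellOk {f : α → ℕ} {g : α → CellData} (hf : PR f) (hg : PR g) :
    PR (fun a => cellOk (f a) (g a)) := by
  unfold KRF.cellOk
  fun_prop

@[fun_prop] theorem PR.rowOk {f : α → ℕ} {g : α → RowData} (hf : PR f) (hg : PR g) :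
    PR (fun a => rowOk (f a) (g a)) := by
  unfold KRF.rowOk
  fun_prop

@[fun_prop] theorem PR.validData {f : α → MachineData} (hf : PR f) :
    PR (fun a => validData (f a)) := by
  unfold KRF.validData
  fun_prop

@[fun_prop] theorem PR.isCode {f : α → ℕ} (hf : PR f) : PR (fun a => isCode (f a)) := by
  unfold KRF.isCode
  refine PR.elim (PR.decode hf) (PR.const _) ?_
  refine PR.band (by fun_prop) (PR.decEq ?_ ?_)
  · exact PR.encodeMachineData (by fun_prop)
  · fun_prop

end

theorem validData_iff (D : MachineData) : validData D = true ↔ ∃ M : TM, M.data = D := by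
  constructor
  · obtain ⟨n, s, tab⟩ := D
    intro h
    simp only [validData, Bool.and_eq_true, decide_eq_true_eq, List.any_eq_true,
      List.all_eq_true] at h
    obtain ⟨⟨⟨rfl, hs⟩, r0, hr0, hr0'⟩, hcells⟩ := h
    have hget : ∀ q : Fin tab.length, ∀ a i, RowData.get tab[q] a = some i → i.1 < tab.length := by
      intro q a i hi
      have h := hcells tab[q] (List.getElem_mem _)
      simp only [rowOk, Bool.and_eq_true] at h
      obtain ⟨⟨h0, h1⟩, h2⟩ := h
      rcases a with _ | _ | _
      · rw [show tab[q].2.1 = some i from hi] at h0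
        exact of_decide_eq_true h0
      · rw [show tab[q].2.2.1 = some i from hi] at h1
        exact of_decide_eq_true h1
      · rw [show tab[q].2.2.2 = some i from hi] at h2
        exact of_decide_eq_true h2
    let M : TM :=
      { numStates := tab.length
        start := ⟨s, hs⟩
        status := fun q => tab[q].1
        exists_halting := by
          obtain ⟨i, hi, e⟩ := List.getElem_of_mem hr0
          refine ⟨⟨i, hi⟩, ?_⟩
          change tab[i].1 ≠ none
          rw [e]
          exact Option.isSome_iff_ne_none.1 hr0'
        -- The inner `none` is never reached: by `hget` all target states are in range.
        instr := fun q a => (RowData.get tab[q] a).bind fun i =>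
          if hi : i.1 < tab.length then some (⟨i.1, hi⟩, i.2.1, if i.2.2 then .right else .left)
          else none }
    have hcell : ∀ q a, M.cell q a = RowData.get tab[q] a := by
      intro q a
      simp only [TM.cell, M]
      cases e : RowData.get tab[q] a with
      | none => rfl
      | some i =>
        simp only [Option.bind_some, dif_pos (hget q a i e), Option.map_some]
        obtain ⟨i, b, d⟩ := i
        cases d <;> simp
    refine ⟨M, ?_⟩
    simp only [TM.data]
    refine Prod.ext rfl (Prod.ext rfl ?_)
    refine List.ext_getElem (by simp [M]) fun i h1 h2 => ?_
    simp only [List.getElem_ofFn, TM.row, hcell]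
    rfl
  · rintro ⟨M, rfl⟩
    have hc : ∀ q a, cellOk M.numStates (M.cell q a) = true := by
      intro q a
      unfold TM.cell cellOk
      cases M.instr q a with
      | none => rfl
      | some i => simp
    simp only [validData, TM.data, Bool.and_eq_true, decide_eq_true_eq, List.any_eq_true,
      List.all_eq_true, List.length_ofFn, Fin.is_lt, and_true, true_and]
    refine ⟨?_, ?_⟩
    · obtain ⟨q, hq⟩ := M.exists_halting
      exact ⟨M.row q, List.mem_ofFn.2 ⟨q, rfl⟩, Option.isSome_iff_ne_none.2 hq⟩
    · intro r hr
      obtain ⟨q, rfl⟩ := List.mem_ofFn.1 hr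
      simp only [rowOk, Bool.and_eq_true]
      exact ⟨⟨hc q _, hc q _⟩, hc q _⟩

theorem isCode_iff (m : ℕ) : isCode m = true ↔ ∃ M : TM, M.code = m := by
  unfold isCode
  constructor
  · intro h
    cases e : (Encodable.decode m : Option MachineData) with
    | none => simp [e] at h
    | some D =>
      rw [e, Option.elim_some, Bool.and_eq_true, decide_eq_true_eq] at h
      obtain ⟨M, rfl⟩ := (validData_iff D).1 h.1
      exact ⟨M, h.2⟩
  · rintro ⟨M, rfl⟩
    rw [TM.code_eq, Encodable.encodek]
    simpa using (validData_iff _).2 ⟨M, rfl⟩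

/-! ### Machines with a hard-wired argument -/

/-- The symbol written, in the place of `s`, in the state number `j` of the preamble. -/
def preambleSymbol (a j : ℕ) (s : Option Bool) : Option Bool :=
  bif decide (j ≤ a) then some true else bif decide (j = a + 1) then some false else s

namespace TM

/-- The machine that writes `1ᵃ0` in front of its input and then works like `U`. -/
def hardwire (U : TM) (a : ℕ) : TM where
  numStates := U.numStates + (a + 3)
  start := Fin.natAdd _ (Fin.last _)
  status := Fin.addCases U.status fun _ => none
  exists_halting := by
    obtain ⟨q, hq⟩ := U.exists_halting
    exact ⟨Fin.castAdd _ q, by rwa [Fin.addCases_left]⟩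
  instr := Fin.addCases (fun q s => (U.instr q s).map fun i => (Fin.castAdd _ i.1, i.2)) <|
    Fin.cases (fun s => some (Fin.castAdd _ U.start, s, .right)) fun j s =>
      some (Fin.natAdd _ j.castSucc, preambleSymbol a (j + 1) s, .left)

end TM

/-- A row of the preamble; `n` is the number of states, `s` the starting state of the machine. -/
def preambleRow (n s a j : ℕ) : RowData :=
  bif decide (j = 0) then
    (none, some (s, none, true), some (s, some false, true), some (s, some true, true))
  else (none, some (n + (j - 1), preambleSymbol a j none, false),
    some (n + (j - 1), preambleSymbol a j (some false), false),
    some (n + (j - 1), preambleSymbol a j (some true), false))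

/-- The data of `U.hardwire a`, if `D` are the data of `U`. -/
def hardwireData (D : MachineData) (a : ℕ) : MachineData :=
  (D.1 + (a + 3), D.1 + (a + 2),
    D.2.2 ++ (List.range (a + 3)).map fun j => preambleRow D.1 D.2.1 a j)

/-- The code of `U.hardwire a`, if `u` is the code of `U`. -/
def hardwireCode (u a : ℕ) : ℕ :=
  (Encodable.decode u : Option MachineData).elim 0 fun D => Encodable.encode (hardwireData D a)

section

variable {α : Type} [Primcodable α]

@[fun_prop] theorem PR.preambleSymbol {f g : α → ℕ} {h : α → Option Bool} (hf : PR f) (hg : PR g)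
    (hh : PR h) : PR (fun a => preambleSymbol (f a) (g a) (h a)) := by
  unfold KRF.preambleSymbol
  fun_prop

@[fun_prop] theorem PR.preambleRow {f g h k : α → ℕ} (hf : PR f) (hg : PR g)
    (hh : PR h) (hk : PR k) : PR (fun a => preambleRow (f a) (g a) (h a) (k a)) := by
  unfold KRF.preambleRow
  fun_prop

@[fun_prop] theorem PR.hardwireData {f : α → MachineData} {g : α → ℕ} (hf : PR f) (hg : PR g) :
    PR (fun a => hardwireData (f a) (g a)) := by
  unfold KRF.hardwireData
  fun_prop

@[fun_prop] theorem PR.hardwireCode {f g : α → ℕ} (hf : PR f) (hg : PR g) :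
    PR (fun a => hardwireCode (f a) (g a)) := by
  unfold KRF.hardwireCode
  refine PR.elim (PR.decode hf) (PR.const _) (PR.encodeMachineData ?_)
  fun_prop

end

namespace TM

variable {U : TM} {a : ℕ}

theorem hardwire_row_castAdd (q : Fin U.numStates) :
    (U.hardwire a).row (Fin.castAdd _ q) = U.row q := by
  have h : ∀ s, (U.hardwire a).cell (Fin.castAdd _ q) s = U.cell q s := by
    intro s
    simp [cell, hardwire, Fin.addCases_left, Function.comp_def]
  simp only [row, h]
  simp [hardwire, Fin.addCases_left]

theorem hardwire_row_natAdd (j : Fin (a + 3)) :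
    (U.hardwire a).row (Fin.natAdd _ j) = preambleRow U.numStates U.start a j := by
  refine Fin.cases ?_ (fun j => ?_) j
  · simp [row, cell, hardwire, Fin.addCases_right, preambleRow]
  · simp [row, cell, hardwire, Fin.addCases_right, preambleRow]

/-- The states of `U` come first and keep their numbers, so its table is an initial segment of the
new one and only the rows of the preamble are appended. This makes the code of `U.hardwire a`
primitive recursive in `a` and the code of `U`. -/
theorem data_hardwire : (U.hardwire a).data = hardwireData U.data a := by
  refine Prod.ext rfl (Prod.ext rfl ?_)
  refine (List.ofFn_add (n := U.numStates) (m := a + 3) (f := (U.hardwire a).row)).trans ?_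
  refine congrArg₂ (· ++ ·) ?_ ?_
  · exact congrArg List.ofFn (funext hardwire_row_castAdd)
  · refine List.ext_getElem (by simp) fun i h1 h2 => ?_
    simp only [List.getElem_ofFn, List.getElem_map, List.getElem_range]
    exact hardwire_row_natAdd _

theorem code_hardwire : (U.hardwire a).code = hardwireCode U.code a := by
  rw [code_eq, code_eq, hardwireCode, Encodable.encodek, Option.elim_some, data_hardwire]

/-- The code is a pair whose first component is the number of states, and the preamble alone has
more than `a` of them. The bound makes the range of a hard-wiring decidable. -/
theorem le_code_hardwire : a ≤ (U.hardwire a).code := by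
  refine le_trans ?_ (Nat.left_le_pair _ _ : _ ≤ (U.hardwire a).code)
  change a ≤ U.numStates + (a + 3)
  omega

/-- A configuration of `U` as a configuration of `U.hardwire a`. -/
def Cfg.hardwire (a : ℕ) (c : U.Cfg) : (U.hardwire a).Cfg := ⟨Fin.castAdd _ c.state, c.tape⟩

theorem status_hardwire (c : U.Cfg) :
    (U.hardwire a).status (c.hardwire a).state = U.status c.state := by
  simp only [Cfg.hardwire, hardwire, Fin.addCases_left]

theorem step_hardwire (c : U.Cfg) :
    (U.hardwire a).step (c.hardwire a) = (U.step c).map (Cfg.hardwire a) := by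
  unfold step
  rw [status_hardwire]
  split_ifs
  · have h : (U.hardwire a).instr (c.hardwire a).state =
      fun s => (U.instr c.state s).map fun i => (Fin.castAdd _ i.1, i.2) := by
      simp only [Cfg.hardwire, hardwire, Fin.addCases_left]
    rw [h]
    change Option.map _ (Option.map _ (U.instr c.state c.tape.head)) = _
    cases U.instr c.state c.tape.head <;> rfl
  · rfl

theorem step_preamble_succ (j : Fin (a + 2)) (T : Turing.Tape (Option Bool)) :
    (U.hardwire a).step ⟨Fin.natAdd _ j.succ, T⟩ = some ⟨Fin.natAdd _ j.castSucc,
      (T.write (preambleSymbol a (j + 1) T.head)).move .left⟩ := by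
  simp [step, hardwire, Fin.addCases_right]

theorem step_preamble_zero (T : Turing.Tape (Option Bool)) :
    (U.hardwire a).step ⟨Fin.natAdd _ 0, T⟩ = some ⟨Fin.castAdd _ U.start, T.move .right⟩ := by
  simp [step, hardwire, Fin.addCases_right]

theorem _root_.Turing.Tape.write_move_left_mk₁ {Γ : Type} [Inhabited Γ] (b : Γ) (l : List Γ) :
    (((Turing.Tape.mk₁ l).move .left).write b).move .left =
      (Turing.Tape.mk₁ (b :: l)).move .left := by
  have e : ∀ l : List Γ, (Turing.Tape.mk₁ l).move .left =
      Turing.Tape.mk' (Turing.ListBlank.mk []) ((Turing.ListBlank.mk l).cons default) :=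
    fun l => Turing.Tape.move_left_mk' _ _
  rw [e, Turing.Tape.write_mk', Turing.Tape.move_left_mk', e]
  rfl

/-- The preamble counts its states down. State `a + 2` only steps to the left of the input, state `a
+ 1` writes the `0`, and each of the states `a, …, 1` puts a `1` in front. After `i` of these the
head is one cell to the left of the string written so far; state `0` will move it back. -/
theorem reaches_preamble (w : List Bool) (i : ℕ) (hi : i ≤ a) :
    StateTransition.Reaches (U.hardwire a).step ((U.hardwire a).init w)
      ⟨Fin.natAdd _ ⟨a - i, by omega⟩, (Turing.Tape.mk₁
        ((List.replicate i true ++ false :: w).map some)).move .left⟩ := by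
  induction i with
  | zero =>
    have h1 := step_preamble_succ (U := U) (Fin.last (a + 1)) (Turing.Tape.mk₁ (w.map some))
    have h2 := step_preamble_succ (U := U) (Fin.last a).castSucc
      ((Turing.Tape.mk₁ (w.map some)).move .left)
    have e1 : preambleSymbol a ((Fin.last (a + 1) : ℕ) + 1) (Turing.Tape.mk₁ (w.map some)).head =
        (Turing.Tape.mk₁ (w.map some)).head := by
      simp [preambleSymbol]
    have e2 : preambleSymbol a (((Fin.last a).castSucc : ℕ) + 1)
        ((Turing.Tape.mk₁ (w.map some)).move .left).head = some false := by
      simp [preambleSymbol]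
    rw [e1, Turing.Tape.write_self] at h1
    rw [e2, Turing.Tape.write_move_left_mk₁] at h2
    have e3 : (Fin.last a).castSucc.succ = (Fin.last (a + 1)).castSucc := rfl
    rw [e3] at h2
    have h3 : StateTransition.Reaches (U.hardwire a).step _ _ := .single h1
    exact h3.tail h2
  | succ i ih =>
    refine (ih (by omega)).tail ?_
    have h := step_preamble_succ (U := U) (⟨a - (i + 1), by omega⟩ : Fin (a + 2))
      ((Turing.Tape.mk₁ ((List.replicate i true ++ false :: w).map some)).move .left)
    have e1 : ∀ s, preambleSymbol a ((⟨a - (i + 1), by omega⟩ : Fin (a + 2)) + 1 : ℕ) s =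
        some true := by
      intro s
      have : a - (i + 1) + 1 ≤ a := by omega
      simp [preambleSymbol, this]
    have e2 : (⟨a - i, by omega⟩ : Fin (a + 3)) =
        (⟨a - (i + 1), by omega⟩ : Fin (a + 2)).succ := Fin.ext (by simp; omega)
    rw [e1, Turing.Tape.write_move_left_mk₁, ← e2] at h
    exact h

theorem reaches_hardwire (w : List Bool) :
    StateTransition.Reaches (U.hardwire a).step ((U.hardwire a).init w)
      (Cfg.hardwire a (U.init (List.replicate a true ++ false :: w))) := by
  have h := reaches_preamble (U := U) w a le_rfl
  refine h.tail ?_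
  have e : (⟨a - a, by omega⟩ : Fin (a + 3)) = 0 := Fin.ext (by simp)
  rw [e, step_preamble_zero, Turing.Tape.move_left_right]
  rfl

/-- Once the preamble is over, configurations of `U` correspond step by step to configurations of
`U.hardwire a`, so the two machines evaluate alike. -/
theorem accepts_hardwire (w : List Bool) :
    (U.hardwire a).Accepts w ↔ U.Accepts (List.replicate a true ++ false :: w) := by
  have key := StateTransition.tr_eval' U.step (U.hardwire a).step (Cfg.hardwire a)
    (StateTransition.fun_respects.2 fun c => by
      cases h : U.step c with
      | none =>
        change (U.hardwire a).step _ = none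
        rw [step_hardwire, h]
        rfl
      | some c' => exact .single (by rw [step_hardwire, h]; rfl))
    (U.init (List.replicate a true ++ false :: w))
  rw [← StateTransition.reaches_eval (reaches_hardwire w)] at key
  constructor
  · rintro ⟨_, c, h1, h2, rfl⟩
    have hc : c ∈ StateTransition.eval (U.hardwire a).step ((U.hardwire a).init w) :=
      StateTransition.mem_eval.2 ⟨h1, step_of_status h2⟩
    rw [key] at hc
    obtain ⟨c', hc', rfl⟩ := (Part.mem_map_iff _).1 hc
    exact ⟨_, c', (StateTransition.mem_eval.1 hc').1, (status_hardwire c').symm.trans h2, rfl⟩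
  · rintro ⟨_, c, h1, h2, rfl⟩
    have hc : c.hardwire a ∈ StateTransition.eval (U.hardwire a).step ((U.hardwire a).init w) := by
      rw [key]
      exact (Part.mem_map_iff _).2 ⟨c, StateTransition.mem_eval.2 ⟨h1, step_of_status h2⟩, rfl⟩
    exact ⟨_, _, (StateTransition.mem_eval.1 hc).1, (status_hardwire c).trans h2, rfl⟩

end TM

/-! ### Refutations in propositional logic -/

section Refutation

variable {S : Type}

/-- The valuation `V` makes all literals in `l` true. -/
def Satisfies (V : S → Prop) (l : List (S × Bool)) : Prop := ∀ x ∈ l, V x.1 ↔ x.2 = true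

/-- The rules for refutations: a list is refuted if it contains a forbidden list or complementary
literals, or if both of its extensions by a literal and its complement are. -/
def RefutationRule (F : List (S × Bool) → Prop)
    (r : List (List (S × Bool)) × List (S × Bool)) : Prop :=
  (r.1 = [] ∧ ((∃ C, F C ∧ C ⊆ r.2) ∨ ∃ x, [(x, true), (x, false)] ⊆ r.2)) ∨
    ∃ x, r.1 = [(x, true) :: r.2, (x, false) :: r.2]

/-- The list of literals is refutable from the forbidden lists in `F`. -/
def Refutable (F : List (S × Bool) → Prop) : List (S × Bool) → Prop := Der (RefutationRule F)

theorem RE.refutable [Primcodable S] [DecidableEq S] {F : List (S × Bool) → Prop} (hF : RE F) :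
    RE (Refutable F) := by
  refine RE.der (((RE.of_dec ?_).and (RE.or ?_ ?_)).or ?_)
  · exact PR.decEq (by fun_prop) (by fun_prop)
  · refine RE.ex (P := fun (r : List (List (S × Bool)) × List (S × Bool)) C => F C ∧ C ⊆ r.2)
      ((hF.comp (by fun_prop)).and (RE.of_dec (by fun_prop)))
  · refine RE.ex (P := fun (r : List (List (S × Bool)) × List (S × Bool)) x =>
      [(x, true), (x, false)] ⊆ r.2) (RE.of_dec (by fun_prop))
  · refine RE.ex (P := fun (r : List (List (S × Bool)) × List (S × Bool)) x =>
      r.1 = [(x, true) :: r.2, (x, false) :: r.2]) (RE.of_dec (PR.decEq ?_ ?_))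
    · fun_prop
    · fun_prop

namespace Refutable

variable {F : List (S × Bool) → Prop} {l : List (S × Bool)}

theorem of_forbidden {C : List (S × Bool)} (hC : F C) (h : C ⊆ l) : Refutable F l :=
  .mk [] l (.inl ⟨rfl, .inl ⟨C, hC, h⟩⟩) (by simp)

theorem of_compl {x : S} (h : (x, true) ∈ l) (h' : (x, false) ∈ l) : Refutable F l :=
  .mk [] l (.inl ⟨rfl, .inr ⟨x, by simp [h, h']⟩⟩) (by simp)

theorem cut {x : S} (h : Refutable F ((x, true) :: l)) (h' : Refutable F ((x, false) :: l)) :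
    Refutable F l :=
  .mk [(x, true) :: l, (x, false) :: l] l (.inr ⟨x, rfl⟩) fun b hb => by
    rcases List.mem_pair.1 hb with rfl | rfl
    exacts [h, h']

/-- Soundness: at a case distinction, the valuation itself tells which of the two branches to
follow. -/
theorem not_satisfies (h : Refutable F l) {V : S → Prop} (hV : ∀ C, F C → ¬ Satisfies V C) :
    ¬ Satisfies V l := by
  induction h with
  | mk prems l hr _ ih =>
    rcases hr with ⟨-, ⟨C, hC, hl⟩ | ⟨x, hx⟩⟩ | ⟨x, hx⟩
    · exact fun h => hV C hC fun x hx => h x (hl hx)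
    · intro h
      have h1 := h (x, true) (hx (by simp))
      have h2 := h (x, false) (hx (by simp))
      simp_all
    · intro h
      dsimp only at hx
      by_cases hv : V x
      · refine ih ((x, true) :: l) (by simp [hx]) fun y hy => ?_
        rcases List.mem_cons.1 hy with rfl | hy
        · simpa using hv
        · exact h y hy
      · refine ih ((x, false) :: l) (by simp [hx]) fun y hy => ?_
        rcases List.mem_cons.1 hy with rfl | hy
        · simpa using hv
        · exact h y hy

/-- Lists that are not refutable have a model. -/
theorem exists_satisfies [Encodable S] (h : ¬ Refutable F l) :
    ∃ V : S → Prop, (∀ C, F C → ¬ Satisfies V C) ∧ Satisfies V l := by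
  classical
  -- Lindenbaum's construction: the literals are decided one after another in the order of their
  -- codes, positively whenever this is not refutable. By `cut`, the negative choice is then not
  -- refutable either.
  let ext (l : List (S × Bool)) (x : S) : List (S × Bool) :=
    if Refutable F ((x, true) :: l) then (x, false) :: l else (x, true) :: l
  let L : ℕ → List (S × Bool) := fun n => Nat.rec l
    (fun n l => (Encodable.decode n : Option S).elim l (ext l)) n
  have hext : ∀ l x, ¬ Refutable F l → ¬ Refutable F (ext l x) := by
    intro l x hl
    by_cases h : Refutable F ((x, true) :: l)
    · simp only [ext, if_pos h]
      exact fun h' => hl (cut h h')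
    · simpa only [ext, if_neg h] using h
  have hsub : ∀ l x, l ⊆ ext l x := by
    intro l x
    simp only [ext]
    split_ifs <;> exact List.subset_cons_self _ _
  have hL : ∀ n, ¬ Refutable F (L n) := by
    intro n
    induction n with
    | zero => exact h
    | succ n ih =>
      change ¬ Refutable F ((Encodable.decode n : Option S).elim (L n) (ext (L n)))
      cases (Encodable.decode n : Option S) with
      | none => exact ih
      | some x => exact hext _ x ih
  have hmono : ∀ m n, m ≤ n → L m ⊆ L n := by
    intro m n hmn
    induction n, hmn using Nat.le_induction with
    | base => exact List.Subset.refl _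
    | succ n _ ih =>
      refine List.Subset.trans ih ?_
      change L n ⊆ (Encodable.decode n : Option S).elim (L n) (ext (L n))
      cases (Encodable.decode n : Option S) with
      | none => exact List.Subset.refl _
      | some x => exact hsub _ x
  have hdec : ∀ x, ∃ b, (x, b) ∈ L (Encodable.encode x + 1) := by
    intro x
    change ∃ b, (x, b) ∈ (Encodable.decode (Encodable.encode x) : Option S).elim _ _
    rw [Encodable.encodek, Option.elim_some]
    simp only [ext]
    split_ifs
    · exact ⟨false, List.mem_cons_self⟩
    · exact ⟨true, List.mem_cons_self⟩
  have hcons : ∀ x m n, (x, true) ∈ L m → (x, false) ∉ L n := by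
    intro x m n hm hn
    exact hL (max m n) (of_compl (hmono _ _ (le_max_left _ _) hm) (hmono _ _ (le_max_right _ _) hn))
  let V : S → Prop := fun x => ∃ n, (x, true) ∈ L n
  have hV : ∀ x b, (V x ↔ b = true) → ∃ n, (x, b) ∈ L n := by
    intro x b hb
    cases b with
    | true => exact (hb.2 rfl : ∃ n, (x, true) ∈ L n)
    | false =>
      obtain ⟨b, hx⟩ := hdec x
      cases b with
      | true => exact absurd (hb.1 ⟨Encodable.encode x + 1, hx⟩) (by simp)
      | false => exact ⟨Encodable.encode x + 1, hx⟩
  refine ⟨V, fun C hC hsat => ?_, fun x hx => ?_⟩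
  -- A forbidden list is finite, hence contained in a single stage of the construction, which would
  -- thereby be refuted.
  · have : ∀ C : List (S × Bool), (∀ x ∈ C, ∃ n, x ∈ L n) → ∃ n, C ⊆ L n := by
      intro C
      induction C with
      | nil => exact fun _ => ⟨0, by simp⟩
      | cons x C ih =>
        intro hC
        obtain ⟨m, hm⟩ := hC x List.mem_cons_self
        obtain ⟨n, hn⟩ := ih fun y hy => hC y (List.mem_cons_of_mem _ hy)
        refine ⟨max m n, List.cons_subset.2 ⟨hmono _ _ (le_max_left _ _) hm, ?_⟩⟩
        exact List.Subset.trans hn (hmono _ _ (le_max_right _ _))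
    obtain ⟨n, hn⟩ := this C fun x hx => hV x.1 x.2 (hsat x hx)
    exact hL n (of_forbidden hC hn)
  · obtain ⟨x, b⟩ := x
    cases b with
    | true => exact ⟨fun _ => rfl, fun _ => ⟨0, hx⟩⟩
    | false => exact ⟨fun ⟨n, hn⟩ => absurd hx (hcons x n 0 hn), by simp⟩

end Refutable

end Refutation

/-! ### Codes of terms and formulas -/

/-- The code of a variable. -/
def codeVar (i : ℕ) : ℕ := Nat.pair 0 i
/-- The code of an application of a function symbol. -/
def codeFunc (l f : ℕ) (ts : List ℕ) : ℕ :=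
  Nat.pair 1 (Nat.pair l (Nat.pair f (Encodable.encode ts)))
/-- The code of `⊥`. -/
def codeBot : ℕ := Nat.pair 0 0
/-- The code of an equation. -/
def codeEq (t u : ℕ) : ℕ := Nat.pair 1 (Nat.pair t u)
/-- The code of an atom. -/
def codeRel (l r : ℕ) (ts : List ℕ) : ℕ :=
  Nat.pair 2 (Nat.pair l (Nat.pair r (Encodable.encode ts)))
/-- The code of an implication. -/
def codeImp (a b : ℕ) : ℕ := Nat.pair 3 (Nat.pair a b)
/-- The code of a universal quantification. -/
def codeAll (a : ℕ) : ℕ := Nat.pair 4 a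

section

variable {α : Type} [Primcodable α]

@[fun_prop] theorem PR.codeVar {f : α → ℕ} (hf : PR f) : PR (fun a => codeVar (f a)) := by
  unfold KRF.codeVar
  fun_prop
@[fun_prop] theorem PR.codeFunc {f g : α → ℕ} {h : α → List ℕ} (hf : PR f) (hg : PR g)
    (hh : PR h) : PR (fun a => codeFunc (f a) (g a) (h a)) := by
  unfold KRF.codeFunc
  exact PR.natPair (by fun_prop) (PR.natPair hf (PR.natPair hg (PR.encode hh)))
@[fun_prop] theorem PR.codeEq {f g : α → ℕ} (hf : PR f) (hg : PR g) :
    PR (fun a => codeEq (f a) (g a)) := by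
  unfold KRF.codeEq
  fun_prop
@[fun_prop] theorem PR.codeRel {f g : α → ℕ} {h : α → List ℕ} (hf : PR f) (hg : PR g)
    (hh : PR h) : PR (fun a => codeRel (f a) (g a) (h a)) := by
  unfold KRF.codeRel
  exact PR.natPair (by fun_prop) (PR.natPair hf (PR.natPair hg (PR.encode hh)))
@[fun_prop] theorem PR.codeImp {f g : α → ℕ} (hf : PR f) (hg : PR g) :
    PR (fun a => codeImp (f a) (g a)) := by
  unfold KRF.codeImp
  fun_prop
@[fun_prop] theorem PR.codeAll {f : α → ℕ} (hf : PR f) : PR (fun a => codeAll (f a)) := by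
  unfold KRF.codeAll
  fun_prop

end

theorem codeTerm_func {n l : ℕ} (f : vocab.Functions l) (ts : Fin l → vocab.Term (Empty ⊕ Fin n)) :
    codeTerm (.func f ts) = codeFunc l f (List.ofFn fun i => codeTerm (ts i)) := by
  rw [codeTerm]; rfl

/-! ### Statements -/

/-- A formula with values of its free variables. -/
abbrev Stmt := ℕ × List ℕ

/-- The name for the value of a term. -/
def valueName (t : ℕ) (e : List ℕ) : ℕ := Nat.pair 0 (Nat.pair t (Encodable.encode e))

/-- The name for a counterexample to a universally quantified formula. -/
def witnessName (a : ℕ) (e : List ℕ) : ℕ := Nat.pair 1 (Nat.pair a (Encodable.encode e))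

/-- The statement that two names name the same thing. -/
def eqStmt (x y : ℕ) : Stmt := (codeEq (codeVar 0) (codeVar 1), [x, y])

section

variable {α : Type} [Primcodable α]

@[fun_prop] theorem PR.valueName {f : α → ℕ} {g : α → List ℕ} (hf : PR f) (hg : PR g) :
    PR (fun a => valueName (f a) (g a)) := by
  unfold KRF.valueName
  exact PR.natPair (by fun_prop) (PR.natPair hf (PR.encode hg))
@[fun_prop] theorem PR.witnessName {f : α → ℕ} {g : α → List ℕ} (hf : PR f) (hg : PR g) :
    PR (fun a => witnessName (f a) (g a)) := by
  unfold KRF.witnessName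
  exact PR.natPair (by fun_prop) (PR.natPair hf (PR.encode hg))
@[fun_prop] theorem PR.eqStmt {f g : α → ℕ} (hf : PR f) (hg : PR g) :
    PR (fun a => eqStmt (f a) (g a)) := by
  unfold KRF.eqStmt
  fun_prop

end

/-- The forbidden lists of statements: those that contradict the truth conditions for formulas. -/
inductive Forbidden : List (Stmt × Bool) → Prop
  | bot (e : List ℕ) : Forbidden [((codeBot, e), true)]
  | imp_true (a b : ℕ) (e : List ℕ) :
      Forbidden [((codeImp a b, e), true), ((a, e), true), ((b, e), false)]
  | imp_left (a b : ℕ) (e : List ℕ) : Forbidden [((codeImp a b, e), false), ((a, e), false)]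
  | imp_right (a b : ℕ) (e : List ℕ) : Forbidden [((codeImp a b, e), false), ((b, e), true)]
  | all_true (a : ℕ) (e : List ℕ) (k : ℕ) :
      Forbidden [((codeAll a, e), true), ((a, e ++ [k]), false)]
  | all_false (a : ℕ) (e : List ℕ) :
      Forbidden [((codeAll a, e), false), ((a, e ++ [witnessName a e]), true)]
  | equal (t u : ℕ) (e : List ℕ) (b : Bool) :
      Forbidden [((codeEq t u, e), b), (eqStmt (valueName t e) (valueName u e), !b)]
  | refl (x : ℕ) : Forbidden [(eqStmt x x, false)]
  | euclid (x y z : ℕ) : Forbidden [(eqStmt x y, true), (eqStmt x z, true), (eqStmt y z, false)]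
  | var (e : List ℕ) (x : ℕ) (e' : List ℕ) :
      Forbidden [(eqStmt (valueName (codeVar e.length) (e ++ x :: e')) x, false)]
  | func (l f : ℕ) (z : List (ℕ × ℕ)) (e e' : List ℕ) :
      Forbidden ((eqStmt (valueName (codeFunc l f (z.map fun p => p.1)) e)
        (valueName (codeFunc l f (z.map fun p => p.2)) e'), false) ::
          z.map fun p => (eqStmt (valueName p.1 e) (valueName p.2 e'), true))
  | rel (l r : ℕ) (z : List (ℕ × ℕ)) (e e' : List ℕ) :
      Forbidden (((codeRel l r (z.map fun p => p.1), e), true) ::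
        ((codeRel l r (z.map fun p => p.2), e'), false) ::
          z.map fun p => (eqStmt (valueName p.1 e) (valueName p.2 e'), true))

/-- Each clause is the range of a primitive recursive function of its parameters. -/
theorem re_forbidden : RE Forbidden := by
  have h1 : RE (fun C => ∃ p : List ℕ, [((codeBot, p), true)] = C) :=
    RE.range (F := fun p : List ℕ => [((codeBot, p), true)]) (by fun_prop)
  have h2 := RE.range (F := fun p : ℕ × ℕ × List ℕ =>
    [((codeImp p.1 p.2.1, p.2.2), true), ((p.1, p.2.2), true), ((p.2.1, p.2.2), false)])
    (by fun_prop)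
  have h3 := RE.range (F := fun p : ℕ × ℕ × List ℕ =>
    [((codeImp p.1 p.2.1, p.2.2), false), ((p.1, p.2.2), false)]) (by fun_prop)
  have h4 := RE.range (F := fun p : ℕ × ℕ × List ℕ =>
    [((codeImp p.1 p.2.1, p.2.2), false), ((p.2.1, p.2.2), true)]) (by fun_prop)
  have h5 := RE.range (F := fun p : ℕ × List ℕ × ℕ =>
    [((codeAll p.1, p.2.1), true), ((p.1, p.2.1 ++ [p.2.2]), false)]) (by fun_prop)
  have h6 := RE.range (F := fun p : ℕ × List ℕ =>
    [((codeAll p.1, p.2), false), ((p.1, p.2 ++ [witnessName p.1 p.2]), true)]) (by fun_prop)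
  have h7 := RE.range (F := fun p : ℕ × ℕ × List ℕ × Bool =>
    [((codeEq p.1 p.2.1, p.2.2.1), p.2.2.2),
      (eqStmt (valueName p.1 p.2.2.1) (valueName p.2.1 p.2.2.1), !p.2.2.2)]) (by fun_prop)
  have h8 := RE.range (F := fun p : ℕ => [(eqStmt p p, false)]) (by fun_prop)
  have h9 := RE.range (F := fun p : ℕ × ℕ × ℕ =>
    [(eqStmt p.1 p.2.1, true), (eqStmt p.1 p.2.2, true), (eqStmt p.2.1 p.2.2, false)])
    (by fun_prop)
  have h10 := RE.range (F := fun p : List ℕ × ℕ × List ℕ =>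
    [(eqStmt (valueName (codeVar p.1.length) (p.1 ++ p.2.1 :: p.2.2)) p.2.1, false)])
    (by fun_prop)
  have h11 := RE.range (F := fun p : ℕ × ℕ × List (ℕ × ℕ) × List ℕ × List ℕ =>
    (eqStmt (valueName (codeFunc p.1 p.2.1 (p.2.2.1.map fun q => q.1)) p.2.2.2.1)
      (valueName (codeFunc p.1 p.2.1 (p.2.2.1.map fun q => q.2)) p.2.2.2.2), false) ::
        p.2.2.1.map fun q =>
          (eqStmt (valueName q.1 p.2.2.2.1) (valueName q.2 p.2.2.2.2), true)) (by fun_prop)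
  have h12 := RE.range (F := fun p : ℕ × ℕ × List (ℕ × ℕ) × List ℕ × List ℕ =>
    ((codeRel p.1 p.2.1 (p.2.2.1.map fun q => q.1), p.2.2.2.1), true) ::
      ((codeRel p.1 p.2.1 (p.2.2.1.map fun q => q.2), p.2.2.2.2), false) ::
        p.2.2.1.map fun q =>
          (eqStmt (valueName q.1 p.2.2.2.1) (valueName q.2 p.2.2.2.2), true)) (by fun_prop)
  refine (h1.or (h2.or (h3.or (h4.or (h5.or (h6.or (h7.or (h8.or (h9.or (h10.or
    (h11.or h12))))))))))).of_eq fun C => ?_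
  constructor
  · intro h
    cases h with
    | bot e => exact .inl ⟨_, rfl⟩
    | imp_true a b e => exact .inr (.inl ⟨(a, b, e), rfl⟩)
    | imp_left a b e => exact .inr (.inr (.inl ⟨(a, b, e), rfl⟩))
    | imp_right a b e => exact .inr (.inr (.inr (.inl ⟨(a, b, e), rfl⟩)))
    | all_true a e k => exact .inr (.inr (.inr (.inr (.inl ⟨(a, e, k), rfl⟩))))
    | all_false a e => exact .inr (.inr (.inr (.inr (.inr (.inl ⟨(a, e), rfl⟩)))))
    | equal t u e b => exact .inr (.inr (.inr (.inr (.inr (.inr (.inl ⟨(t, u, e, b), rfl⟩))))))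
    | refl x => exact .inr (.inr (.inr (.inr (.inr (.inr (.inr (.inl ⟨x, rfl⟩)))))))
    | euclid x y z =>
      exact .inr (.inr (.inr (.inr (.inr (.inr (.inr (.inr (.inl ⟨(x, y, z), rfl⟩))))))))
    | var e x e' =>
      exact .inr (.inr (.inr (.inr (.inr (.inr (.inr (.inr (.inr (.inl ⟨(e, x, e'), rfl⟩)))))))))
    | func l f z e e' =>
      exact .inr (.inr (.inr (.inr (.inr (.inr (.inr (.inr (.inr (.inr
        (.inl ⟨(l, f, z, e, e'), rfl⟩))))))))))
    | rel l r z e e' =>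
      exact .inr (.inr (.inr (.inr (.inr (.inr (.inr (.inr (.inr (.inr
        (.inr ⟨(l, r, z, e, e'), rfl⟩))))))))))
  · rintro (⟨p, rfl⟩ | ⟨p, rfl⟩ | ⟨p, rfl⟩ | ⟨p, rfl⟩ | ⟨p, rfl⟩ | ⟨p, rfl⟩ | ⟨p, rfl⟩ |
      ⟨p, rfl⟩ | ⟨p, rfl⟩ | ⟨p, rfl⟩ | ⟨p, rfl⟩ | ⟨p, rfl⟩)
    exacts [.bot _, .imp_true _ _ _, .imp_left _ _ _, .imp_right _ _ _, .all_true _ _ _,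
      .all_false _ _, .equal _ _ _ _, .refl _, .euclid _ _ _, .var _ _ _, .func _ _ _ _ _,
      .rel _ _ _ _ _]

/-! ### Soundness -/

/-- Justifies recursion on codes: the members of a coded list are smaller than its code. -/
theorem lt_encode_of_mem {a : ℕ} {l : List ℕ} (h : a ∈ l) : a < Encodable.encode l := by
  induction l with
  | nil => simp at h
  | cons b l ih =>
    rw [Encodable.encode_list_cons]
    rcases List.mem_cons.1 h with rfl | h
    · exact Nat.lt_succ_of_le (Nat.left_le_pair _ _)
    · exact (ih h).trans (Nat.lt_succ_of_le (Nat.right_le_pair _ _))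

theorem lt_of_mem_ofNat {a n : ℕ} (h : a ∈ Denumerable.ofNat (List ℕ) n) : a < n := by
  have := lt_encode_of_mem h
  rwa [Denumerable.encode_ofNat] at this

section Semantics

variable {𝔐 : Type} [vocab.Structure 𝔐] [Nonempty 𝔐]

open Classical in
/-- The value of a function, for lists of arguments. -/
noncomputable def applyFunc (l f : ℕ) (vs : List 𝔐) : 𝔐 :=
  if h : ∃ v : Fin l → 𝔐, List.ofFn v = vs then
    Language.Structure.funMap (L := vocab) (n := l) f h.choose
  else Classical.arbitrary 𝔐

/-- The value of a term given by its code. -/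
noncomputable def valueOf (t : ℕ) (e : List 𝔐) : 𝔐 :=
  if t.unpair.1 = 0 then (e[t.unpair.2]?).getD (Classical.arbitrary 𝔐)
  else applyFunc t.unpair.2.unpair.1 t.unpair.2.unpair.2.unpair.1
    ((Denumerable.ofNat (List ℕ) t.unpair.2.unpair.2.unpair.2).attach.map fun s => valueOf s.1 e)
termination_by t
decreasing_by
  exact (lt_of_mem_ofNat s.2).trans_le ((Nat.unpair_right_le _).trans
    ((Nat.unpair_right_le _).trans (Nat.unpair_right_le _)))

/-- The truth of an atom, for lists of arguments. -/
def HoldsRel (l r : ℕ) (vs : List 𝔐) : Prop :=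
  ∃ (R : vocab.Relations l) (v : Fin l → 𝔐), codePred R = r ∧ List.ofFn v = vs ∧
    Language.Structure.RelMap R v

/-- The truth of a formula given by its code. -/
def Holds (c : ℕ) (e : List 𝔐) : Prop :=
  if c.unpair.1 = 1 then valueOf c.unpair.2.unpair.1 e = valueOf c.unpair.2.unpair.2 e
  else if c.unpair.1 = 2 then
    HoldsRel c.unpair.2.unpair.1 c.unpair.2.unpair.2.unpair.1
      ((Denumerable.ofNat (List ℕ) c.unpair.2.unpair.2.unpair.2).map fun t => valueOf t e)
  else if _h : c.unpair.1 = 3 then Holds c.unpair.2.unpair.1 e → Holds c.unpair.2.unpair.2 e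
  else if _h : c.unpair.1 = 4 then ∀ m, Holds c.unpair.2 (e ++ [m])
  else False
termination_by c
decreasing_by
  all_goals
    have h1 := Nat.add_le_pair c.unpair.1 c.unpair.2
    have h2 := Nat.unpair_left_le c.unpair.2
    have h3 := Nat.unpair_right_le c.unpair.2
    rw [Nat.pair_unpair] at h1
    omega

/-- What a name names. -/
noncomputable def denotation (k : ℕ) : 𝔐 :=
  if k.unpair.1 = 0 then valueOf k.unpair.2.unpair.1
    ((Denumerable.ofNat (List ℕ) k.unpair.2.unpair.2).attach.map fun s => denotation s.1)
  else Classical.epsilon fun m => ¬ Holds k.unpair.2.unpair.1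
    (((Denumerable.ofNat (List ℕ) k.unpair.2.unpair.2).attach.map fun s => denotation s.1) ++ [m])
termination_by k
decreasing_by
  all_goals
    exact (lt_of_mem_ofNat s.2).trans_le ((Nat.unpair_right_le _).trans (Nat.unpair_right_le _))

theorem valueOf_codeVar (i : ℕ) (e : List 𝔐) :
    valueOf (codeVar i) e = (e[i]?).getD (Classical.arbitrary 𝔐) := by
  rw [valueOf]; simp [codeVar]

theorem valueOf_codeFunc (l f : ℕ) (ts : List ℕ) (e : List 𝔐) :
    valueOf (codeFunc l f ts) e = applyFunc l f (ts.map fun t => valueOf t e) := by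
  rw [valueOf]; simp [codeFunc]

theorem holds_codeBot (e : List 𝔐) : ¬ Holds codeBot e := by
  rw [Holds]; simp [codeBot]

theorem holds_codeEq (t u : ℕ) (e : List 𝔐) :
    Holds (codeEq t u) e ↔ valueOf t e = valueOf u e := by
  rw [Holds]; simp [codeEq]

theorem holds_codeImp (a b : ℕ) (e : List 𝔐) :
    Holds (codeImp a b) e ↔ (Holds a e → Holds b e) := by
  rw [Holds]; simp [codeImp]

theorem holds_codeAll (a : ℕ) (e : List 𝔐) :
    Holds (codeAll a) e ↔ ∀ m, Holds a (e ++ [m]) := by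
  rw [Holds]; simp [codeAll]

theorem holds_codeRel (l r : ℕ) (ts : List ℕ) (e : List 𝔐) :
    Holds (codeRel l r ts) e ↔ HoldsRel l r (ts.map fun t => valueOf t e) := by
  rw [Holds]; simp [codeRel]

theorem denotation_valueName (t : ℕ) (e : List ℕ) :
    (denotation (valueName t e) : 𝔐) = valueOf t (e.map denotation) := by
  rw [denotation]; simp [valueName]

/-- A witness name denotes a counterexample, chosen by `Classical.epsilon`, whenever there is one.
So a formula that is true at its witness is true everywhere. -/
theorem holds_witnessName (a : ℕ) (e : List ℕ)
    (h : Holds a ((e ++ [witnessName a e]).map denotation : List 𝔐)) (m : 𝔐) :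
    Holds a (e.map denotation ++ [m]) := by
  by_contra hm
  rw [List.map_append, List.map_singleton, denotation] at h
  simp only [witnessName, Nat.unpair_pair, Denumerable.ofNat_encode, one_ne_zero, if_false,
    List.attach_map_val] at h
  exact Classical.epsilon_spec (p := fun m => ¬ Holds a (e.map denotation ++ [m])) ⟨m, hm⟩ h

theorem holds_eqStmt (x y : ℕ) :
    Holds (eqStmt x y).1 ((eqStmt x y).2.map denotation : List 𝔐) ↔
      (denotation x : 𝔐) = denotation y := by
  simp [eqStmt, holds_codeEq, valueOf_codeVar]

/-- Every structure yields a valuation without forbidden lists. For this, `valueOf`, `Holds` and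
`denotation` are defined on all numbers, because the forbidden lists also speak of numbers that are
no codes of terms or formulas. -/
theorem Forbidden.not_satisfies {C : List (Stmt × Bool)} (hC : Forbidden C) :
    ¬ Satisfies (fun s : Stmt => Holds s.1 (s.2.map denotation : List 𝔐)) C := by
  have congr : ∀ (z : List (ℕ × ℕ)) (e e' : List ℕ),
      (∀ x ∈ z.map fun p => (eqStmt (valueName p.1 e) (valueName p.2 e'), true),
        (Holds x.1.1 (x.1.2.map denotation : List 𝔐) ↔ x.2 = true)) →
      (z.map fun p => p.1).map (fun t => (valueOf t (e.map denotation) : 𝔐)) =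
        (z.map fun p => p.2).map fun t => valueOf t (e'.map denotation) := by
    intro z e e' h
    rw [List.map_map, List.map_map]
    refine List.map_congr_left fun p hp => ?_
    have := (h _ (List.mem_map_of_mem hp)).2 rfl
    rwa [holds_eqStmt, denotation_valueName, denotation_valueName] at this
  intro h
  cases hC with
  | bot e => simp [Satisfies, holds_codeBot] at h
  | imp_true a b e =>
    simp only [Satisfies, List.mem_cons, List.not_mem_nil, or_false, forall_eq_or_imp,
      forall_eq, holds_codeImp] at h
    simp only [iff_true, Bool.false_eq_true, iff_false] at h
    tauto
  | imp_left a b e =>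
    simp only [Satisfies, List.mem_cons, List.not_mem_nil, or_false, forall_eq_or_imp,
      forall_eq, holds_codeImp] at h
    simp only [Bool.false_eq_true, iff_false] at h
    tauto
  | imp_right a b e =>
    simp only [Satisfies, List.mem_cons, List.not_mem_nil, or_false, forall_eq_or_imp,
      forall_eq, holds_codeImp] at h
    simp only [iff_true, Bool.false_eq_true, iff_false] at h
    tauto
  | all_true a e k =>
    simp only [Satisfies, List.mem_cons, List.not_mem_nil, or_false, forall_eq_or_imp,
      forall_eq, holds_codeAll, iff_true, Bool.false_eq_true, iff_false, List.map_append,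
      List.map_singleton] at h
    exact h.2 (h.1 _)
  | all_false a e =>
    simp only [Satisfies, List.mem_cons, List.not_mem_nil, or_false, forall_eq_or_imp,
      forall_eq, holds_codeAll, iff_true, Bool.false_eq_true, iff_false] at h
    exact h.1 (holds_witnessName a e h.2)
  | equal t u e b =>
    simp only [Satisfies, List.mem_cons, List.not_mem_nil, or_false, forall_eq_or_imp,
      forall_eq, holds_codeEq, holds_eqStmt, denotation_valueName] at h
    rw [h.1] at h
    cases b <;> simp at h
  | refl x => simp [Satisfies, holds_eqStmt] at h
  | euclid x y z =>
    simp only [Satisfies, List.mem_cons, List.not_mem_nil, or_false, forall_eq_or_imp,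
      forall_eq, holds_eqStmt, iff_true, Bool.false_eq_true, iff_false] at h
    exact h.2.2 (h.1.symm.trans h.2.1)
  | var e x e' =>
    simp [Satisfies, holds_eqStmt, denotation_valueName, valueOf_codeVar] at h
  | func l f z e e' =>
    have h1 := congr z e e' fun x hx => h x (List.mem_cons_of_mem _ hx)
    have h2 := h _ List.mem_cons_self
    simp only [holds_eqStmt, denotation_valueName, valueOf_codeFunc] at h2
    rw [h1] at h2
    simp at h2
  | rel l r z e e' =>
    have h1 := congr z e e' fun x hx =>
      h x (List.mem_cons_of_mem _ (List.mem_cons_of_mem _ hx))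
    have h2 := h _ List.mem_cons_self
    have h3 := h _ (List.mem_cons_of_mem _ List.mem_cons_self)
    simp only [holds_codeRel] at h2 h3
    rw [h1] at h2
    rw [h2] at h3
    simp at h3

theorem valueOf_codeTerm {n : ℕ} (t : vocab.Term (Empty ⊕ Fin n)) (v : Fin n → 𝔐) :
    valueOf (codeTerm t) (List.ofFn v) = t.realize (Sum.elim default v) := by
  induction t with
  | var x =>
    rcases x with x | i
    · exact x.elim
    · have : codeTerm (Language.Term.var (L := vocab) (.inr i : Empty ⊕ Fin n)) = codeVar i := by
        rw [codeTerm]; rfl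
      rw [this, valueOf_codeVar]
      simp
  | func f ts ih =>
    rename_i l
    rw [codeTerm_func, valueOf_codeFunc]
    have e : (List.ofFn fun i => codeTerm (ts i)).map (fun t => valueOf t (List.ofFn v)) =
        List.ofFn fun i => (ts i).realize (Sum.elim default v) := by
      rw [List.map_ofFn]
      exact congrArg List.ofFn (funext ih)
    rw [e, applyFunc, dif_pos ⟨_, rfl⟩]
    have h : ∃ w : Fin l → 𝔐, List.ofFn w =
      List.ofFn fun i => (ts i).realize (Sum.elim default v) := ⟨_, rfl⟩
    -- The tuple chosen in `applyFunc` is the intended one, as `List.ofFn` is injective.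
    exact congrArg _ (List.ofFn_injective h.choose_spec)

theorem ofFn_snoc {α : Type} {n : ℕ} (v : Fin n → α) (x : α) :
    List.ofFn (Fin.snoc v x : Fin (n + 1) → α) = List.ofFn v ++ [x] := by
  rw [List.ofFn_succ']
  simp [List.concat_eq_append]

theorem holds_codeFormula {n : ℕ} (φ : vocab.BoundedFormula Empty n) (v : Fin n → 𝔐) :
    Holds (codeFormula φ) (List.ofFn v) ↔ φ.Realize default v := by
  induction φ with
  | falsum => exact iff_of_false (holds_codeBot _) id
  | equal t u =>
    refine (holds_codeEq _ _ _).trans ?_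
    rw [valueOf_codeTerm, valueOf_codeTerm]
    rfl
  | rel R ts =>
    refine (holds_codeRel _ _ _ _).trans ?_
    rw [List.map_ofFn]
    have e : (fun t => valueOf t (List.ofFn v)) ∘ (fun i => codeTerm (ts i)) =
        fun i => (ts i).realize (Sum.elim default v) := funext fun i => valueOf_codeTerm _ _
    rw [e]
    constructor
    · rintro ⟨S, w, h1, h2, h3⟩
      obtain rfl := codePred_injective h1
      obtain rfl := List.ofFn_injective h2
      exact h3
    · exact fun h => ⟨R, _, rfl, rfl, h⟩
  | imp φ ψ ih₁ ih₂ =>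
    refine (holds_codeImp _ _ _).trans ?_
    rw [ih₁, ih₂]
    rfl
  | all φ ih =>
    refine (holds_codeAll _ _).trans (forall_congr' fun m => ?_)
    rw [← ofFn_snoc, ih]

end Semantics

/-! ### Completeness -/

section Completeness

variable {V : Stmt → Prop} (hV : ∀ C, Forbidden C → ¬ Satisfies V C)

include hV

theorem eqStmt_refl (x : ℕ) : V (eqStmt x x) := by
  simpa [Satisfies] using hV _ (.refl x)

theorem eqStmt_euclid {x y z : ℕ} (h : V (eqStmt x y)) (h' : V (eqStmt x z)) : V (eqStmt y z) := by
  by_contra hn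
  exact hV _ (.euclid x y z) (by simp [Satisfies, h, h', hn])

theorem eqStmt_symm {x y : ℕ} (h : V (eqStmt x y)) : V (eqStmt y x) :=
  eqStmt_euclid hV h (eqStmt_refl hV x)

theorem eqStmt_var {n : ℕ} (v : Fin n → ℕ) (i : Fin n) :
    V (eqStmt (valueName (codeVar i) (List.ofFn v)) (v i)) := by
  have h : List.ofFn v = (List.ofFn v).take i ++ v i :: (List.ofFn v).drop (i + 1) := by
    have := List.take_append_drop i.val (List.ofFn v)
    rw [List.drop_eq_getElem_cons (by simp)] at this
    simpa using this.symm
  have hi : ((List.ofFn v).take i).length = i := by simp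
  have := hV _ (.var ((List.ofFn v).take i) (v i) ((List.ofFn v).drop (i + 1)))
  rw [← h, hi] at this
  simpa [Satisfies] using this

theorem eqStmt_func {l : ℕ} (f : ℕ) (ts us : Fin l → ℕ) (e e' : List ℕ)
    (h : ∀ i, V (eqStmt (valueName (ts i) e) (valueName (us i) e'))) :
    V (eqStmt (valueName (codeFunc l f (List.ofFn ts)) e)
      (valueName (codeFunc l f (List.ofFn us)) e')) := by
  by_contra hn
  have := hV _ (.func l f (List.ofFn fun i => (ts i, us i)) e e')
  refine this fun x hx => ?_
  rcases List.mem_cons.1 hx with rfl | hx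
  · rw [List.map_ofFn, List.map_ofFn]
    simpa [Function.comp_def] using hn
  · obtain ⟨p, hp, rfl⟩ := List.mem_map.1 hx
    obtain ⟨i, rfl⟩ := List.mem_ofFn.1 hp
    simpa using h i

theorem holds_rel_congr {l : ℕ} (r : ℕ) (ts us : Fin l → ℕ) (e e' : List ℕ)
    (h : ∀ i, V (eqStmt (valueName (ts i) e) (valueName (us i) e')))
    (ht : V (codeRel l r (List.ofFn ts), e)) : V (codeRel l r (List.ofFn us), e') := by
  by_contra hn
  have := hV _ (.rel l r (List.ofFn fun i => (ts i, us i)) e e')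
  refine this fun x hx => ?_
  rcases List.mem_cons.1 hx with rfl | hx
  · rw [List.map_ofFn]
    simpa [Function.comp_def] using ht
  rcases List.mem_cons.1 hx with rfl | hx
  · rw [List.map_ofFn]
    simpa [Function.comp_def] using hn
  · obtain ⟨p, hp, rfl⟩ := List.mem_map.1 hx
    obtain ⟨i, rfl⟩ := List.mem_ofFn.1 hp
    simpa using h i

/-- The names, up to equality. -/
def nameSetoid : Setoid ℕ where
  r x y := V (eqStmt x y)
  iseqv := ⟨eqStmt_refl hV, eqStmt_symm hV,
    fun h h' => eqStmt_euclid hV (eqStmt_symm hV h) h'⟩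

/-- The universe of the structure described by a valuation. -/
abbrev Named : Type := Quotient (nameSetoid hV)

/-- The structure described by a valuation. -/
noncomputable instance namedStructure : vocab.Structure (Named hV) where
  funMap {l} f xs := Quotient.mk (nameSetoid hV)
    (valueName (codeFunc l f (List.ofFn fun i : Fin l => codeVar i))
      (List.ofFn fun i => (xs i).out))
  RelMap {l} R xs := V (codeRel l (codePred R) (List.ofFn fun i : Fin l => codeVar i),
    List.ofFn fun i => (xs i).out)

theorem eqStmt_out (x : ℕ) : V (eqStmt (Quotient.mk (nameSetoid hV) x).out x) :=
  Quotient.exact (s := nameSetoid hV) (Quotient.out_eq _)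

/-- Function symbols were interpreted through their values at chosen representatives; the congruence
clause `Forbidden.func` replaces these by the names of the actual arguments. -/
theorem realize_named {n : ℕ} (t : vocab.Term (Empty ⊕ Fin n)) (v : Fin n → ℕ) :
    t.realize (Sum.elim default fun i => Quotient.mk (nameSetoid hV) (v i)) =
      Quotient.mk (nameSetoid hV) (valueName (codeTerm t) (List.ofFn v)) := by
  induction t with
  | var x =>
    rcases x with x | i
    · exact x.elim
    · have : codeTerm (Language.Term.var (L := vocab) (.inr i : Empty ⊕ Fin n)) = codeVar i := by
        rw [codeTerm]; rfl
      rw [this]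
      exact Quotient.sound (s := nameSetoid hV) (eqStmt_symm hV (eqStmt_var hV v i))
  | func f ts ih =>
    rw [codeTerm_func, Language.Term.realize_func, funext ih]
    refine Quotient.sound (s := nameSetoid hV) (eqStmt_func hV _ _ _ _ _ fun i => ?_)
    exact eqStmt_euclid hV (eqStmt_symm hV (eqStmt_var hV _ i)) (eqStmt_out hV _)

/-- The truth lemma for the structure of names. In the quantifier case, every element is the class
of a name, and a universal statement that `V` makes false fails at its witness name. -/
theorem realize_formula_named {n : ℕ} (φ : vocab.BoundedFormula Empty n) (v : Fin n → ℕ) :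
    φ.Realize default (fun i => Quotient.mk (nameSetoid hV) (v i)) ↔
      V (codeFormula φ, List.ofFn v) := by
  induction φ with
  | falsum =>
    refine iff_of_false id fun h => hV _ (.bot (List.ofFn v)) ?_
    have h : V (codeBot, List.ofFn v) := h
    simpa [Satisfies] using h
  | equal t u =>
    have e : V (codeEq (codeTerm t) (codeTerm u), List.ofFn v) ↔
        V (eqStmt (valueName (codeTerm t) (List.ofFn v)) (valueName (codeTerm u) (List.ofFn v))) := by
      have h0 := hV _ (.equal (codeTerm t) (codeTerm u) (List.ofFn v) false)
      have h1 := hV _ (.equal (codeTerm t) (codeTerm u) (List.ofFn v) true)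
      simp only [Satisfies, List.mem_cons, List.not_mem_nil, or_false, forall_eq_or_imp,
        forall_eq, iff_true, Bool.false_eq_true, iff_false, Bool.not_false, Bool.not_true] at h0 h1
      tauto
    refine Iff.trans ?_ e.symm
    change t.realize _ = u.realize _ ↔ _
    rw [realize_named, realize_named]
    exact ⟨fun h => Quotient.exact (s := nameSetoid hV) h,
      fun h => Quotient.sound (s := nameSetoid hV) h⟩
  | rel R ts =>
    change Language.Structure.RelMap R (fun i => (ts i).realize _) ↔ _
    simp only [realize_named]
    constructor
    · refine fun h => holds_rel_congr hV _ _ _ _ _ (fun i => ?_) h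
      exact eqStmt_euclid hV (eqStmt_symm hV (eqStmt_var hV _ i)) (eqStmt_out hV _)
    · refine fun h => holds_rel_congr hV _ _ _ _ _ (fun i => ?_) h
      exact eqStmt_symm hV
        (eqStmt_euclid hV (eqStmt_symm hV (eqStmt_var hV _ i)) (eqStmt_out hV _))
  | imp φ ψ ih₁ ih₂ =>
    have e : V (codeImp (codeFormula φ) (codeFormula ψ), List.ofFn v) ↔
        (V (codeFormula φ, List.ofFn v) → V (codeFormula ψ, List.ofFn v)) := by
      have h0 := hV _ (.imp_true (codeFormula φ) (codeFormula ψ) (List.ofFn v))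
      have h1 := hV _ (.imp_left (codeFormula φ) (codeFormula ψ) (List.ofFn v))
      have h2 := hV _ (.imp_right (codeFormula φ) (codeFormula ψ) (List.ofFn v))
      simp only [Satisfies, List.mem_cons, List.not_mem_nil, or_false, forall_eq_or_imp,
        forall_eq, iff_true, Bool.false_eq_true, iff_false] at h0 h1 h2
      tauto
    refine Iff.trans ?_ e.symm
    rw [Language.BoundedFormula.realize_imp, ih₁, ih₂]
  | all φ ih =>
    have e : V (codeAll (codeFormula φ), List.ofFn v) ↔
        ∀ k, V (codeFormula φ, List.ofFn v ++ [k]) := by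
      constructor
      · intro h k
        by_contra hn
        exact hV _ (.all_true (codeFormula φ) (List.ofFn v) k) (by simp [Satisfies, h, hn])
      · intro h
        by_contra hn
        exact hV _ (.all_false (codeFormula φ) (List.ofFn v)) (by simp [Satisfies, h, hn])
    refine Iff.trans ?_ e.symm
    rw [Language.BoundedFormula.realize_all]
    have hs : ∀ k, (Fin.snoc (fun i => Quotient.mk (nameSetoid hV) (v i))
        (Quotient.mk (nameSetoid hV) k) : Fin _ → Named hV) =
          fun i => Quotient.mk (nameSetoid hV) ((Fin.snoc v k : Fin _ → ℕ) i) := by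
      intro k
      exact (Fin.comp_snoc (Quotient.mk (nameSetoid hV)) v k).symm
    constructor
    · intro h k
      rw [← ofFn_snoc, ← ih, ← hs]
      exact h _
    · intro h x
      obtain ⟨k, rfl⟩ := Quotient.exists_rep x
      rw [hs, ih, ofFn_snoc]
      exact h k

end Completeness

theorem holds_sentence {𝔐 : Type} [vocab.Structure 𝔐] [Nonempty 𝔐] (φ : Sentence) :
    Holds (codeFormula φ) ([] : List 𝔐) ↔ 𝔐 ⊨ φ :=
  (holds_codeFormula φ default)

theorem realize_sentence_named {V : Stmt → Prop} (hV : ∀ C, Forbidden C → ¬ Satisfies V C)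
    (φ : Sentence) : Named hV ⊨ φ ↔ V (codeFormula φ, []) := by
  rw [← List.ofFn_zero (f := Fin.elim0), ← realize_formula_named hV]
  exact iff_of_eq (congrArg₂ (Language.BoundedFormula.Realize (M := Named hV) φ)
    (Subsingleton.elim _ _) (Subsingleton.elim _ _))

/-- The completeness theorem in the form needed for the search: it makes entailment recursively
enumerable. A list that is not refutable gives a countermodel of names, and a refutation is sound in
every model. -/
theorem entails_iff {φ ψ : Sentence} : Entails φ ψ ↔
    Refutable Forbidden [((codeFormula φ, []), true), ((codeFormula ψ, []), false)] := by
  rw [Entails, Language.Theory.models_sentence_iff]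
  constructor
  · intro h
    by_contra hn
    obtain ⟨V, hV, hs⟩ := Refutable.exists_satisfies hn
    have h1 : Named hV ⊨ φ := (realize_sentence_named hV φ).2 ((hs ((codeFormula φ, []), true) (by simp)).2 rfl)
    have h2 : ¬ Named hV ⊨ ψ := fun h => by
      have := (hs ((codeFormula ψ, []), false) (by simp)).1 ((realize_sentence_named hV ψ).1 h)
      simp at this
    have : Nonempty (Named hV) := ⟨Quotient.mk _ 0⟩
    have : Named hV ⊨ ({φ} : vocab.Theory) := by simpa using h1
    exact h2 (h (Language.Theory.ModelType.of _ (Named hV)))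
  · intro h M
    by_contra hn
    refine h.not_satisfies (fun C hC => hC.not_satisfies (𝔐 := M)) fun x hx => ?_
    have hφ : M ⊨ φ := by simpa using M.is_model
    rcases List.mem_pair.1 hx with rfl | rfl
    · simpa using (holds_sentence φ).2 hφ
    · simpa using fun h => hn ((holds_sentence ψ).1 h)

theorem tautology_iff {φ : Sentence} : Tautology φ ↔
    Refutable Forbidden [((codeFormula φ, []), false)] := by
  rw [Tautology, Language.Theory.models_sentence_iff]
  constructor
  · intro h
    by_contra hn
    obtain ⟨V, hV, hs⟩ := Refutable.exists_satisfies hn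
    have h2 : ¬ Named hV ⊨ φ := fun h => by
      have := (hs ((codeFormula φ, []), false) (by simp)).1 ((realize_sentence_named hV φ).1 h)
      simp at this
    have : Nonempty (Named hV) := ⟨Quotient.mk _ 0⟩
    have : Named hV ⊨ (∅ : vocab.Theory) := by simp
    exact h2 (h (Language.Theory.ModelType.of _ (Named hV)))
  · intro h M
    by_contra hn
    refine h.not_satisfies (fun C hC => hC.not_satisfies (𝔐 := M)) fun x hx => ?_
    obtain rfl := List.mem_singleton.1 hx
    simpa using fun h => hn ((holds_sentence φ).1 h)

theorem re_refutable : RE (Refutable Forbidden) := RE.refutable re_forbidden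

/-! ### Renamings as finite objects -/

/-- The product of transpositions of constants. -/
def actSwaps (T : List (ℕ × ℕ)) (c : ℕ) : ℕ :=
  T.foldr (fun p x => bif decide (x = p.1) then p.2 else bif decide (x = p.2) then p.1 else x) c

theorem actSwaps_cons (p : ℕ × ℕ) (T : List (ℕ × ℕ)) (c : ℕ) :
    actSwaps (p :: T) c = Equiv.swap p.1 p.2 (actSwaps T c) := by
  simp only [actSwaps, List.foldr_cons, Equiv.swap_apply_def, Bool.cond_decide]

theorem actSwaps_injective (T : List (ℕ × ℕ)) : Function.Injective (actSwaps T) := by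
  induction T with
  | nil => exact fun _ _ h => h
  | cons p T ih =>
    intro a b h
    rw [actSwaps_cons, actSwaps_cons] at h
    exact ih ((Equiv.injective _) h)

/-- To include a further constant `x`, the transposition of its present image and `τ x` is applied
last. It does not move the images of the earlier constants, because `actSwaps T` and `τ` are both
injective. -/
theorem exists_actSwaps {τ : Const → Const} (hτ : Function.Injective τ) (s : Finset ℕ) :
    ∃ T, ∀ c ∈ s, τ c = actSwaps T c := by
  induction s using Finset.induction_on with
  | empty => exact ⟨[], by simp⟩
  | insert x s hx ih =>
    obtain ⟨T, hT⟩ := ih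
    refine ⟨(actSwaps T x, τ x) :: T, fun c hc => ?_⟩
    rw [actSwaps_cons]
    rcases Finset.mem_insert.1 hc with rfl | hc
    · exact (Equiv.swap_apply_left _ _).symm
    · have hne : c ≠ x := fun h => hx (h ▸ hc)
      refine (hT c hc).trans (Equiv.swap_apply_of_ne_of_ne ?_ ?_).symm
      · exact fun h => hne (actSwaps_injective T h)
      · exact fun h => hne (hτ ((hT c hc).trans h))

/-- The list with the code `n`. -/
def decodeList (n : ℕ) : List ℕ := (Encodable.decode n : Option (List ℕ)).getD []

@[simp] theorem decodeList_encode (l : List ℕ) : decodeList (Encodable.encode l) = l := by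
  rw [decodeList, Encodable.encodek]; rfl

theorem lt_of_mem_decodeList {a n : ℕ} (h : a ∈ decodeList n) : a < n := by
  refine lt_of_mem_ofNat ?_
  rwa [decodeList, Denumerable.decode_eq_ofNat] at h

/-- The code of a term after a renaming. -/
def renameTermCode (T : List (ℕ × ℕ)) (t : ℕ) : ℕ :=
  bif decide (t.unpair.1 = 0) then t else
    codeFunc t.unpair.2.unpair.1 (bif decide (t.unpair.2.unpair.1 = 0)
        then actSwaps T t.unpair.2.unpair.2.unpair.1 else t.unpair.2.unpair.2.unpair.1)
      ((decodeList t.unpair.2.unpair.2.unpair.2).attach.map fun s => renameTermCode T s.1)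
termination_by t
decreasing_by
  exact (lt_of_mem_decodeList s.2).trans_le ((Nat.unpair_right_le _).trans
    ((Nat.unpair_right_le _).trans (Nat.unpair_right_le _)))

theorem renameTermCode_eq (T : List (ℕ × ℕ)) (t : ℕ) :
    renameTermCode T t = bif decide (t.unpair.1 = 0) then t else
      codeFunc t.unpair.2.unpair.1 (bif decide (t.unpair.2.unpair.1 = 0)
          then actSwaps T t.unpair.2.unpair.2.unpair.1 else t.unpair.2.unpair.2.unpair.1)
        ((decodeList t.unpair.2.unpair.2.unpair.2).map fun s => renameTermCode T s) := by
  rw [renameTermCode, List.attach_map_val (f := fun s => renameTermCode T s)]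

theorem renameTermCode_codeFunc (T : List (ℕ × ℕ)) (l f : ℕ) (ts : List ℕ) :
    renameTermCode T (codeFunc l f ts) = codeFunc l (bif decide (l = 0) then actSwaps T f else f)
      (ts.map fun s => renameTermCode T s) := by
  rw [renameTermCode_eq]
  simp [codeFunc]

/-- The code of a formula after a renaming. -/
def renameFormulaCode (T : List (ℕ × ℕ)) (c : ℕ) : ℕ :=
  bif decide (c.unpair.1 = 1) then
    codeEq (renameTermCode T c.unpair.2.unpair.1) (renameTermCode T c.unpair.2.unpair.2)
  else bif decide (c.unpair.1 = 2) then
    codeRel c.unpair.2.unpair.1 c.unpair.2.unpair.2.unpair.1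
      ((decodeList c.unpair.2.unpair.2.unpair.2).map fun t => renameTermCode T t)
  else if _h : c.unpair.1 = 3 then
    codeImp (renameFormulaCode T c.unpair.2.unpair.1) (renameFormulaCode T c.unpair.2.unpair.2)
  else if _h : c.unpair.1 = 4 then codeAll (renameFormulaCode T c.unpair.2)
  else c
termination_by c
decreasing_by
  all_goals
    have h1 := Nat.add_le_pair c.unpair.1 c.unpair.2
    have h2 := Nat.unpair_left_le c.unpair.2
    have h3 := Nat.unpair_right_le c.unpair.2
    rw [Nat.pair_unpair] at h1
    omega

/-- The code of a fact after a renaming. -/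
def renameFactCode (T : List (ℕ × ℕ)) (k : ℕ) : ℕ :=
  (Encodable.decode k : Option (ℕ × List ℕ × Bool)).elim 0 fun x =>
    Encodable.encode (x.1, x.2.1.map fun c => actSwaps T c, x.2.2)

section

variable {α : Type} [Primcodable α]

@[fun_prop] theorem PR.actSwaps {f : α → List (ℕ × ℕ)} {g : α → ℕ} (hf : PR f) (hg : PR g) :
    PR (fun a => actSwaps (f a) (g a)) := by
  unfold KRF.actSwaps
  fun_prop

@[fun_prop] theorem PR.decodeList {f : α → ℕ} (hf : PR f) : PR (fun a => decodeList (f a)) := by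
  unfold KRF.decodeList
  exact PR.getD (PR.decode hf) (PR.const _)

/-- Course-of-values recursion: `L` lists the values at all smaller numbers. Codes of arguments are
smaller than the code of the term, so the default `0` is never used. -/
theorem primrec₂_renameTermCode : Primrec₂ renameTermCode := by
  refine Primrec.nat_strong_rec _ (g := fun T L => some <|
    bif decide (L.length.unpair.1 = 0) then L.length else
      codeFunc L.length.unpair.2.unpair.1 (bif decide (L.length.unpair.2.unpair.1 = 0)
          then actSwaps T L.length.unpair.2.unpair.2.unpair.1
          else L.length.unpair.2.unpair.2.unpair.1)
        ((decodeList L.length.unpair.2.unpair.2.unpair.2).map fun s => (L[s]?).getD 0)) ?_ ?_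
  · refine Primrec₂.mk (?_ : PR _)
    fun_prop
  · intro T n
    rw [renameTermCode_eq]
    simp only [List.length_map, List.length_range]
    congr 3
    refine List.map_congr_left fun s hs => ?_
    have : s < n := (lt_of_mem_decodeList hs).trans_le ((Nat.unpair_right_le _).trans
      ((Nat.unpair_right_le _).trans (Nat.unpair_right_le _)))
    simp [this]

@[fun_prop] theorem PR.renameTermCode {f : α → List (ℕ × ℕ)} {g : α → ℕ} (hf : PR f)
    (hg : PR g) : PR (fun a => renameTermCode (f a) (g a)) :=
  Primrec₂.comp primrec₂_renameTermCode hf hg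

theorem primrec₂_renameFormulaCode : Primrec₂ renameFormulaCode := by
  refine Primrec.nat_strong_rec _ (g := fun T L => some <|
    bif decide (L.length.unpair.1 = 1) then
      codeEq (renameTermCode T L.length.unpair.2.unpair.1)
        (renameTermCode T L.length.unpair.2.unpair.2)
    else bif decide (L.length.unpair.1 = 2) then
      codeRel L.length.unpair.2.unpair.1 L.length.unpair.2.unpair.2.unpair.1
        ((decodeList L.length.unpair.2.unpair.2.unpair.2).map fun t =>
          renameTermCode T t)
    else bif decide (L.length.unpair.1 = 3) then
      codeImp ((L[L.length.unpair.2.unpair.1]?).getD 0) ((L[L.length.unpair.2.unpair.2]?).getD 0)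
    else bif decide (L.length.unpair.1 = 4) then codeAll ((L[L.length.unpair.2]?).getD 0)
    else L.length) ?_ ?_
  · refine Primrec₂.mk (?_ : PR _)
    fun_prop
  · intro T n
    rw [renameFormulaCode]
    simp only [List.length_map, List.length_range]
    have h1 := Nat.add_le_pair n.unpair.1 n.unpair.2
    have h2 := Nat.unpair_left_le n.unpair.2
    have h3 := Nat.unpair_right_le n.unpair.2
    rw [Nat.pair_unpair] at h1
    congr 3
    by_cases e3 : n.unpair.1 = 3
    · have h4 : n.unpair.2.unpair.1 < n := by omega
      have h5 : n.unpair.2.unpair.2 < n := by omega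
      simp [e3, h4, h5]
    by_cases e4 : n.unpair.1 = 4
    · have h4 : n.unpair.2 < n := by omega
      simp [e4, h4]
    · simp [e3, e4]

@[fun_prop] theorem PR.renameFormulaCode {f : α → List (ℕ × ℕ)} {g : α → ℕ} (hf : PR f)
    (hg : PR g) : PR (fun a => renameFormulaCode (f a) (g a)) :=
  Primrec₂.comp primrec₂_renameFormulaCode hf hg

@[fun_prop] theorem PR.renameFactCode {f : α → List (ℕ × ℕ)} {g : α → ℕ} (hf : PR f)
    (hg : PR g) : PR (fun a => renameFactCode (f a) (g a)) := by
  unfold KRF.renameFactCode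
  refine PR.elim (PR.decode hg) (PR.const _) ?_
  have h : PR (fun p : α × ℕ × List ℕ × Bool =>
    (p.2.1, p.2.2.1.map fun c => KRF.actSwaps (f p.1) c, p.2.2.2)) := by fun_prop
  exact PR.encode h

end

theorem renameTermCode_codeTerm (T : List (ℕ × ℕ)) {n : ℕ} (t : vocab.Term (Empty ⊕ Fin n)) :
    renameTermCode T (codeTerm t) = codeTerm ((renameHom (actSwaps T)).onTerm t) := by
  induction t with
  | var x =>
    rcases x with x | i
    · exact x.elim
    · have : codeTerm (Language.Term.var (L := vocab) (.inr i : Empty ⊕ Fin n)) = codeVar i := by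
        rw [codeTerm]; rfl
      rw [Language.LHom.onTerm, this, renameTermCode]
      simp [codeVar]
  | func f ts ih =>
    rename_i l
    rw [Language.LHom.onTerm, codeTerm_func, codeTerm_func, renameTermCode_codeFunc, List.map_ofFn]
    congr 1
    · cases l <;> rfl
    · exact congrArg List.ofFn (funext ih)

theorem renameFormulaCode_codeFormula (T : List (ℕ × ℕ)) {n : ℕ}
    (φ : vocab.BoundedFormula Empty n) : renameFormulaCode T (codeFormula φ) =
      codeFormula ((renameHom (actSwaps T)).onBoundedFormula φ) := by
  induction φ with
  | falsum =>
    rw [renameFormulaCode]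
    simp [codeFormula, Language.LHom.onBoundedFormula]
  | equal t u =>
    rw [renameFormulaCode]
    simp [codeFormula, Language.LHom.onBoundedFormula, renameTermCode_codeTerm, codeEq,
      Language.Term.bdEqual]
  | rel R ts =>
    rw [renameFormulaCode]
    have h : (renameHom (actSwaps T)).onRelation R = R := rfl
    simp [codeFormula, Language.LHom.onBoundedFormula, codeRel, List.map_ofFn,
      Function.comp_def, renameTermCode_codeTerm, Language.Relations.boundedFormula, h]
  | imp φ ψ ih₁ ih₂ =>
    rw [renameFormulaCode]
    simp [codeFormula, Language.LHom.onBoundedFormula, codeImp, ih₁, ih₂]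
  | all φ ih =>
    rw [renameFormulaCode]
    simp [codeFormula, Language.LHom.onBoundedFormula, codeAll, ih]

theorem renameFactCode_codeFact (T : List (ℕ × ℕ)) (α : GroundAtom) (b : Bool) :
    renameFactCode T (Database.codeFact α b) = Database.codeFact (α.rename (actSwaps T)) b := by
  rw [renameFactCode, Database.codeFact, Encodable.encodek, Option.elim_some]
  simp only [List.map_ofFn]
  rfl

theorem exists_finset_onTerm {n : ℕ} (t : vocab.Term (Empty ⊕ Fin n)) :
    ∃ s : Finset ℕ, ∀ τ τ' : Const → Const, (∀ c ∈ s, τ c = τ' c) →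
      (renameHom τ).onTerm t = (renameHom τ').onTerm t := by
  classical
  induction t with
  | var x => exact ⟨∅, fun _ _ _ => rfl⟩
  | func f ts ih =>
    rename_i l
    choose s hs using ih
    -- The symbol `f` is a constant only for arity `0`; for other arities its insertion does no
    -- harm.
    refine ⟨insert f (Finset.univ.biUnion s), fun τ τ' h => ?_⟩
    rw [Language.LHom.onTerm, Language.LHom.onTerm]
    congr 1
    · cases l
      · exact h f (Finset.mem_insert_self _ _)
      · rfl
    · exact funext fun i => hs i _ _ fun c hc => h c (Finset.mem_insert_of_mem
        (Finset.mem_biUnion.2 ⟨i, Finset.mem_univ _, hc⟩))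

/-- Only finitely many constants occur in a formula, which allows an arbitrary renaming to be
replaced by a finite object. -/
theorem exists_finset_onBoundedFormula {n : ℕ} (φ : vocab.BoundedFormula Empty n) :
    ∃ s : Finset ℕ, ∀ τ τ' : Const → Const, (∀ c ∈ s, τ c = τ' c) →
      (renameHom τ).onBoundedFormula φ = (renameHom τ').onBoundedFormula φ := by
  classical
  induction φ with
  | falsum => exact ⟨∅, fun _ _ _ => rfl⟩
  | equal t u =>
    obtain ⟨s, hs⟩ := exists_finset_onTerm t
    obtain ⟨s', hs'⟩ := exists_finset_onTerm u
    refine ⟨s ∪ s', fun τ τ' h => ?_⟩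
    rw [Language.LHom.onBoundedFormula, Language.LHom.onBoundedFormula,
      hs _ _ fun c hc => h c (Finset.mem_union_left _ hc),
      hs' _ _ fun c hc => h c (Finset.mem_union_right _ hc)]
  | rel R ts =>
    choose s hs using fun i => exists_finset_onTerm (ts i)
    refine ⟨Finset.univ.biUnion s, fun τ τ' h => ?_⟩
    have : (renameHom τ).onTerm ∘ ts = (renameHom τ').onTerm ∘ ts := funext fun i =>
      hs i _ _ fun c hc => h c (Finset.mem_biUnion.2 ⟨i, Finset.mem_univ _, hc⟩)
    rw [Language.LHom.onBoundedFormula, Language.LHom.onBoundedFormula, this]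
    rfl
  | imp φ ψ ih₁ ih₂ =>
    obtain ⟨s, hs⟩ := ih₁
    obtain ⟨s', hs'⟩ := ih₂
    refine ⟨s ∪ s', fun τ τ' h => ?_⟩
    rw [Language.LHom.onBoundedFormula, Language.LHom.onBoundedFormula,
      hs _ _ fun c hc => h c (Finset.mem_union_left _ hc),
      hs' _ _ fun c hc => h c (Finset.mem_union_right _ hc)]
  | all φ ih =>
    obtain ⟨s, hs⟩ := ih
    refine ⟨s, fun τ τ' h => ?_⟩
    rw [Language.LHom.onBoundedFormula, Language.LHom.onBoundedFormula, hs _ _ h]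

/-! ### Databases as lists of facts -/

/-- The list of numbers is strictly increasing. -/
def isIncreasing (l : List ℕ) : Bool :=
  (l.foldr (fun a (s : List ℕ × Bool) => (a :: s.1, s.2 && s.1.all fun b => decide (a < b)))
    ([], true)).2

theorem isIncreasing_iff (l : List ℕ) : isIncreasing l = true ↔ l.SortedLT := by
  rw [List.sortedLT_iff_pairwise]
  have key : ∀ l : List ℕ, (l.foldr (fun a (s : List ℕ × Bool) =>
      (a :: s.1, s.2 && s.1.all fun b => decide (a < b))) ([], true)).1 = l := by
    intro l
    induction l with
    | nil => rfl
    | cons a l ih => rw [List.foldr_cons, ih]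
  unfold isIncreasing
  induction l with
  | nil => simp
  | cons a l ih =>
    rw [List.foldr_cons, key, Bool.and_eq_true, List.pairwise_cons]
    exact (and_congr ih (by simp)).trans and_comm

/-- The code of a fact with an OWA-predicate symbol. -/
def isOwaCode (k : ℕ) : Bool :=
  (Encodable.decode k : Option (ℕ × List ℕ × Bool)).elim false fun x =>
    (Encodable.decode x.1 : Option (Bool × ℕ)).elim false fun y => !y.1

section

variable {α : Type} [Primcodable α]

@[fun_prop] theorem PR.isIncreasing {f : α → List ℕ} (hf : PR f) :
    PR (fun a => isIncreasing (f a)) := by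
  unfold KRF.isIncreasing
  fun_prop

@[fun_prop] theorem PR.isOwaCode {f : α → ℕ} (hf : PR f) : PR (fun a => isOwaCode (f a)) := by
  unfold KRF.isOwaCode
  refine PR.elim (PR.decode hf) (PR.const _) (PR.elim (PR.decode ?_) (PR.const _) ?_)
  · fun_prop
  · fun_prop

end

theorem isOwaCode_codeFact (α : GroundAtom) (b : Bool) :
    isOwaCode (Database.codeFact α b) = true ↔ ¬ α.IsCWA := by
  rw [isOwaCode, Database.codeFact, Encodable.encodek, Option.elim_some, codePred,
    Encodable.encodek, Option.elim_some, GroundAtom.IsCWA]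
  simp

namespace Database

variable {σ : Signature}

/-- The value of an observed fact. -/
def obs (b : Bool) : SignType := if b then 1 else 0

theorem mem_factCodes {D : Database σ} {α : GroundAtom} {b : Bool} :
    codeFact α b ∈ D.factCodes ↔ D.val α = some (obs b) := by
  constructor
  · rintro ⟨β, ⟨hβ, e⟩ | ⟨hβ, e⟩⟩ <;> obtain ⟨rfl, rfl⟩ := codeFact_injective e <;> exact hβ
  · intro h
    cases b
    · exact ⟨α, .inr ⟨h, rfl⟩⟩
    · exact ⟨α, .inl ⟨h, rfl⟩⟩

theorem exists_of_mem_factCodes {D : Database σ} {k : ℕ} (h : k ∈ D.factCodes) :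
    ∃ α b, k = codeFact α b := by
  obtain ⟨α, ⟨-, rfl⟩ | ⟨-, rfl⟩⟩ := h
  exacts [⟨α, _, rfl⟩, ⟨α, _, rfl⟩]

open Classical in
/-- The database with some of the observed facts of `D`. -/
noncomputable def restrict (D : Database σ) (s : Set ℕ) : Database σ where
  val := fun α => if D.val α = some 1 ∧ codeFact α true ∈ s then some 1
    else if D.val α = some 0 ∧ codeFact α false ∈ s then some 0
    else if α.IsFact σ ∧ α.IsCWA then some (-1) else none
  isFact := by
    intro α h
    split_ifs at h with h1 h2 h3
    · exact D.isFact α (by simp [h1.1])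
    · exact D.isFact α (by simp [h2.1])
    · exact h3.1
    · exact absurd rfl h
  finite := by
    refine D.finite.subset fun α h => ?_
    simp only [Set.mem_ofPred_eq] at h
    split_ifs at h with h1 h2 h3
    · exact .inl h1.1
    · exact .inr h2.1
    · exact absurd h (by decide)
    · simp at h
  complete := by
    intro α h1 h2
    split_ifs with h3 h4 h5 <;> simp_all
  neg_cwa := by
    intro α h
    split_ifs at h with h1 h2 h3
    · exact absurd h (by decide)
    · exact absurd h (by decide)
    · exact h3.2

theorem val_restrict_eq_one {D : Database σ} {s : Set ℕ} {α : GroundAtom} :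
    (D.restrict s).val α = some 1 ↔ D.val α = some 1 ∧ codeFact α true ∈ s := by
  simp only [restrict]
  split_ifs <;> simp_all

theorem val_restrict_eq_zero {D : Database σ} {s : Set ℕ} {α : GroundAtom} :
    (D.restrict s).val α = some 0 ↔ D.val α = some 0 ∧ codeFact α false ∈ s := by
  simp only [restrict]
  split_ifs <;> simp_all

theorem factCodes_restrict (D : Database σ) {s : Set ℕ} (hs : s ⊆ D.factCodes) :
    (D.restrict s).factCodes = s := by
  ext k
  constructor
  · rintro ⟨α, ⟨h, rfl⟩ | ⟨h, rfl⟩⟩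
    · exact (val_restrict_eq_one.1 h).2
    · exact (val_restrict_eq_zero.1 h).2
  · intro hk
    obtain ⟨α, ⟨h, rfl⟩ | ⟨h, rfl⟩⟩ := hs hk
    · exact ⟨α, .inl ⟨val_restrict_eq_one.2 ⟨h, hk⟩, rfl⟩⟩
    · exact ⟨α, .inr ⟨val_restrict_eq_zero.2 ⟨h, hk⟩, rfl⟩⟩

/-- Extensions add observed OWA-facts. -/
theorem extends_iff {D D' : Database σ} : D.Extends D' ↔ D'.factCodes ⊆ D.factCodes ∧
    ∀ k ∈ D.factCodes, k ∈ D'.factCodes ∨ isOwaCode k = true := by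
  constructor
  · intro h
    refine ⟨fun k hk => ?_, fun k hk => ?_⟩
    · obtain ⟨α, b, rfl⟩ := exists_of_mem_factCodes hk
      exact mem_factCodes.2 (h _ _ (mem_factCodes.1 hk))
    · obtain ⟨α, b, rfl⟩ := exists_of_mem_factCodes hk
      rw [isOwaCode_codeFact, or_iff_not_imp_right, not_not]
      intro hα
      have hv := mem_factCodes.1 hk
      obtain ⟨v, hv'⟩ := Option.ne_none_iff_exists'.1
        (D'.complete α (D.isFact α (by simp [hv])) hα)
      have e := h _ _ hv'
      rw [hv] at e
      rw [mem_factCodes, hv', e]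
  · rintro ⟨h1, h2⟩ α v hv
    have obsv : ∀ b, D'.val α = some (obs b) → D.val α = some (obs b) := fun b hb =>
      mem_factCodes.1 (h1 (mem_factCodes.2 hb))
    rcases v with _ | _ | _
    · exact obsv false hv
    · have hα := D'.neg_cwa α hv
      obtain ⟨w, hw⟩ := Option.ne_none_iff_exists'.1
        (D.complete α (D'.isFact α (by simp [hv])) hα)
      have obsw : ∀ b, D.val α ≠ some (obs b) := by
        intro b hb
        rcases h2 _ (mem_factCodes.2 hb) with h | h
        · rw [mem_factCodes, hv] at h
          cases b <;> exact absurd h (by decide)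
        · exact (isOwaCode_codeFact α b).1 h hα
      rcases w with _ | _ | _
      · exact absurd hw (obsw false)
      · exact hw
      · exact absurd hw (obsw true)
    · exact obsv true hv

theorem exists_of_val_rename {τ : Const → Const} {D : Database σ} {β : GroundAtom} {b : Bool}
    (h : (D.rename τ).val β = some (obs b)) : ∃ α, α.rename τ = β ∧ D.val α = some (obs b) := by
  simp only [rename] at h
  cases b <;> simp only [obs] at h ⊢ <;> split_ifs at h <;> simp_all

/-- Observed facts determine a database, so it is enough that the transpositions agree with `τ` on
these. -/
theorem factCodes_rename {T : List (ℕ × ℕ)} {D : Database σ} {τ : Const → Const}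
    (hτ : Function.Injective τ)
    (h : ∀ α b, codeFact α b ∈ D.factCodes → α.rename τ = α.rename (actSwaps T)) :
    (D.rename τ).factCodes = renameFactCode T '' D.factCodes := by
  ext k
  constructor
  · intro hk
    obtain ⟨β, b, rfl⟩ := exists_of_mem_factCodes hk
    obtain ⟨α, rfl, hα⟩ := exists_of_val_rename (mem_factCodes.1 hk)
    refine ⟨_, mem_factCodes.2 hα, ?_⟩
    rw [renameFactCode_codeFact, h α b (mem_factCodes.2 hα)]
  · rintro ⟨k, hk, rfl⟩
    obtain ⟨α, b, rfl⟩ := exists_of_mem_factCodes hk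
    rw [renameFactCode_codeFact, ← h α b hk, mem_factCodes, val_rename τ hτ]
    exact mem_factCodes.1 hk

theorem code_eq_encode {D : Database σ} {l : List ℕ} (hl : l.SortedLT)
    (h : ∀ k, k ∈ l ↔ k ∈ D.factCodes) : D.code = Encodable.encode l := by
  rw [code]
  congr 1
  exact (Finset.sortedLT_sort _).eq_of_mem_iff hl fun k => by simp [h]

end Database

/-- One of the two classes of databases. -/
def IsDatabaseClass {σ : Signature} (𝒟 : Set (Database σ)) : Prop :=
  𝒟 = allDatabases σ ∨ 𝒟 = posDatabases σ

namespace IsDatabaseClass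

variable {σ : Signature} {𝒟 : Set (Database σ)}

/-- Both classes are treated at once: membership depends at most on whether the value `0` occurs. -/
theorem mem_of_val_eq_zero (h : IsDatabaseClass 𝒟) {D D' : Database σ} (hD : D ∈ 𝒟)
    (h' : ∀ α, D'.val α = some 0 → ∃ β, D.val β = some 0) : D' ∈ 𝒟 := by
  rcases h with rfl | rfl
  · exact Set.mem_univ _
  · intro α hα
    obtain ⟨β, hβ⟩ := h' α hα
    exact hD β hβ

theorem restrict_mem (h : IsDatabaseClass 𝒟) {D : Database σ} (hD : D ∈ 𝒟) (s : Set ℕ) :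
    D.restrict s ∈ 𝒟 :=
  h.mem_of_val_eq_zero hD fun α hα => ⟨α, (Database.val_restrict_eq_zero.1 hα).1⟩

theorem rename_mem (h : IsDatabaseClass 𝒟) {D : Database σ} (hD : D ∈ 𝒟) (τ : Const → Const) :
    D.rename τ ∈ 𝒟 :=
  h.mem_of_val_eq_zero hD fun _ hβ => by
    obtain ⟨α, -, hα⟩ := Database.exists_of_val_rename (b := false) hβ
    exact ⟨α, hα⟩

end IsDatabaseClass

/-! ### The search -/

/-- The code of a conjunction. -/
def codeAnd (a b : ℕ) : ℕ := codeImp (codeImp a (codeImp b codeBot)) codeBot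

@[fun_prop] theorem PR.codeAnd {α : Type} [Primcodable α] {f g : α → ℕ} (hf : PR f) (hg : PR g) :
    PR (fun a => codeAnd (f a) (g a)) := by
  unfold KRF.codeAnd
  fun_prop

/-- The number is the code of a sentence in `𝒬`. -/
def IsQueryCode (𝒬 : Set Sentence) (c : ℕ) : Prop := ∃ φ ∈ 𝒬, codeFormula φ = c

theorem IsQueryLanguage.re {σ : Signature} {𝒬 : Set Sentence} (h : IsQueryLanguage σ 𝒬) :
    RE (IsQueryCode 𝒬) := by
  refine (h.recursive.re.comp (g := fun c : ℕ => Nat.bits c) (by fun_prop)).of_eq fun c => ?_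
  constructor
  · rintro ⟨φ, hφ, rfl⟩
    exact ⟨φ, hφ, rfl⟩
  · rintro ⟨φ, hφ, e⟩
    exact ⟨φ, hφ, TM.bits_injective e⟩

/-- A search: the code of a machine, the list of facts of a database, the code of a sentence. -/
abbrev SearchItem := ℕ × List ℕ × ℕ

/-- The rules of the search. -/
inductive SearchRule (𝒬 : Set Sentence) : List SearchItem × SearchItem → Prop
  | simulate (m : ℕ) (l : List ℕ) (c : ℕ) (h : isIncreasing l = true)
      (h' : AcceptsCode (m, Nat.bits (Nat.pair (Encodable.encode l) c))) :
      SearchRule 𝒬 ([], m, l, c)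
  | tautology (m : ℕ) (l : List ℕ) (c : ℕ) (h : Refutable Forbidden [((c, []), false)]) :
      SearchRule 𝒬 ([], m, l, c)
  | implication (m : ℕ) (l : List ℕ) (c c' : ℕ) (hc : IsQueryCode 𝒬 c')
      (h : Refutable Forbidden [((c', []), true), ((c, []), false)]) :
      SearchRule 𝒬 ([(m, l, c')], m, l, c)
  | conjunction (m : ℕ) (l : List ℕ) (c c' : ℕ) (hc : IsQueryCode 𝒬 c) (hc' : IsQueryCode 𝒬 c') :
      SearchRule 𝒬 ([(m, l, c), (m, l, c')], m, l, codeAnd c c')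
  | extension (m : ℕ) (l l' : List ℕ) (c : ℕ) (h : l' ⊆ l)
      (h' : (l.all fun k => decide (k ∈ l') || isOwaCode k) = true) :
      SearchRule 𝒬 ([(m, l', c)], m, l, c)
  | rename (m : ℕ) (l : List ℕ) (c : ℕ) (T : List (ℕ × ℕ)) :
      SearchRule 𝒬 ([(m, l.map fun k => renameFactCode T k, renameFormulaCode T c)], m, l, c)

theorem IsQueryLanguage.re_searchRule {σ : Signature} {𝒬 : Set Sentence}
    (h : IsQueryLanguage σ 𝒬) : RE (SearchRule 𝒬) := by
  have h1 := RE.image (F := fun p : SearchItem => (([] : List SearchItem), p)) (by fun_prop)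
    (Q := fun p => isIncreasing p.2.1 = true ∧
      AcceptsCode (p.1, Nat.bits (Nat.pair (Encodable.encode p.2.1) p.2.2)))
    ((RE.of_bool (by fun_prop)).and (re_acceptsCode.comp
      (g := fun p : SearchItem => (p.1, Nat.bits (Nat.pair (Encodable.encode p.2.1) p.2.2)))
      (PR.mk (by fun_prop) (PR.bits (PR.natPair (PR.encode (by fun_prop)) (by fun_prop))))))
  have h2 := RE.image (F := fun p : SearchItem => (([] : List SearchItem), p)) (by fun_prop)
    (Q := fun p => Refutable Forbidden [((p.2.2, []), false)])
    (re_refutable.comp (by fun_prop))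
  have h3 := RE.image (F := fun p : SearchItem × ℕ => ([(p.1.1, p.1.2.1, p.2)], p.1))
    (by fun_prop) (Q := fun p => IsQueryCode 𝒬 p.2 ∧
      Refutable Forbidden [((p.2, []), true), ((p.1.2.2, []), false)])
    ((h.re.comp (by fun_prop)).and (re_refutable.comp (by fun_prop)))
  have h4 := RE.image (F := fun p : ℕ × List ℕ × ℕ × ℕ =>
    ([(p.1, p.2.1, p.2.2.1), (p.1, p.2.1, p.2.2.2)], p.1, p.2.1, codeAnd p.2.2.1 p.2.2.2))
    (by fun_prop) (Q := fun p => IsQueryCode 𝒬 p.2.2.1 ∧ IsQueryCode 𝒬 p.2.2.2)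
    ((h.re.comp (by fun_prop)).and (h.re.comp (by fun_prop)))
  have h5a : PR (fun p : SearchItem × List ℕ => decide (p.2 ⊆ p.1.2.1)) :=
    PR.decSubset (by fun_prop) (by fun_prop)
  have h5b : PR (fun p : SearchItem × List ℕ =>
      p.1.2.1.all fun k => decide (k ∈ p.2) || isOwaCode k) :=
    PR.all (by fun_prop) (PR.bor (PR.decMem (by fun_prop) (by fun_prop)) (by fun_prop))
  have h5 := RE.image (F := fun p : SearchItem × List ℕ => ([(p.1.1, p.2, p.1.2.2)], p.1))
    (by fun_prop) (Q := fun p => p.2 ⊆ p.1.2.1 ∧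
      (p.1.2.1.all fun k => decide (k ∈ p.2) || isOwaCode k) = true)
    ((RE.of_dec h5a).and (RE.of_bool h5b))
  have h6 := RE.range (F := fun p : SearchItem × List (ℕ × ℕ) =>
    ([(p.1.1, p.1.2.1.map fun k => renameFactCode p.2 k, renameFormulaCode p.2 p.1.2.2)], p.1))
    (by fun_prop)
  refine (h1.or (h2.or (h3.or (h4.or (h5.or h6))))).of_eq fun r => ?_
  constructor
  · intro h
    cases h with
    | simulate m l c h h' => exact .inl ⟨(m, l, c), ⟨h, h'⟩, rfl⟩
    | tautology m l c h => exact .inr (.inl ⟨(m, l, c), h, rfl⟩)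
    | implication m l c c' hc h => exact .inr (.inr (.inl ⟨((m, l, c), c'), ⟨hc, h⟩, rfl⟩))
    | conjunction m l c c' hc hc' =>
      exact .inr (.inr (.inr (.inl ⟨(m, l, c, c'), ⟨hc, hc'⟩, rfl⟩)))
    | extension m l l' c h h' =>
      exact .inr (.inr (.inr (.inr (.inl ⟨((m, l, c), l'), ⟨h, h'⟩, rfl⟩))))
    | rename m l c T => exact .inr (.inr (.inr (.inr (.inr ⟨((m, l, c), T), rfl⟩))))
  · rintro (⟨p, hp, rfl⟩ | ⟨p, hp, rfl⟩ | ⟨p, hp, rfl⟩ | ⟨p, hp, rfl⟩ | ⟨p, hp, rfl⟩ | ⟨p, rfl⟩)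
    exacts [.simulate _ _ _ hp.1 hp.2, .tautology _ _ _ hp, .implication _ _ _ _ hp.1 hp.2,
      .conjunction _ _ _ _ hp.1 hp.2, .extension _ _ _ _ hp.1 hp.2, .rename _ _ _ _]

/-- The search succeeds, as a property of codes. -/
def SearchCode (𝒬 : Set Sentence) : SearchItem → Prop := Der (SearchRule 𝒬)

theorem IsQueryLanguage.re_searchCode {σ : Signature} {𝒬 : Set Sentence}
    (h : IsQueryLanguage σ 𝒬) : RE (SearchCode 𝒬) := RE.der h.re_searchRule

section

variable {σ σ' : Signature} {𝒟 : Set (Database σ)} {𝒬 : Set Sentence}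

/-- The rules on codes do not test membership in `𝒟`, and test membership in `𝒬` only for newly
chosen sentences. It is passed on from a search to its subsearches: sublists of the facts of a
database in `𝒟` and renamings of them belong again to databases in `𝒟`, and `𝒬` is closed under
renamings. -/
theorem SearchCode.succeeds (h𝒟 : IsDatabaseClass 𝒟) (h𝒬 : IsQueryLanguage σ' 𝒬) {M : TM}
    {x : SearchItem} (h : SearchCode 𝒬 x) : ∀ {D : Database σ} {φ : Sentence}, D ∈ 𝒟 → φ ∈ 𝒬 →
      x.1 = M.code → (∀ k, k ∈ x.2.1 ↔ k ∈ D.factCodes) → codeFormula φ = x.2.2 →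
      SearchSucceeds 𝒟 𝒬 M D φ := by
  induction h with
  | mk prems x hr _ ih =>
    intro D φ hD hφ hm hl hc
    cases hr with
    | simulate m l c h h' =>
      dsimp only at hm hl hc
      subst hm hc
      rw [← Database.code_eq_encode ((isIncreasing_iff l).1 h) hl, TM.acceptsCode] at h'
      exact .simulate hD hφ h'
    | tautology m l c h =>
      dsimp only at hc
      subst hc
      exact .tautology hD hφ (tautology_iff.2 h)
    | implication m l c c' hc' h =>
      dsimp only at hc
      subst hc
      obtain ⟨ψ, hψ, rfl⟩ := hc'
      exact .implication hD hφ hψ (entails_iff.2 h)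
        (ih _ List.mem_cons_self hD hψ hm hl rfl)
    | conjunction m l c c' h h' =>
      obtain ⟨ψ, hψ, rfl⟩ := h
      obtain ⟨χ, hχ, rfl⟩ := h'
      -- The conjunction unfolds to `¬ (ψ → ¬ χ)` with negation as implication of `⊥`, so `codeAnd`
      -- gives its code by definition.
      obtain rfl : φ = ψ ⊓ χ := codeFormula_injective hc
      exact .conjunction hD hφ hψ hχ (ih _ List.mem_cons_self hD hψ hm hl rfl)
        (ih _ (List.mem_cons_of_mem _ List.mem_cons_self) hD hχ hm hl rfl)
    | extension m l l' c h h' =>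
      have hs : {k | k ∈ l'} ⊆ D.factCodes := fun k hk => (hl k).1 (h hk)
      have hf := D.factCodes_restrict hs
      refine .extension hD (h𝒟.restrict_mem hD {k | k ∈ l'}) hφ ?_
        (ih _ List.mem_cons_self (h𝒟.restrict_mem hD _) hφ hm (fun k => by rw [hf]; rfl) hc)
      rw [Database.extends_iff, hf]
      refine ⟨hs, fun k hk => ?_⟩
      have := List.all_eq_true.1 h' k ((hl k).2 hk)
      simpa using this
    | rename m l c T =>
      refine .renaming hD hφ (actSwaps T) (actSwaps_injective T)
        (ih _ List.mem_cons_self (h𝒟.rename_mem hD _)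
          (h𝒬.rename _ (actSwaps_injective T) _ hφ) hm (fun k => ?_) ?_)
      · rw [Database.factCodes_rename (actSwaps_injective T) fun _ _ _ => rfl]
        simp only [List.mem_map, hl, Set.mem_image]
      · dsimp only at hc
        rw [← hc, renameFormulaCode_codeFormula]
        rfl

theorem SearchSucceeds.searchCode {M : TM} {D : Database σ} {φ : Sentence}
    (h : SearchSucceeds 𝒟 𝒬 M D φ) : ∀ {l : List ℕ}, (∀ k, k ∈ l ↔ k ∈ D.factCodes) →
      SearchCode 𝒬 (M.code, l, codeFormula φ) := by
  classical
  induction h with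
  | @simulate D φ hD hφ h =>
    intro l hl
    -- The rule for simulation needs the increasing list, while `l` may be any list of the facts.
    -- The extension rule, applied to two lists of the same facts, leads from one to the other.
    refine .mk _ _ (.extension _ _ (D.factCodes_finite.toFinset.sort (· ≤ ·)) _ ?_ ?_) ?_
    · exact fun k hk => (hl k).2 (by simpa using hk)
    · refine List.all_eq_true.2 fun k hk => ?_
      simp [(hl k).1 hk]
    · intro b hb
      obtain rfl := List.mem_singleton.1 hb
      refine .mk _ _ (.simulate _ _ _ ((isIncreasing_iff _).2 (Finset.sortedLT_sort _)) ?_)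
        (by simp)
      exact TM.acceptsCode.2 h
  | tautology hD hφ h =>
    intro l hl
    exact .mk _ _ (.tautology _ _ _ (tautology_iff.1 h)) (by simp)
  | implication hD hφ hψ h _ ih =>
    intro l hl
    refine .mk _ _ (.implication _ _ _ _ ⟨_, hψ, rfl⟩ (entails_iff.1 h)) fun b hb => ?_
    obtain rfl := List.mem_singleton.1 hb
    exact ih hl
  | conjunction hD _ hψ hχ _ _ ih₁ ih₂ =>
    intro l hl
    refine .mk _ _ (.conjunction _ _ _ _ ⟨_, hψ, rfl⟩ ⟨_, hχ, rfl⟩) fun b hb => ?_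
    rcases List.mem_pair.1 hb with rfl | rfl
    exacts [ih₁ hl, ih₂ hl]
  | @extension D D' φ hD hD' hφ h _ ih =>
    intro l hl
    obtain ⟨h1, h2⟩ := Database.extends_iff.1 h
    refine .mk _ _ (.extension _ _ D'.factCodes_finite.toFinset.toList _ ?_ ?_) ?_
    · exact fun k hk => (hl k).2 (h1 (by simpa using hk))
    · refine List.all_eq_true.2 fun k hk => ?_
      simpa using h2 k ((hl k).1 hk)
    · intro b hb
      obtain rfl := List.mem_singleton.1 hb
      exact ih fun k => by simp
  | _ =>
    rename_i D φ hD hφ τ hτ _ ih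
    intro l hl
    obtain ⟨s, hs⟩ := exists_finset_onBoundedFormula φ
    have hfin : {α | D.val α = some 1 ∨ D.val α = some 0}.Finite := D.finite
    -- The transpositions have to match `τ` on the constants of `φ` and on the arguments of the
    -- observed facts of `D`.
    obtain ⟨T, hT⟩ := exists_actSwaps hτ
      (s ∪ hfin.toFinset.biUnion fun α => Finset.univ.image α.args)
    have hφT := hs τ (actSwaps T) fun c hc => hT c (Finset.mem_union_left _ hc)
    have hDT := Database.factCodes_rename (D := D) (T := T) hτ fun α b hα => by
      rw [Database.mem_factCodes] at hα
      refine congrArg (GroundAtom.mk α.arity α.pred) (funext fun i => hT _ ?_)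
      refine Finset.mem_union_right _ (Finset.mem_biUnion.2 ⟨α, ?_, by simp⟩)
      cases b
      · exact hfin.mem_toFinset.2 (.inr hα)
      · exact hfin.mem_toFinset.2 (.inl hα)
    refine .mk _ _ (.rename _ _ _ T) fun b hb => ?_
    obtain rfl := List.mem_singleton.1 hb
    rw [renameFormulaCode_codeFormula, ← hφT]
    refine ih fun k => ?_
    rw [hDT]
    simp only [List.mem_map, hl, Set.mem_image]

/-- The search, as a recursively enumerable property of codes. -/
theorem searchCode_iff (h𝒟 : IsDatabaseClass 𝒟) (h𝒬 : IsQueryLanguage σ' 𝒬) {M : TM}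
    {D : Database σ} {φ : Sentence} (hD : D ∈ 𝒟) (hφ : φ ∈ 𝒬) :
    SearchCode 𝒬 (M.code, D.factCodes_finite.toFinset.sort (· ≤ ·), codeFormula φ) ↔
      SearchSucceeds 𝒟 𝒬 M D φ :=
  ⟨fun h => h.succeeds h𝒟 h𝒬 hD hφ rfl (by simp) rfl, fun h => h.searchCode (by simp)⟩

end

/-! ### Star transformations -/

theorem replicate_append_false_injective {a b : ℕ} {v w : List Bool}
    (h : List.replicate a true ++ false :: v = List.replicate b true ++ false :: w) :
    a = b ∧ v = w := by
  induction a generalizing b with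
  | zero => cases b <;> simp_all [List.replicate_succ]
  | succ a ih =>
    cases b with
    | zero => simp [List.replicate_succ] at h
    | succ b =>
      simp only [List.replicate_succ, List.cons_append, List.cons.injEq, true_and] at h
      obtain ⟨rfl, rfl⟩ := ih h
      exact ⟨rfl, rfl⟩

/-- Recursively enumerable relations between numbers and strings, by hard-wired machines. -/
theorem RE.exists_hardwire_accepts {P : ℕ × List Bool → Prop} (hP : RE P) :
    ∃ U : TM, ∀ a w, (U.hardwire a).Accepts w ↔ P (a, w) := by
  have h := RE.image (F := fun p : ℕ × List Bool =>
    ((List.range p.1).map fun _ => true) ++ false :: p.2) (by fun_prop) hP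
  obtain ⟨U, hU⟩ := RE.exists_TM_accepts h
  refine ⟨U, fun a w => ?_⟩
  rw [TM.accepts_hardwire, hU]
  constructor
  · rintro ⟨⟨b, v⟩, hp, e⟩
    dsimp only at e
    rw [List.map_const', List.length_range] at e
    obtain ⟨rfl, rfl⟩ := replicate_append_false_injective e
    exact hp
  · exact fun hp => ⟨(a, w), hp, by simp⟩

/-- The number with the binary digits `w`. -/
def ofBits (w : List Bool) : ℕ := w.foldr (fun b n => 2 * n + bif b then 1 else 0) 0

theorem ofBits_bits (n : ℕ) : ofBits (Nat.bits n) = n := by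
  induction n using Nat.binaryRec' with
  | zero => rfl
  | bit b n hn ih =>
    rw [Nat.bits_append_bit n b hn, ofBits, List.foldr_cons, ← ofBits, ih]
    cases b <;> simp [Nat.bit]

@[fun_prop] theorem PR.ofBits {α : Type} [Primcodable α] {f : α → List Bool} (hf : PR f) :
    PR (fun a => ofBits (f a)) := by
  unfold KRF.ofBits
  fun_prop

/-- A bounded search decides membership: by `TM.le_code_hardwire` the hard-wired argument is at most
the number coded by the string. -/
theorem isRecursive_range_hardwire (U : TM) :
    IsRecursive (Set.range fun M : TM => (U.hardwire M.code).enc) := by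
  have h : PR (fun w : List Bool => (List.range (ofBits w + 1)).any fun m =>
      isCode m && decide (Nat.bits (hardwireCode U.code m) = w)) := by
    refine PR.any (by fun_prop) (PR.band (by fun_prop) (PR.decEq (by fun_prop) (by fun_prop)))
  convert isRecursive_of_PR h using 1
  ext w
  simp only [Set.mem_range, Set.mem_ofPred_eq, List.any_eq_true, List.mem_range,
    Bool.and_eq_true, decide_eq_true_eq, isCode_iff]
  constructor
  · rintro ⟨M, rfl⟩
    refine ⟨M.code, ?_, ⟨M, rfl⟩, ?_⟩
    · rw [TM.enc, ofBits_bits]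
      exact Nat.lt_succ_of_le TM.le_code_hardwire
    · rw [TM.enc, TM.code_hardwire]
  · rintro ⟨m, -, ⟨M, rfl⟩, rfl⟩
    exact ⟨M, by rw [TM.enc, TM.code_hardwire]⟩

theorem exists_TM_outputs_hardwire (U : TM) :
    ∃ T : TM, ∀ M : TM, T.Outputs M.enc (U.hardwire M.code).enc := by
  have h := RE.range (F := fun m : ℕ => (Nat.bits m, Nat.bits (hardwireCode U.code m)))
    (by fun_prop)
  obtain ⟨T, hT⟩ := RE.exists_TM_outputs h (by
    rintro w v v' ⟨m, hm⟩ ⟨m', hm'⟩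
    simp only [Prod.mk.injEq] at hm hm'
    obtain rfl := TM.bits_injective (hm.1.trans hm'.1.symm)
    exact hm.2.symm.trans hm'.2)
  refine ⟨T, fun M => (hT _ _).2 ⟨M.code, ?_⟩⟩
  rw [TM.enc, TM.enc, TM.code_hardwire]

section

variable {σ σ' : Signature} {𝒟 : Set (Database σ)} {𝒬 : Set Sentence}

/-- The search is recursively enumerable uniformly in the code of the machine on which it is based.
So a single machine `U` does all searches, and `M*` is `U` with the code of `M` hard-wired. -/
theorem exists_isStarTransformation (h𝒟 : IsDatabaseClass 𝒟) (h𝒬 : IsQueryLanguage σ' 𝒬) :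
    ∃ star : TM → TM, IsStarTransformation 𝒟 𝒬 star := by
  have h : RE (fun p : ℕ × List Bool => ∃ y : List ℕ × ℕ, SearchCode 𝒬 (p.1, y) ∧
      Nat.bits (Nat.pair (Encodable.encode y.1) y.2) = p.2) := by
    refine RE.ex (P := fun (p : ℕ × List Bool) (y : List ℕ × ℕ) => SearchCode 𝒬 (p.1, y) ∧
      Nat.bits (Nat.pair (Encodable.encode y.1) y.2) = p.2)
      ((h𝒬.re_searchCode.comp (by fun_prop)).and (RE.of_dec (PR.decEq ?_ (by fun_prop))))
    exact PR.bits (PR.natPair (PR.encode (by fun_prop)) (by fun_prop))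
  obtain ⟨U, hU⟩ := h.exists_hardwire_accepts
  refine ⟨fun M => U.hardwire M.code, exists_TM_outputs_hardwire U, isRecursive_range_hardwire U,
    fun M D hD φ hφ => ?_⟩
  rw [hU, ← searchCode_iff h𝒟 h𝒬 hD hφ]
  constructor
  · rintro ⟨⟨l, c⟩, h, e⟩
    have e := Nat.pair_eq_pair.1 (TM.bits_injective e)
    obtain rfl := Encodable.encode_injective e.1
    obtain rfl := e.2
    exact h
  · exact fun h => ⟨_, h, rfl⟩

/-! ### Idempotence of the search and the fixed point -/

/-- The search based on a machine that performs the search based on `M` finds nothing new. -/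
theorem SearchSucceeds.of_accepts {M M₀ : TM}
    (hM : ∀ D ∈ 𝒟, ∀ φ ∈ 𝒬, M₀.Accepts (encPair D φ) → SearchSucceeds 𝒟 𝒬 M D φ)
    {D : Database σ} {φ : Sentence} (h : SearchSucceeds 𝒟 𝒬 M₀ D φ) :
    SearchSucceeds 𝒟 𝒬 M D φ := by
  induction h with
  | simulate hD hφ h => exact hM _ hD _ hφ h
  | tautology hD hφ h => exact .tautology hD hφ h
  | implication hD hφ hψ h _ ih => exact .implication hD hφ hψ h ih
  | conjunction hD hψχ hψ hχ _ _ ih₁ ih₂ => exact .conjunction hD hψχ hψ hχ ih₁ ih₂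
  | extension hD hD' hφ h _ ih => exact .extension hD hD' hφ h ih
  | _ =>
    rename_i hD hφ τ hτ _ ih
    exact .renaming hD hφ τ hτ ih

theorem Theta_enc (star : TM → TM) (M : TM) :
    Theta 𝒟 𝒬 star (star M).enc = Part.some (acceptedPairs 𝒟 𝒬 (star M)) := by
  refine Part.ext' (iff_of_true ⟨M, rfl⟩ trivial) fun _ _ => ?_
  ext x
  simp only [Theta, Set.mem_iUnion, Part.get_some]
  constructor
  · rintro ⟨M', h, hx⟩
    rwa [← TM.enc_injective h]
  · exact fun hx => ⟨M, rfl, hx⟩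

/-- What `star M` accepts is found by simulation in the search based on `M₀`. Conversely, that
search starts from pairs already found by the search based on `M`, and the pairs found there are
closed under all the clauses. -/
theorem IsStarTransformation.acceptedPairs_eq {star : TM → TM}
    (h : IsStarTransformation 𝒟 𝒬 star) {M M₀ : TM}
    (hM : ∀ w, M₀.Accepts w ↔ (star M).Accepts w) :
    acceptedPairs 𝒟 𝒬 (star M) = acceptedPairs 𝒟 𝒬 (star M₀) := by
  ext ⟨D, φ⟩
  refine and_congr_right fun hD => and_congr_right fun hφ => ?_
  dsimp only at hD hφ ⊢
  rw [h.accepts_iff M₀ D hD φ hφ]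
  constructor
  · exact fun hx => .simulate hD hφ ((hM _).2 hx)
  · intro hx
    refine (h.accepts_iff M D hD φ hφ).2 (hx.of_accepts fun D hD φ hφ hx => ?_)
    exact (h.accepts_iff M D hD φ hφ).1 ((hM _).1 hx)

/-- For every machine `M`, effectively, a machine `M₀` that accepts like the machine whose encoding
is the output of `M` on `⟪star M₀⟫`. -/
theorem IsStarTransformation.exists_fixedPoint {star : TM → TM}
    (h : IsStarTransformation 𝒟 𝒬 star) : ∃ (N : TM) (M₀ : TM → TM), ∀ M : TM,
      N.Outputs M.enc (star (M₀ M)).enc ∧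
        ∀ M' : TM, M.Outputs (star (M₀ M)).enc M'.enc → ∀ w, (M₀ M).Accepts w ↔ M'.Accepts w := by
  obtain ⟨T, hT⟩ := h.effective
  -- The argument `p.1` is meant to be a pair of the codes of `M` and of a machine `U`, so that
  -- `hardwireCode p.1.unpair.2 p.1` is the code of `U.hardwire p.1`. The string `y.1` is then the
  -- encoding of the star of that machine, and `y.2` the code of the machine whose encoding `M`
  -- outputs on `y.1`.
  have hP : RE (fun p : ℕ × List Bool => ∃ y : List Bool × ℕ,
      OutputsCode (T.code, Nat.bits (hardwireCode p.1.unpair.2 p.1), y.1) ∧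
      OutputsCode (p.1.unpair.1, y.1, Nat.bits y.2) ∧ AcceptsCode (y.2, p.2)) :=
    RE.ex (P := fun (p : ℕ × List Bool) (y : List Bool × ℕ) =>
      OutputsCode (T.code, Nat.bits (hardwireCode p.1.unpair.2 p.1), y.1) ∧
      OutputsCode (p.1.unpair.1, y.1, Nat.bits y.2) ∧ AcceptsCode (y.2, p.2))
    ((re_outputsCode.comp (by fun_prop)).and
      ((re_outputsCode.comp (by fun_prop)).and (re_acceptsCode.comp (by fun_prop))))
  -- The diagonal step: with its own code as second component of the argument, `U` works with the
  -- code of the machine that it is part of. The fixed point for `M` will be `U.hardwire (Nat.pair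
  -- M.code U.code)`, and its star is computable from `⟪M⟫` by one machine `N`.
  obtain ⟨U, hU⟩ := hP.exists_hardwire_accepts
  have hR : RE (fun r : List Bool × List Bool => ∃ m : ℕ, Nat.bits m = r.1 ∧
      OutputsCode (T.code, Nat.bits (hardwireCode U.code (Nat.pair m U.code)), r.2)) :=
    RE.ex (P := fun (r : List Bool × List Bool) (m : ℕ) => Nat.bits m = r.1 ∧
      OutputsCode (T.code, Nat.bits (hardwireCode U.code (Nat.pair m U.code)), r.2))
    ((RE.of_dec (PR.decEq (by fun_prop) (by fun_prop))).and (re_outputsCode.comp (by fun_prop)))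
  obtain ⟨N, hN⟩ := RE.exists_TM_outputs hR (by
    rintro w v v' ⟨m, rfl, hm⟩ ⟨m', e, hm'⟩
    obtain rfl := TM.bits_injective e
    exact TM.Outputs.unique (TM.outputsCode.1 hm) (TM.outputsCode.1 hm'))
  have hT' : ∀ M : TM, OutputsCode (T.code, Nat.bits (hardwireCode U.code (Nat.pair M.code U.code)),
      (star (U.hardwire (Nat.pair M.code U.code))).enc) := by
    intro M
    rw [← TM.code_hardwire]
    exact TM.outputsCode.2 (hT _)
  refine ⟨N, fun M => U.hardwire (Nat.pair M.code U.code), fun M => ⟨?_, fun M' hM' w => ?_⟩⟩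
  · exact (hN _ _).2 ⟨M.code, rfl, hT' M⟩
  · rw [hU]
    dsimp only
    rw [Nat.unpair_pair]
    constructor
    · rintro ⟨⟨π, m⟩, h1, h2, h3⟩
      obtain rfl := TM.Outputs.unique (TM.outputsCode.1 h1) (TM.outputsCode.1 (hT' M))
      have e := TM.Outputs.unique (TM.outputsCode.1 h2) hM'
      obtain rfl : m = M'.code := TM.bits_injective e
      exact TM.acceptsCode.1 h3
    · exact fun hw => ⟨(_, M'.code), hT' M, TM.outputsCode.2 hM', TM.acceptsCode.2 hw⟩

end

end KRF

theorem mainTheorem4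
    (σD σQ : KRF.Signature) (hσD : σD.IsDatabaseSignature) (hσQ : σQ.IsQuerySignature)
    (𝒟 : Set (KRF.Database σD)) (h𝒟 : 𝒟 = KRF.allDatabases σD ∨ 𝒟 = KRF.posDatabases σD)
    (𝒬 : Set KRF.Sentence) (h𝒬 : KRF.IsQueryLanguage σQ 𝒬) :
    (∃ star : KRF.TM → KRF.TM, KRF.IsStarTransformation 𝒟 𝒬 star) ∧
    ∀ star : KRF.TM → KRF.TM, KRF.IsStarTransformation 𝒟 𝒬 star →
      ∃ N : KRF.TM, ∀ (M : KRF.TM) (p : List Bool →. List Bool),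
        M.Computes p →
        p.Dom = (KRF.Theta 𝒟 𝒬 star).Dom →
        (∀ π, ∀ ω ∈ p π, ω ∈ (KRF.Theta 𝒟 𝒬 star).Dom) →
        ∃ π ∈ (KRF.Theta 𝒟 𝒬 star).Dom, N.Outputs M.enc π ∧
          ∃ ω ∈ p π, KRF.Theta 𝒟 𝒬 star ω = KRF.Theta 𝒟 𝒬 star π := by
  refine ⟨KRF.exists_isStarTransformation h𝒟 h𝒬, fun star hstar => ?_⟩
  obtain ⟨N, M₀, hN⟩ := hstar.exists_fixedPoint
  refine ⟨N, fun M p hp hdom hran => ?_⟩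
  have hπ : (star (M₀ M)).enc ∈ (KRF.Theta 𝒟 𝒬 star).Dom := ⟨M₀ M, rfl⟩
  have hπ' := hπ
  rw [← hdom, PFun.mem_dom] at hπ'
  obtain ⟨ω, hω⟩ := hπ'
  -- The value of `p` is again a theory, the encoding of `star M'`, so `M₀ M` accepts exactly the
  -- strings that `star M'` accepts.
  obtain ⟨M', rfl⟩ := hran _ ω hω
  refine ⟨_, hπ, (hN M).1, _, hω, ?_⟩
  rw [KRF.Theta_enc, KRF.Theta_enc,
    hstar.acceptedPairs_eq ((hN M).2 (star M') ((hp _ _).2 hω))]
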